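/- Let $\nu$ be a $\sigma$-finite measure on $\mathbb{R}_0=\mathbb{R}\setminus\{0\}$, put $m_p=\int_{\mathbb{R}_0}|z|^p\,\nu(dz)$, and assume $m_2<\infty$. Let $N$ be a Poisson random measure on $Z=\mathbb{R}_+\times\mathbb{R}\times\mathbb{R}_0$ with intensity $\mathfrak{m}=\mathrm{Leb}\times\nu$, defined on a probability space $(\Omega,\mathcal{F},\mathbb{P})$, let $\widehat N=N-\mathfrak{m}$ be its compensation, and let $L(ds,dy)=\int_{\mathbb{R}_0}z\,\widehat N(ds,dy,dz)$ be the associated pure-jump space-time Lévy noise. Let $\mathcal{F}_t$ be generated by the variables $N([0,s]\times A\times B)$ with $s\le t$, $\mathrm{Leb}(A)+\nu(B)<\infty$, and by the $\mathbb{P}$-null sets; predictability refers to this filtration. Let $G_t(x)=\tfrac12\mathbf 1_{\{|x|<t\}}$ (so $G_t=0$ for $t\le 0$), and let $I_n(h)$ denote the $n$-th multiple Wiener–Itô integral of $h\in L^2(Z^n,\mathfrak{m}^{n})$ with respect to $\widehat N$. Write $\|\cdot\|_p$ for the norm of $L^p(\Omega)$. Fix $(r,y,z)\in\mathbb{R}_+\times\mathbb{R}\times\mathbb{R}_0$.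 A solution of the stochastic wave equation $$\partial_t^2 v=\partial_x^2 v+v\dot L\ \ (t>r,\ x\in\mathbb{R}),\qquad v(r,\cdot)=0,\quad \partial_t v(r,\cdot)=z\,\delta_y$$ is a predictable process $v$ with $v(r,x)=0$ for all $x\in\mathbb{R}$ such that, for every $t>r$ and $x\in\mathbb{R}$, the integrand $G_{t-s}(x-y')v(s,y')$ is square integrable on $\Omega\times(r,t)\times\mathbb{R}$ against $m_2\,d\mathbb{P}\,ds\,dy'$ and almost surely $$v(t,x)=G_{t-r}(x-y)\,z+\int_r^t\!\int_{\mathbb{R}}G_{t-s}(x-y')\,v(s,y')\,L(ds,dy'),$$ the stochastic integral being the Itô integral. Then the following hold. (i) The equation has a solution $v=v^{(r,y,z)}$, and it is unique: any other solution $w$ satisfies $w(t,x)=v(t,x)$ almost surely for all $t\ge r$, $x\in\mathbb{R}$. Moreover, for every $p\ge 2$ there is a constant $B_p>0$ depending only on $p$ such that, whenever $m_p<\infty$, for every $T>0$ and all $r\le t\le T$, $x\in\mathbb{R}$, $$\|v^{(r,y,z)}(t,x)\|_p\le C_{T,p,\nu}\,|z|,\qquad C_{T,p,\nu}=\exp\!\big[B_p^p\,(m_2^{p/2}T^p+m_pT^2)\big];$$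 in particular the bound is uniform in $r$, $t$, $x$ and $y$. (ii) For all $t>r$ and $x\in\mathbb{R}$, the following expansion holds, with convergence in $L^2(\Omega)$: $$v^{(r,y,z)}(t,x)=G_{t-r}(x-y)\,z+\sum_{n\ge1}I_n\big(G_{t,x,n+1}(r,y,z;\bullet)\big),$$ where the following kernels belong to $L^2(Z^n,\mathfrak{m}^n)$: $$G_{t,x,n+1}(r,y,z;(t_j,x_j,z_j)_{j\le n})=G_{t-t_n}(x-x_n)\,G_{t_n-t_{n-1}}(x_n-x_{n-1})\cdots G_{t_2-t_1}(x_2-x_1)\,G_{t_1-r}(x_1-y)\;z\prod_{j=1}^n z_j .$$ (iii) For all $t>r$ and $x\in\mathbb{R}$: $v^{(r,y,z)}(t,x)=0$ almost surely if $|x-y|\ge t-r$, and hence $G_{t-r}(x-y)\,v^{(r,y,z)}(t,x)=\tfrac12 v^{(r,y,z)}(t,x)$ almost surely. -/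

import Mathlib

open MeasureTheory ProbabilityTheory Filter
open scoped ENNReal NNReal Topology

namespace LevyWave

noncomputable section

/-- Points `(t, x, z)`. The state space `ℝ₊ × ℝ × (ℝ \ {0})` is encoded as `ℝ × ℝ × ℝ`, carrying a
measure that does not charge `t < 0` (see `intensity`) nor `z = 0` (hypothesis `ν {0} = 0`). -/
abbrev Pt : Type := ℝ × ℝ × ℝ

/-- The intensity measure `Leb × ν` on `ℝ₊ × ℝ × (ℝ \ {0})`. -/
abbrev intensity (ν : Measure ℝ) : Measure Pt :=
  (volume.restrict (Set.Ici (0 : ℝ))).prod ((volume : Measure ℝ).prod ν)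

/-- The absolute moment `m_p = ∫ |z|^p ν(dz) ∈ [0, ∞]`. -/
def levyMoment (ν : Measure ℝ) (p : ℝ) : ℝ≥0∞ := ∫⁻ ζ, ENNReal.ofReal (|ζ| ^ p) ∂ν

/-- The fundamental solution `G_t(x) = (1/2) 1_{|x| < t}`, which vanishes for `t ≤ 0`. -/
def waveG (t x : ℝ) : ℝ := if |x| < t then 1 / 2 else 0

section Noise

variable {Ω : Type*} [MeasurableSpace Ω]

/-- `N` is a Poisson random measure with intensity `μ`: a measurable random element of the
space of `σ`-finite `ℕ ∪ {∞}`-valued measures, with Poisson marginals (`N(A) = ∞` almost surely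
if `μ(A) = ∞`), independent over disjoint sets. -/
structure IsPoissonRandomMeasure {E : Type*} [MeasurableSpace E] (P : Measure Ω)
    (N : Ω → Measure E) (μ : Measure E) : Prop where
  sigmaFinite : ∀ ω, SigmaFinite (N ω)
  integer_valued : ∀ ω, ∀ A, MeasurableSet A → N ω A = ∞ ∨ ∃ k : ℕ, N ω A = (k : ℝ≥0∞)
  measurable : ∀ A, MeasurableSet A → Measurable fun ω => N ω A
  poisson : ∀ A, MeasurableSet A → μ A < ∞ →
    P.map (fun ω => N ω A) =
      (poissonMeasure (μ A).toNNReal).map (fun k : ℕ => (k : ℝ≥0∞))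
  infinite : ∀ A, MeasurableSet A → μ A = ∞ → ∀ᵐ ω ∂P, N ω A = ∞
  indep : ∀ (k : ℕ) (A : Fin k → Set E), (∀ i, MeasurableSet (A i)) →
    Pairwise (fun i j => Disjoint (A i) (A j)) → iIndepFun (fun i ω => N ω (A i)) P

/-- The compensated measure `N̂(A) = N(A) - 𝔪(A)`, used for sets with `𝔪(A) < ∞`. -/
def compensated (N : Ω → Measure Pt) (ν : Measure ℝ) (A : Set Pt) (ω : Ω) : ℝ :=
  (N ω A).toReal - (intensity ν A).toReal

/-- The `σ`-algebra `ℱ_t` generated by `N([0,s] × A × B)`, `s ∈ [0,t]`, `Leb(A) + ν(B) < ∞`,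
and by the `P`-null sets. -/
abbrev noiseSigma (P : Measure Ω) (N : Ω → Measure Pt) (ν : Measure ℝ) (t : ℝ) :
    MeasurableSpace Ω :=
  MeasurableSpace.generateFrom
    ({S | ∃ s : ℝ, 0 ≤ s ∧ s ≤ t ∧ ∃ A B : Set ℝ, MeasurableSet A ∧ MeasurableSet B ∧
        volume A < ∞ ∧ ν B < ∞ ∧ ∃ U : Set ℝ≥0∞, MeasurableSet U ∧
        S = (fun ω => N ω (Set.Icc 0 s ×ˢ A ×ˢ B)) ⁻¹' U} ∪
      {S | MeasurableSet S ∧ P S = 0})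

/-- The predictable `σ`-algebra: generated by the sets `(a,b] × A × Γ × S` with `0 < a < b`,
`Leb(A) + ν(Γ) < ∞` and `S ∈ ℱ_a`. -/
abbrev predictableSigma (P : Measure Ω) (N : Ω → Measure Pt) (ν : Measure ℝ) :
    MeasurableSpace (Pt × Ω) :=
  MeasurableSpace.generateFrom
    {R | ∃ (a b : ℝ) (A Γ : Set ℝ) (S : Set Ω), 0 < a ∧ a < b ∧ MeasurableSet A ∧
        MeasurableSet Γ ∧ volume A < ∞ ∧ ν Γ < ∞ ∧ MeasurableSet[noiseSigma P N ν a] S ∧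
        R = (Set.Ioc a b ×ˢ A ×ˢ Γ) ×ˢ S}

/-- Predictability of a random field `V(t, x, z)`. -/
def IsPredictable (P : Measure Ω) (N : Ω → Measure Pt) (ν : Measure ℝ)
    (V : Pt → Ω → ℝ) : Prop :=
  Measurable[predictableSigma P N ν] (fun q : Pt × Ω => V q.1 q.2)

/-- A finite sum of elementary processes `Y 1_{(a,b]}(t) 1_{A × Γ}(x, z)` with `0 < a < b`,
`Leb(A) + ν(Γ) < ∞` and `Y` bounded and `ℱ_a`-measurable. -/
structure ElementaryProcess (P : Measure Ω) (N : Ω → Measure Pt) (ν : Measure ℝ) where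
  n : ℕ
  a : Fin n → ℝ
  b : Fin n → ℝ
  A : Fin n → Set ℝ
  Γ : Fin n → Set ℝ
  Y : Fin n → Ω → ℝ
  a_pos : ∀ i, 0 < a i
  a_lt_b : ∀ i, a i < b i
  measurableSet_A : ∀ i, MeasurableSet (A i)
  measurableSet_Γ : ∀ i, MeasurableSet (Γ i)
  volume_A : ∀ i, volume (A i) < ∞
  measure_Γ : ∀ i, ν (Γ i) < ∞
  measurable_Y : ∀ i, Measurable[noiseSigma P N ν (a i)] (Y i)
  bounded_Y : ∀ i, ∃ c : ℝ, ∀ ω, |Y i ω| ≤ c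

namespace ElementaryProcess

variable {P : Measure Ω} {N : Ω → Measure Pt} {ν : Measure ℝ}

/-- The set `(a_i, b_i] × A_i × Γ_i`. -/
def box (V : ElementaryProcess P N ν) (i : Fin V.n) : Set Pt :=
  Set.Ioc (V.a i) (V.b i) ×ˢ V.A i ×ˢ V.Γ i

/-- The process itself. -/
def toFun (V : ElementaryProcess P N ν) (ξ : Pt) (ω : Ω) : ℝ :=
  ∑ i, V.Y i ω * (V.box i).indicator (fun _ => (1 : ℝ)) ξ

/-- Its integral `∑ Y_i N̂((a_i, b_i] × A_i × Γ_i)`. -/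
def integral (V : ElementaryProcess P N ν) (ω : Ω) : ℝ :=
  ∑ i, V.Y i ω * compensated N ν (V.box i) ω

end ElementaryProcess

/-- `X` is the Itô integral `∫ V dN̂` of the predictable field `V ∈ L²(𝔪 ⊗ P)`: the `L²(P)`-limit
of the integrals of elementary processes that converge to `V` in `L²(𝔪 ⊗ P)`. -/
structure IsItoIntegral (P : Measure Ω) (N : Ω → Measure Pt) (ν : Measure ℝ)
    (V : Pt → Ω → ℝ) (X : Ω → ℝ) : Prop where
  predictable : IsPredictable P N ν V
  memLp : MemLp (fun q : Pt × Ω => V q.1 q.2) 2 ((intensity ν).prod P)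
  memLp_integral : MemLp X 2 P
  approx : ∃ W : ℕ → ElementaryProcess P N ν,
    Tendsto (fun k => eLpNorm (fun q : Pt × Ω => V q.1 q.2 - (W k).toFun q.1 q.2) 2
      ((intensity ν).prod P)) atTop (𝓝 0) ∧
    Tendsto (fun k => eLpNorm (fun ω => X ω - (W k).integral ω) 2 P) atTop (𝓝 0)

/-- Simple functions of `k` variables in `Pt`,
`∑ β_{i_1, …, i_k} 1_{F_{i_1} × ⋯ × F_{i_k}}`, with pairwise disjoint `F_i = A_i × B_i × C_i` of
finite measure, and `β` vanishing as soon as two indices are equal. -/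
structure SimpleKernel (ν : Measure ℝ) (k : ℕ) where
  m : ℕ
  A : Fin m → Set ℝ
  B : Fin m → Set ℝ
  C : Fin m → Set ℝ
  coeff : (Fin k → Fin m) → ℝ
  measurableSet_A : ∀ i, MeasurableSet (A i)
  measurableSet_B : ∀ i, MeasurableSet (B i)
  measurableSet_C : ∀ i, MeasurableSet (C i)
  finite_measure : ∀ i, intensity ν (A i ×ˢ B i ×ˢ C i) < ∞
  disjoint : Pairwise fun i j => Disjoint (A i ×ˢ B i ×ˢ C i) (A j ×ˢ B j ×ˢ C j)
  coeff_eq_zero : ∀ ι : Fin k → Fin m, ¬ Function.Injective ι → coeff ι = 0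

namespace SimpleKernel

variable {ν : Measure ℝ} {k : ℕ}

/-- The set `F_i = A_i × B_i × C_i`. -/
def box (h : SimpleKernel ν k) (i : Fin h.m) : Set Pt := h.A i ×ˢ h.B i ×ˢ h.C i

/-- The simple function itself. -/
def toFun (h : SimpleKernel ν k) (ξ : Fin k → Pt) : ℝ :=
  ∑ ι : Fin k → Fin h.m, h.coeff ι * ∏ j, (h.box (ι j)).indicator (fun _ => (1 : ℝ)) (ξ j)

/-- Its multiple integral `∑ β_{i_1, …, i_k} ∏ N̂(F_{i_j})`. -/
def integral (h : SimpleKernel ν k) (N : Ω → Measure Pt) (ω : Ω) : ℝ :=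
  ∑ ι : Fin k → Fin h.m, h.coeff ι * ∏ j, compensated N ν (h.box (ι j)) ω

end SimpleKernel

/-- `X` is the multiple Wiener–Itô–Poisson integral `I_k(h)` of `h ∈ L²(𝔪^k)`: the `L²(P)`-limit
of the multiple integrals of simple functions that converge to `h` in `L²(𝔪^k)`. -/
structure IsMultipleIntegral (P : Measure Ω) (N : Ω → Measure Pt) (ν : Measure ℝ) (k : ℕ)
    (h : (Fin k → Pt) → ℝ) (X : Ω → ℝ) : Prop where
  memLp : MemLp h 2 (Measure.pi fun _ : Fin k => intensity ν)
  memLp_integral : MemLp X 2 P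
  approx : ∃ g : ℕ → SimpleKernel ν k,
    Tendsto (fun i => eLpNorm (fun ξ => h ξ - (g i).toFun ξ) 2
      (Measure.pi fun _ : Fin k => intensity ν)) atTop (𝓝 0) ∧
    Tendsto (fun i => eLpNorm (fun ω => X ω - (g i).integral N ω) 2 P) atTop (𝓝 0)

/-- `v` is a (mild) solution on `[r, ∞) × ℝ` of
`∂ₜ² v = ∂ₓ² v + v L̇`, `v(r, ·) = 0`, `∂ₜ v(r, ·) = z δ_y`, where
`L(A) = ∫_{A × (ℝ \ {0})} z' dN̂`: it is predictable, vanishes at time `r`, and for all `t > r` and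
`x` the variable `v(t,x) - G_{t-r}(x-y) z` is the Itô integral with respect to `N̂` of
`(s, y', z') ↦ 1_{(r,t)}(s) G_{t-s}(x-y') v(s,y') z'`. The values of `v` before time `r` play no
role. -/
structure IsSolution (P : Measure Ω) (N : Ω → Measure Pt) (ν : Measure ℝ) (r y z : ℝ)
    (v : ℝ → ℝ → Ω → ℝ) : Prop where
  predictable : IsPredictable P N ν (fun ξ => v ξ.1 ξ.2.1)
  initial : ∀ x ω, v r x ω = 0
  mild : ∀ t x, r < t → ∃ X : Ω → ℝ,
    IsItoIntegral P N ν
      (fun ξ ω => (Set.Ioo r t).indicator (fun _ => (1 : ℝ)) ξ.1 *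
        waveG (t - ξ.1) (x - ξ.2.1) * v ξ.1 ξ.2.1 ω * ξ.2.2) X ∧
    ∀ᵐ ω ∂P, v t x ω = waveG (t - r) (x - y) * z + X ω

end Noise

/-- The kernel
`G_{t-t_n}(x-x_n) G_{t_n-t_{n-1}}(x_n-x_{n-1}) ⋯ G_{t_1-r}(x_1-y) z ∏_{j=1}^n z_j` at
`ξ = ((t_1,x_1,z_1), …, (t_n,x_n,z_n))`, by recursion on `n`, peeling off the last point. -/
def chaosKernel (r y z : ℝ) : (n : ℕ) → (t x : ℝ) → (Fin n → Pt) → ℝ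
  | 0, t, x, _ => waveG (t - r) (x - y) * z
  | n + 1, t, x, ξ =>
      waveG (t - (ξ (Fin.last n)).1) (x - (ξ (Fin.last n)).2.1) * (ξ (Fin.last n)).2.2 *
        chaosKernel r y z n (ξ (Fin.last n)).1 (ξ (Fin.last n)).2.1 (Fin.init ξ)

/-- `C_{T,p,ν} = exp (B^p (m_2^{p/2} T^p + m_p T²))`, for finite `m_2` and `m_p`. -/
def momentConst (B T p : ℝ) (ν : Measure ℝ) : ℝ :=
  Real.exp (B ^ p * ((levyMoment ν 2).toReal ^ (p / 2) * T ^ p + (levyMoment ν p).toReal * T ^ 2))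

end

end LevyWave

set_option linter.unusedSectionVars false

/-! ### Moments of the Poisson distribution. -/

namespace LevyWave

/-! The mild equation is a linear fixed point problem for fields with values in L²(Ω); its Picard
series is at the same time the chaos expansion.

The Itô integral is first built as a closed subspace `itoGraph`: the closure of the span of the
pairs (Y 1_box, Y N̂(box)), with Y square integrable and known at the left time endpoint of the box.
The noise after time a is independent of `noiseSigma P N ν a`, which gives the isometry on
generators (`integral_mul_compensated_box`); bilinearity and continuity extend it to the closure
(`inner_itoGraph`). So an integral is unique, and it exists once the integrand is an L² limit of
integrands in the graph. The integrands G_{t-s}(x-w) z' u(s,w), for u adapted, locally bounded and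
continuous off the light cone of (r,y), are limits of their samples at grid corners
(`waveApprox_tendsto`). This class of fields is stable under stochastic convolution
(`isWaveField_conv`), so Picard iteration stays inside it.

Convergence comes from an exponential weight: if ‖u(s,·)‖² ≤ b e^{ls} and l ≥ 2 m₂ T, the
convolution satisfies the same bound with b/4 (`cone_exp_le`). The Picard terms are thus O(2⁻ⁿ),
locally uniformly, and their sum `solH` solves the equation (`itoRel_solH`). The triangle inequality
propagates vanishing outside the light cone (`picardTerm_eq_zero`). For uniqueness, the second
moment of a difference of two solutions is put through the same contraction (`IsSolution.unique`).

For p-th moments, the cells of a grid are added in order of time. One more centred Poisson variable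
multiplies the p-th moment by 1 + Cw and adds a controlled term, for a free parameter w
(`exists_lintegral_add_poisson_le`). Taking w proportional to the share of the cell in the quadratic
variation keeps the product of all the factors bounded uniformly in the mesh
(`lintegral_grid_sum_le`, `stepWeight_mul_le`). Fatou's lemma passes to the limit, and a Grönwall
type induction on Picard partial sums gives the bound (`lintegral_sum_picardTerm_le`).

For the chaos expansion, on a grid the iterated sums are literally the multiple integrals of step
kernels (`gridKernel_integral`). As the mesh tends to 0, the step kernels converge in L² to the
chaos kernel (`gridKernel_tendsto`) and the iterated sums converge to the Picard terms
(`tendsto_gridChaosH`).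

Finally `solH` needs a predictable version. Its part of order at least one is continuous in L²(Ω),
so step fields converge to it almost surely at each point (`exists_predictable_version`); the
deterministic term of order zero, which jumps across the cone, is added explicitly
(`exists_isSolution`). -/

theorem integrable_pow_poissonMeasure (r : ℝ≥0) (n : ℕ) :
    Integrable (fun k : ℕ => (k : ℝ) ^ n) (poissonMeasure r) := by
  rw [integrable_poissonMeasure_iff]
  have h1 : Summable fun k : ℕ => ((r : ℝ) * Real.exp 1) ^ k / k.factorial :=
    Real.summable_pow_div_factorial _
  refine Summable.of_nonneg_of_le (fun k => by positivity) (fun k => ?_)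
    (h1.mul_left (Real.exp (-r) * n.factorial))
  have h2 : (k : ℝ) ^ n ≤ n.factorial * Real.exp 1 ^ k := by
    have := Real.pow_div_factorial_le_exp (k : ℝ) (by positivity) n
    rw [div_le_iff₀ (by positivity)] at this
    rw [← Real.exp_nat_mul, mul_one]
    linarith
  rw [Real.norm_of_nonneg (by positivity), mul_pow]
  calc Real.exp (-r) * r ^ k / k.factorial * (k : ℝ) ^ n
      ≤ Real.exp (-r) * r ^ k / k.factorial * (n.factorial * Real.exp 1 ^ k) := by gcongr
    _ = _ := by ring

/-- The factor k(k - 1) cancels against k!, so an index shift by two leaves the exponential series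
of rc. At c = 1 this is the second factorial moment. -/
theorem hasSum_poisson_factorial_moment (r : ℝ≥0) (c : ℝ) :
    HasSum (fun k : ℕ => Real.exp (-r) * r ^ k / k.factorial * ((k : ℝ) * (k - 1) * c ^ k))
      ((r * c) ^ 2 * Real.exp (r * (c - 1))) := by
  have h := (NormedSpace.expSeries_div_hasSum_exp ((r : ℝ) * c)).mul_left
    ((r * c) ^ 2 * Real.exp (-r))
  rw [← hasSum_nat_add_iff' 2]
  simp only [Finset.sum_range_succ, Finset.sum_range_zero]
  norm_num
  rw [← Real.exp_eq_exp_ℝ, mul_assoc, ← Real.exp_add] at h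
  convert! h using 1
  · ext k
    have : ((k + 2).factorial : ℝ) = (k + 2) * (k + 1) * k.factorial := by
      rw [Nat.factorial_succ, Nat.factorial_succ]; push_cast; ring
    rw [this]
    field_simp
    ring
  · congr 2; ring

theorem hasSum_poisson_mean (r : ℝ≥0) :
    HasSum (fun k : ℕ => Real.exp (-r) * r ^ k / k.factorial * (k : ℝ)) r := by
  have h := (NormedSpace.expSeries_div_hasSum_exp (r : ℝ)).mul_left (r * Real.exp (-r))
  rw [← hasSum_nat_add_iff' 1]
  simp only [Finset.sum_range_succ, Finset.sum_range_zero]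
  norm_num
  rw [← Real.exp_eq_exp_ℝ, mul_assoc, ← Real.exp_add] at h
  convert! h using 1
  · ext k
    rw [Nat.factorial_succ]
    push_cast
    field_simp
    ring
  · simp

theorem integral_id_poissonMeasure (r : ℝ≥0) : ∫ k, (k : ℝ) ∂poissonMeasure r = r := by
  rw [integral_poissonMeasure]
  simpa using (hasSum_poisson_mean r).tsum_eq

theorem integral_sq_poissonMeasure (r : ℝ≥0) :
    ∫ k, (k : ℝ) ^ 2 ∂poissonMeasure r = r ^ 2 + r := by
  rw [integral_poissonMeasure]
  have := (hasSum_poisson_factorial_moment r 1).add (hasSum_poisson_mean r)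
  simp only [sub_self, mul_zero, Real.exp_zero, mul_one, one_pow] at this
  rw [← this.tsum_eq]
  congr with k
  simp only [smul_eq_mul]
  ring

/-! ### Marginals of a Poisson random measure. -/

section RandomMeasure

variable {Ω E : Type*} [MeasurableSpace Ω] [MeasurableSpace E] {P : Measure Ω}
  {N : Ω → Measure E} {μ : Measure E}

namespace IsPoissonRandomMeasure

theorem ae_lt_top (hN : IsPoissonRandomMeasure P N μ) {F : Set E} (hF : MeasurableSet F)
    (hμ : μ F < ∞) : ∀ᵐ ω ∂P, N ω F < ∞ := by
  have h : P.map (fun ω => N ω F) {∞} = 0 := by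
    rw [hN.poisson F hF hμ, Measure.map_apply .of_discrete (measurableSet_singleton _)]
    convert measure_empty (μ := poissonMeasure (μ F).toNNReal)
    ext k
    simp
  rw [Measure.map_apply (hN.measurable F hF) (measurableSet_singleton _)] at h
  rw [ae_iff]
  convert h using 2
  ext ω
  simp

theorem map_toReal (hN : IsPoissonRandomMeasure P N μ) {F : Set E} (hF : MeasurableSet F)
    (hμ : μ F < ∞) :
    P.map (fun ω => (N ω F).toReal) =
      (poissonMeasure (μ F).toNNReal).map (fun k : ℕ => (k : ℝ)) := by
  have h := congrArg (fun ρ => ρ.map ENNReal.toReal) (hN.poisson F hF hμ)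
  rw [Measure.map_map ENNReal.measurable_toReal (hN.measurable F hF),
    Measure.map_map ENNReal.measurable_toReal .of_discrete] at h
  exact h

theorem measurable_toReal (hN : IsPoissonRandomMeasure P N μ) {F : Set E}
    (hF : MeasurableSet F) : Measurable fun ω => (N ω F).toReal :=
  (hN.measurable F hF).ennreal_toReal

theorem integral_comp (hN : IsPoissonRandomMeasure P N μ) {F : Set E} (hF : MeasurableSet F)
    (hμ : μ F < ∞) {g : ℝ → ℝ} (hg : Measurable g) :
    ∫ ω, g (N ω F).toReal ∂P = ∫ k : ℕ, g k ∂poissonMeasure (μ F).toNNReal := by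
  rw [← integral_map (f := g) (hN.measurable_toReal hF).aemeasurable
    hg.aestronglyMeasurable, hN.map_toReal hF hμ,
    integral_map Measurable.of_discrete.aemeasurable hg.aestronglyMeasurable]

theorem integrable_comp (hN : IsPoissonRandomMeasure P N μ) {F : Set E} (hF : MeasurableSet F)
    (hμ : μ F < ∞) {g : ℝ → ℝ} (hg : Measurable g)
    (h : Integrable (fun k : ℕ => g k) (poissonMeasure (μ F).toNNReal)) :
    Integrable (fun ω => g (N ω F).toReal) P := by
  have h1 : Integrable g (P.map fun ω => (N ω F).toReal) := by
    rw [hN.map_toReal hF hμ, integrable_map_measure hg.aestronglyMeasurable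
      Measurable.of_discrete.aemeasurable]
    exact h
  exact (integrable_map_measure hg.aestronglyMeasurable
    (hN.measurable_toReal hF).aemeasurable).1 h1

theorem memLp_toReal [IsProbabilityMeasure P] (hN : IsPoissonRandomMeasure P N μ) {F : Set E}
    (hF : MeasurableSet F) (hμ : μ F < ∞) {q : ℝ≥0∞} (hq : q ≠ ∞) :
    MemLp (fun ω => (N ω F).toReal) q P := by
  obtain ⟨n, hn⟩ : ∃ n : ℕ, q ≤ ((n + 1 : ℕ) : ℝ≥0∞) := by
    obtain ⟨n, hn⟩ := ENNReal.exists_nat_gt hq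
    exact ⟨n, hn.le.trans (by gcongr; simp)⟩
  refine MemLp.mono_exponent ?_ hn
  rw [← integrable_norm_rpow_iff (hN.measurable_toReal hF).aestronglyMeasurable (by simp)
    (by simp)]
  have := hN.integrable_comp hF hμ (g := fun x => x ^ (n + 1)) (by fun_prop)
    (integrable_pow_poissonMeasure _ _)
  refine this.congr (ae_of_all _ fun ω => ?_)
  simp only [ENNReal.toReal_natCast, Real.rpow_natCast]
  rw [Real.norm_of_nonneg ENNReal.toReal_nonneg]

end IsPoissonRandomMeasure

end RandomMeasure

/-! ### First and second moments of the compensated measure. -/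

section Compensated

variable {Ω : Type*} [MeasurableSpace Ω] {P : Measure Ω}
  {N : Ω → Measure Pt} {ν : Measure ℝ}

theorem measurable_compensated (hN : IsPoissonRandomMeasure P N (intensity ν)) {F : Set Pt}
    (hF : MeasurableSet F) : Measurable (compensated N ν F) :=
  (hN.measurable_toReal hF).sub_const _

theorem memLp_compensated [IsProbabilityMeasure P] (hN : IsPoissonRandomMeasure P N (intensity ν)) {F : Set Pt}
    (hF : MeasurableSet F) (hμ : intensity ν F < ∞) {q : ℝ≥0∞} (hq : q ≠ ∞) :
    MemLp (compensated N ν F) q P :=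
  (hN.memLp_toReal hF hμ hq).sub (memLp_const _)

theorem integral_compensated [IsProbabilityMeasure P] (hN : IsPoissonRandomMeasure P N (intensity ν)) {F : Set Pt}
    (hF : MeasurableSet F) (hμ : intensity ν F < ∞) : ∫ ω, compensated N ν F ω ∂P = 0 := by
  unfold compensated
  rw [integral_sub ((hN.memLp_toReal hF hμ ENNReal.one_ne_top).integrable le_rfl)
    (integrable_const _), hN.integral_comp hF hμ (g := fun x => x) measurable_id,
    integral_id_poissonMeasure]
  simp only [integral_const, probReal_univ, one_smul, ENNReal.coe_toNNReal_eq_toReal, sub_self]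

theorem integral_compensated_sq [IsProbabilityMeasure P] (hN : IsPoissonRandomMeasure P N (intensity ν)) {F : Set Pt}
    (hF : MeasurableSet F) (hμ : intensity ν F < ∞) :
    ∫ ω, compensated N ν F ω ^ 2 ∂P = (intensity ν F).toReal := by
  have h1 := (hN.memLp_toReal hF hμ ENNReal.one_ne_top).integrable le_rfl
  have h2 := (hN.memLp_toReal hF hμ ENNReal.ofNat_ne_top (q := 2)).integrable_sq
  set l := (intensity ν F).toReal with hl
  have : ∀ ω, compensated N ν F ω ^ 2 =
      (N ω F).toReal ^ 2 - (2 * l) * (N ω F).toReal + l ^ 2 := by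
    intro ω; unfold compensated; ring
  simp_rw [this]
  have h3 : Integrable (fun ω => (N ω F).toReal ^ 2 - (2 * l) * (N ω F).toReal) P :=
    h2.sub (h1.const_mul _)
  rw [integral_add h3 (integrable_const _),
    integral_sub h2 (h1.const_mul _), integral_const_mul,
    hN.integral_comp hF hμ (g := fun x => x) measurable_id,
    hN.integral_comp hF hμ (g := fun x => x ^ 2) (by fun_prop),
    integral_id_poissonMeasure, integral_sq_poissonMeasure]
  simp only [ENNReal.coe_toNNReal_eq_toReal, integral_const, probReal_univ, smul_eq_mul, one_mul]
  rw [← hl]; ring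

/-- Additivity is only almost sure: `toReal` is additive on finite values, and N(F), N(F') are
finite off a null set. -/
theorem compensated_union_ae (hN : IsPoissonRandomMeasure P N (intensity ν)) {F F' : Set Pt}
    (hF : MeasurableSet F) (hF' : MeasurableSet F') (hd : Disjoint F F')
    (hμ : intensity ν F < ∞) (hμ' : intensity ν F' < ∞) :
    compensated N ν (F ∪ F') =ᵐ[P] fun ω => compensated N ν F ω + compensated N ν F' ω := by
  filter_upwards [hN.ae_lt_top hF hμ, hN.ae_lt_top hF' hμ'] with ω h h'
  unfold compensated
  rw [measure_union hd hF', measure_union hd hF', ENNReal.toReal_add h.ne h'.ne,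
    ENNReal.toReal_add hμ.ne hμ'.ne]
  ring

end Compensated

end LevyWave

namespace LevyWave

/-! ### Independence of the noise on disjoint regions. -/

section Independence

variable {Ω E : Type*} [MeasurableSpace E]

/-- The events determined by finitely many values `N(F)` with `F ⊆ U`. -/
def cylinderSets (N : Ω → Measure E) (U : Set E) : Set (Set Ω) :=
  {S | ∃ (n : ℕ) (F : Fin n → Set E) (T : Set (Fin n → ℝ≥0∞)),
    (∀ i, MeasurableSet (F i) ∧ F i ⊆ U) ∧ MeasurableSet T ∧
      S = (fun ω i => N ω (F i)) ⁻¹' T}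

theorem isPiSystem_cylinderSets (N : Ω → Measure E) (U : Set E) :
    IsPiSystem (cylinderSets N U) := by
  rintro _ ⟨n, F, T, hF, hT, rfl⟩ _ ⟨n', F', T', hF', hT', rfl⟩ -
  refine ⟨n + n', Fin.append F F', {x | (fun i => x (Fin.castAdd n' i)) ∈ T} ∩
    {x | (fun i => x (Fin.natAdd n i)) ∈ T'}, ?_, ?_, ?_⟩
  · intro i
    refine Fin.addCases (fun i => ?_) (fun i => ?_) i
    · simpa using hF i
    · simpa using hF' i
  · refine MeasurableSet.inter ?_ ?_
    · exact (measurable_pi_lambda _ fun i => measurable_pi_apply _) hT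
    · exact (measurable_pi_lambda _ fun i => measurable_pi_apply _) hT'
  · ext ω
    simp

theorem measurable_apply_cylinderSets (N : Ω → Measure E) {U F : Set E} (hF : MeasurableSet F)
    (hFU : F ⊆ U) : Measurable[MeasurableSpace.generateFrom (cylinderSets N U)]
      (fun ω => N ω F) := by
  intro T hT
  refine MeasurableSpace.measurableSet_generateFrom
    ⟨1, fun _ => F, {x | x 0 ∈ T}, fun _ => ⟨hF, hFU⟩, measurable_pi_apply 0 hT, rfl⟩

/-- The atom of the family `F` in `U` with the given pattern. -/
def atom {E : Type*} {n : ℕ} (U : Set E) (F : Fin n → Set E) (σ : Fin n → Bool) : Set E :=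
  U ∩ ⋂ i, if σ i then F i else (F i)ᶜ

theorem measurableSet_atom {n : ℕ} {U : Set E} {F : Fin n → Set E} (hU : MeasurableSet U)
    (hF : ∀ i, MeasurableSet (F i)) (σ : Fin n → Bool) : MeasurableSet (atom U F σ) := by
  refine hU.inter (MeasurableSet.iInter fun i => ?_)
  split_ifs
  · exact hF i
  · exact (hF i).compl

theorem disjoint_atom {E : Type*} {n : ℕ} (U : Set E) (F : Fin n → Set E) {σ τ : Fin n → Bool}
    (h : σ ≠ τ) : Disjoint (atom U F σ) (atom U F τ) := by
  obtain ⟨i, hi⟩ := Function.ne_iff.1 h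
  rw [Set.disjoint_left]
  rintro x ⟨-, hx⟩ ⟨-, hy⟩
  have h1 := Set.mem_iInter.1 hx i
  have h2 := Set.mem_iInter.1 hy i
  cases hσ : σ i <;> cases hτ : τ i <;> simp_all

theorem measure_eq_sum_atom {n : ℕ} {U : Set E} {F : Fin n → Set E} (hU : MeasurableSet U)
    (hF : ∀ i, MeasurableSet (F i)) (hFU : ∀ i, F i ⊆ U) (ρ : Measure E) (i : Fin n) :
    ρ (F i) = ∑ σ : Fin n → Bool, if σ i then ρ (atom U F σ) else 0 := by
  rw [← Finset.sum_filter, ← measure_biUnion_finset]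
  · congr 1
    ext x
    simp only [Finset.mem_filter, Finset.mem_univ, true_and, Set.mem_iUnion, exists_prop]
    constructor
    · intro hx
      classical
      refine ⟨fun j => decide (x ∈ F j), by simpa using hx, hFU i hx, Set.mem_iInter.2 fun j => ?_⟩
      by_cases hj : x ∈ F j <;> simp [hj]
    · rintro ⟨σ, hσ, -, hx⟩
      simpa [hσ] using Set.mem_iInter.1 hx i
  · intro σ _ τ _ h
    exact disjoint_atom U F h
  · intro σ _
    exact measurableSet_atom hU hF σ

variable [MeasurableSpace Ω] {P : Measure Ω} {N : Ω → Measure E} {μ : Measure E}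

/-- Independence is assumed for disjoint sets only, while the sets of each family may overlap. The
atoms of the two families are pairwise disjoint, hence independent, and each N(F i) is a sum over
atoms on its own side. -/
theorem IsPoissonRandomMeasure.indepFun_tuple (hN : IsPoissonRandomMeasure P N μ)
    {U U' : Set E} (hU : MeasurableSet U) (hU' : MeasurableSet U') (hd : Disjoint U U')
    {n n' : ℕ} {F : Fin n → Set E} {F' : Fin n' → Set E} (hF : ∀ i, MeasurableSet (F i))
    (hF' : ∀ i, MeasurableSet (F' i)) (hFU : ∀ i, F i ⊆ U) (hFU' : ∀ i, F' i ⊆ U') :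
    IndepFun (fun ω i => N ω (F i)) (fun ω i => N ω (F' i)) P := by
  let I := (Fin n → Bool) ⊕ (Fin n' → Bool)
  let A : I → Set E := Sum.elim (atom U F) (atom U' F')
  have hA : ∀ i, MeasurableSet (A i) := by
    rintro (σ | σ)
    · exact measurableSet_atom hU hF σ
    · exact measurableSet_atom hU' hF' σ
  have hAd : Pairwise fun i j => Disjoint (A i) (A j) := by
    rintro (σ | σ) (τ | τ) h
    · exact disjoint_atom U F fun h' => h (congrArg _ h')
    · exact hd.mono Set.inter_subset_left Set.inter_subset_left
    · exact hd.symm.mono Set.inter_subset_left Set.inter_subset_left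
    · exact disjoint_atom U' F' fun h' => h (congrArg _ h')
  let e := Fintype.equivFin I
  have h1 : iIndepFun (fun i ω => N ω (A i)) P := by
    have h := hN.indep _ (A ∘ e.symm) (fun i => hA _)
      (fun i j hij => hAd (e.symm.injective.ne hij))
    have h2 := h.precomp (g := e) e.injective
    simpa using h2
  have h2 := h1.indepFun_finset (Finset.univ.map ⟨Sum.inl, Sum.inl_injective⟩)
    (Finset.univ.map ⟨Sum.inr, Sum.inr_injective⟩)
    (by rw [Finset.disjoint_left]; simp) (fun i => hN.measurable _ (hA i))
  have h3 := h2.comp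
    (φ := fun (x : (Finset.univ.map ⟨Sum.inl, Sum.inl_injective⟩ : Finset I) → ℝ≥0∞)
        (i : Fin n) =>
      ∑ σ : Fin n → Bool, if σ i then x ⟨Sum.inl σ, by simp⟩ else 0)
    (ψ := fun (x : (Finset.univ.map ⟨Sum.inr, Sum.inr_injective⟩ : Finset I) → ℝ≥0∞)
        (i : Fin n') =>
      ∑ σ : Fin n' → Bool, if σ i then x ⟨Sum.inr σ, by simp⟩ else 0)
    (by
      refine measurable_pi_lambda _ fun i => Finset.measurable_sum _ fun σ _ => ?_
      split_ifs
      · exact measurable_pi_apply _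
      · exact measurable_const)
    (by
      refine measurable_pi_lambda _ fun i => Finset.measurable_sum _ fun σ _ => ?_
      split_ifs
      · exact measurable_pi_apply _
      · exact measurable_const)
  convert h3 using 1
  · funext ω i
    exact measure_eq_sum_atom hU hF hFU (N ω) i
  · funext ω i
    exact measure_eq_sum_atom hU' hF' hFU' (N ω) i

theorem IsPoissonRandomMeasure.cylinderSets_le (hN : IsPoissonRandomMeasure P N μ) (U : Set E) :
    MeasurableSpace.generateFrom (cylinderSets N U) ≤ ‹MeasurableSpace Ω› := by
  refine MeasurableSpace.generateFrom_le ?_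
  rintro _ ⟨n, F, T, hF, hT, rfl⟩
  exact (measurable_pi_lambda _ fun i => hN.measurable _ (hF i).1) hT

theorem IsPoissonRandomMeasure.indep_generateFrom_cylinderSets [IsProbabilityMeasure P]
    (hN : IsPoissonRandomMeasure P N μ)
    {U U' : Set E} (hU : MeasurableSet U) (hU' : MeasurableSet U') (hd : Disjoint U U') :
    Indep (MeasurableSpace.generateFrom (cylinderSets N U))
      (MeasurableSpace.generateFrom (cylinderSets N U')) P := by
  refine IndepSets.indep (hN.cylinderSets_le U) (hN.cylinderSets_le U')
    (isPiSystem_cylinderSets N U) (isPiSystem_cylinderSets N U') rfl rfl ?_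
  rw [IndepSets_iff]
  rintro _ _ ⟨n, F, T, hF, hT, rfl⟩ ⟨n', F', T', hF', hT', rfl⟩
  exact (hN.indepFun_tuple hU hU' hd (fun i => (hF i).1) (fun i => (hF' i).1)
    (fun i => (hF i).2) (fun i => (hF' i).2)).meas_inter ⟨T, hT, rfl⟩ ⟨T', hT', rfl⟩

end Independence

/-! ### The filtration and its independence from the future noise. -/

section Filtration

variable {Ω : Type*} [mΩ : MeasurableSpace Ω] {P : Measure Ω}
  {N : Ω → Measure Pt} {ν : Measure ℝ}

theorem noiseSigma_mono (P : Measure Ω) (N : Ω → Measure Pt) (ν : Measure ℝ) {s t : ℝ}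
    (hst : s ≤ t) : noiseSigma P N ν s ≤ noiseSigma P N ν t := by
  refine MeasurableSpace.generateFrom_mono (Set.union_subset_union_left _ ?_)
  rintro _ ⟨u, h0, hu, A, B, h⟩
  exact ⟨u, h0, hu.trans hst, A, B, h⟩

theorem noiseSigma_le (hN : IsPoissonRandomMeasure P N (intensity ν)) (t : ℝ) :
    noiseSigma P N ν t ≤ mΩ := by
  refine MeasurableSpace.generateFrom_le ?_
  rintro _ (⟨s, -, -, A, B, hA, hB, -, -, U, hU, rfl⟩ | h)
  · exact hN.measurable _ (measurableSet_Icc.prod (hA.prod hB)) hU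
  · exact h.1

/-- Isolates the null sets in ℱ_a: each event agrees almost surely with one determined by the noise
up to time a, so null sets do no harm to independence. -/
theorem noiseSigma_le_eventuallyMeasurableSpace (a : ℝ) :
    noiseSigma P N ν a ≤ eventuallyMeasurableSpace
      (MeasurableSpace.generateFrom (cylinderSets N (Set.Iic a ×ˢ (Set.univ : Set (ℝ × ℝ)))))
      (ae P) := by
  refine MeasurableSpace.generateFrom_le ?_
  rintro _ (⟨s, -, hs, A, B, hA, hB, -, -, U, hU, rfl⟩ | h)
  · refine ⟨_, measurable_apply_cylinderSets N (measurableSet_Icc.prod (hA.prod hB)) ?_ hU,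
      EventuallyEq.refl _ _⟩
    exact Set.prod_mono (Set.Icc_subset_Iic_self.trans (Set.Iic_subset_Iic.2 hs))
      (Set.subset_univ _)
  · exact ⟨∅, @MeasurableSet.empty _ (_), ae_eq_empty.2 h.2⟩

theorem noiseSigma_indep [IsProbabilityMeasure P] (hN : IsPoissonRandomMeasure P N (intensity ν))
    (a : ℝ) : Indep (noiseSigma P N ν a)
      (MeasurableSpace.generateFrom (cylinderSets N (Set.Ioi a ×ˢ Set.univ))) P := by
  have hd : Disjoint (Set.Iic a ×ˢ (Set.univ : Set (ℝ × ℝ))) (Set.Ioi a ×ˢ Set.univ) := by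
    rw [Set.disjoint_left]
    rintro x ⟨h1, -⟩ ⟨h2, -⟩
    exact absurd (Set.mem_Iic.1 h1) (not_le.2 h2)
  have hI := hN.indep_generateFrom_cylinderSets (measurableSet_Iic.prod MeasurableSet.univ)
    (measurableSet_Ioi.prod MeasurableSet.univ) hd
  rw [Indep_iff] at hI ⊢
  intro S S' hS hS'
  obtain ⟨R, hR, hRS⟩ := noiseSigma_le_eventuallyMeasurableSpace a S hS
  rw [measure_congr hRS, ← hI R S' hR hS']
  exact measure_congr (hRS.inter (EventuallyEq.refl _ _))

/-- `Y` is almost surely equal to an `ℱ_a`-measurable variable. -/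
abbrev AdaptedAt (P : Measure Ω) (N : Ω → Measure Pt) (ν : Measure ℝ) (a : ℝ) (Y : Ω → ℝ) : Prop :=
  AEStronglyMeasurable[noiseSigma P N ν a] Y P

theorem AdaptedAt.mono {a b : ℝ} (hab : a ≤ b) {Y : Ω → ℝ} (hY : AdaptedAt P N ν a Y) :
    AdaptedAt P N ν b Y :=
  AEStronglyMeasurable.mono (noiseSigma_mono P N ν hab) hY

theorem AdaptedAt.indepFun [IsProbabilityMeasure P]
    (hN : IsPoissonRandomMeasure P N (intensity ν)) {a : ℝ} {Y : Ω → ℝ}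
    (hY : AdaptedAt P N ν a Y) {Z : Ω → ℝ}
    (hZ : Measurable[MeasurableSpace.generateFrom
      (cylinderSets N (Set.Ioi a ×ˢ (Set.univ : Set (ℝ × ℝ))))] Z) : IndepFun Y Z P := by
  obtain ⟨Y', hY', hYY'⟩ := hY
  refine IndepFun.congr ?_ hYY'.symm (EventuallyEq.refl _ _)
  rw [IndepFun_iff_Indep]
  exact indep_of_indep_of_le (noiseSigma_indep hN a) hY'.measurable.comap_le hZ.comap_le

theorem measurable_compensated_cylinderSets {Ω : Type*} (N : Ω → Measure Pt) (ν : Measure ℝ)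
    {U F : Set Pt} (hF : MeasurableSet F) (hFU : F ⊆ U) :
    Measurable[MeasurableSpace.generateFrom (cylinderSets N U)] (compensated N ν F) :=
  (measurable_apply_cylinderSets N hF hFU).ennreal_toReal.sub_const _

/-- A rectangle `A × Γ` in space of finite measure. -/
structure FiniteRect (ν : Measure ℝ) (A Γ : Set ℝ) : Prop where
  measA : MeasurableSet A
  measΓ : MeasurableSet Γ
  volA : volume A < ∞
  nuΓ : ν Γ < ∞

theorem FiniteRect.measurableSet {A Γ : Set ℝ} (h : FiniteRect ν A Γ) {I : Set ℝ}
    (hI : MeasurableSet I) : MeasurableSet (I ×ˢ A ×ˢ Γ) :=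
  hI.prod (h.measA.prod h.measΓ)

variable [SigmaFinite ν]

theorem FiniteRect.intensity_lt_top {A Γ : Set ℝ} (h : FiniteRect ν A Γ) {I : Set ℝ}
    (hI : volume I < ∞) : intensity ν (I ×ˢ A ×ˢ Γ) < ∞ := by
  rw [intensity, Measure.prod_prod, Measure.prod_prod]
  exact ENNReal.mul_lt_top ((Measure.restrict_apply_le _ _).trans_lt hI)
    (ENNReal.mul_lt_top h.volA h.nuΓ)

/-- The filtration is generated by N([0,s] × A × B), so N((a,b] × A × Γ) has to be written as a
difference of two such values. This is legitimate where they are finite, that is, almost surely. -/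
theorem adaptedAt_compensated (hN : IsPoissonRandomMeasure P N (intensity ν)) {a b c : ℝ}
    (ha : 0 ≤ a) (hab : a ≤ b) (hbc : b ≤ c) {A Γ : Set ℝ} (h : FiniteRect ν A Γ) :
    AdaptedAt P N ν c (compensated N ν (Set.Ioc a b ×ˢ A ×ˢ Γ)) := by
  have hm : ∀ s, 0 ≤ s → s ≤ c →
      Measurable[noiseSigma P N ν c] (fun ω => N ω (Set.Icc 0 s ×ˢ A ×ˢ Γ)) := by
    intro s h0 hs U hU
    exact MeasurableSpace.measurableSet_generateFrom
      (Or.inl ⟨s, h0, hs, A, Γ, h.measA, h.measΓ, h.volA, h.nuΓ, U, hU, rfl⟩)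
  refine ⟨fun ω => (N ω (Set.Icc 0 b ×ˢ A ×ˢ Γ)).toReal - (N ω (Set.Icc 0 a ×ˢ A ×ˢ Γ)).toReal -
    (intensity ν (Set.Ioc a b ×ˢ A ×ˢ Γ)).toReal, ?_, ?_⟩
  · exact (((hm b (ha.trans hab) hbc).ennreal_toReal.sub
      (hm a ha (hab.trans hbc)).ennreal_toReal).sub_const _).stronglyMeasurable
  · filter_upwards [hN.ae_lt_top (h.measurableSet (measurableSet_Icc (a := 0) (b := a)))
      (h.intensity_lt_top (by simp)), hN.ae_lt_top
      (h.measurableSet (measurableSet_Ioc (a := a) (b := b)))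
      (h.intensity_lt_top (by simp))] with ω h1 h2
    have hu : Set.Icc 0 b ×ˢ A ×ˢ Γ = Set.Icc 0 a ×ˢ A ×ˢ Γ ∪ Set.Ioc a b ×ˢ A ×ˢ Γ := by
      rw [← Set.union_prod, Set.Icc_union_Ioc_eq_Icc ha hab]
    have hd : Disjoint (Set.Icc 0 a ×ˢ A ×ˢ Γ) (Set.Ioc a b ×ˢ A ×ˢ Γ) := by
      rw [Set.disjoint_left]
      rintro x ⟨h1, -⟩ ⟨h2, -⟩
      exact absurd h1.2 (not_le.2 h2.1)
    unfold compensated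
    rw [hu, measure_union hd (h.measurableSet measurableSet_Ioc), ENNReal.toReal_add h1.ne h2.ne]
    ring

end Filtration

/-! ### Covariances of elementary stochastic integrals. -/

section Products

variable {Ω : Type*} [mΩ : MeasurableSpace Ω] {P : Measure Ω} [IsProbabilityMeasure P]
  {N : Ω → Measure Pt} {ν : Measure ℝ}

theorem memLp_two_mul_of_indepFun {Y Z : Ω → ℝ} (h : IndepFun Y Z P) (hY : MemLp Y 2 P)
    (hZ : MemLp Z 2 P) : MemLp (fun ω => Y ω * Z ω) 2 P := by
  rw [memLp_two_iff_integrable_sq (show AEStronglyMeasurable (fun ω => Y ω * Z ω) P from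
    hY.1.mul hZ.1)]
  have h2 : IndepFun (fun ω => Y ω ^ 2) (fun ω => Z ω ^ 2) P :=
    h.comp (φ := fun x => x ^ 2) (ψ := fun x => x ^ 2) (by fun_prop) (by fun_prop)
  refine (h2.integrable_mul hY.integrable_sq hZ.integrable_sq).congr (ae_of_all _ fun ω => ?_)
  simp [mul_pow]

/-- Polarisation: the variance of N̂(F ∪ F') is 𝔪(F) + 𝔪(F'), which leaves no room for a cross term.
-/
theorem integral_mul_compensated_of_disjoint (hN : IsPoissonRandomMeasure P N (intensity ν))
    {F F' : Set Pt} (hF : MeasurableSet F) (hF' : MeasurableSet F') (hd : Disjoint F F')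
    (hμ : intensity ν F < ∞) (hμ' : intensity ν F' < ∞) :
    ∫ ω, compensated N ν F ω * compensated N ν F' ω ∂P = 0 := by
  have h1 := memLp_compensated hN hF hμ ENNReal.ofNat_ne_top (q := 2)
  have h2 := memLp_compensated hN hF' hμ' ENNReal.ofNat_ne_top (q := 2)
  have hu : intensity ν (F ∪ F') < ∞ := measure_union_lt_top hμ hμ'
  have key := integral_compensated_sq hN (hF.union hF') hu
  have : (fun ω => compensated N ν (F ∪ F') ω ^ 2) =ᵐ[P] fun ω =>
      compensated N ν F ω ^ 2 + (compensated N ν F' ω ^ 2 +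
        2 * (compensated N ν F ω * compensated N ν F' ω)) := by
    filter_upwards [compensated_union_ae hN hF hF' hd hμ hμ'] with ω hω
    rw [hω]; ring
  have h3 : Integrable (fun ω => 2 * (compensated N ν F ω * compensated N ν F' ω)) P :=
    (h1.integrable_mul h2).const_mul 2
  have h4 : Integrable (fun ω => compensated N ν F' ω ^ 2 +
      2 * (compensated N ν F ω * compensated N ν F' ω)) P := h2.integrable_sq.add h3
  rw [integral_congr_ae this, integral_add h1.integrable_sq h4,
    integral_add h2.integrable_sq h3, integral_compensated_sq hN hF hμ,
    integral_compensated_sq hN hF' hμ', integral_const_mul, measure_union hd hF',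
    ENNReal.toReal_add hμ.ne hμ'.ne] at key
  linarith

theorem integral_mul_compensated (hN : IsPoissonRandomMeasure P N (intensity ν))
    {F F' : Set Pt} (hF : MeasurableSet F) (hF' : MeasurableSet F')
    (hμ : intensity ν F < ∞) (hμ' : intensity ν F' < ∞) :
    ∫ ω, compensated N ν F ω * compensated N ν F' ω ∂P = (intensity ν (F ∩ F')).toReal := by
  have hC := hF.inter hF'
  have hD := hF.diff hF'
  have hD' := hF'.diff hF
  have fC : intensity ν (F ∩ F') < ∞ := (measure_mono Set.inter_subset_left).trans_lt hμ
  have fD : intensity ν (F \ F') < ∞ := (measure_mono Set.sdiff_subset).trans_lt hμ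
  have fD' : intensity ν (F' \ F) < ∞ := (measure_mono Set.sdiff_subset).trans_lt hμ'
  have dCD : Disjoint (F ∩ F') (F \ F') := Set.disjoint_sdiff_right.mono_left Set.inter_subset_right
  have dCD' : Disjoint (F ∩ F') (F' \ F) := Set.disjoint_sdiff_right.mono_left Set.inter_subset_left
  have dDD' : Disjoint (F \ F') (F' \ F) := Set.disjoint_sdiff_right.mono_left Set.sdiff_subset
  have e1 := compensated_union_ae hN hC hD dCD fC fD
  have e2 := compensated_union_ae hN hC hD' dCD' fC fD'
  rw [Set.inter_union_sdiff] at e1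
  rw [Set.inter_comm, Set.inter_union_sdiff, Set.inter_comm] at e2
  have mC := memLp_compensated hN hC fC ENNReal.ofNat_ne_top (q := 2)
  have mD := memLp_compensated hN hD fD ENNReal.ofNat_ne_top (q := 2)
  have mD' := memLp_compensated hN hD' fD' ENNReal.ofNat_ne_top (q := 2)
  set c := compensated N ν (F ∩ F')
  set d := compensated N ν (F \ F')
  set d' := compensated N ν (F' \ F)
  have : (fun ω => compensated N ν F ω * compensated N ν F' ω) =ᵐ[P] fun ω =>
      c ω ^ 2 + (c ω * d' ω + (c ω * d ω + d ω * d' ω)) := by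
    filter_upwards [e1, e2] with ω h1 h2
    rw [h1, h2]; ring
  have i1 : Integrable (fun ω => c ω * d' ω) P := mC.integrable_mul mD'
  have i2 : Integrable (fun ω => c ω * d ω) P := mC.integrable_mul mD
  have i3 : Integrable (fun ω => d ω * d' ω) P := mD.integrable_mul mD'
  have i4 : Integrable (fun ω => c ω * d ω + d ω * d' ω) P := i2.add i3
  have i5 : Integrable (fun ω => c ω * d' ω + (c ω * d ω + d ω * d' ω)) P := i1.add i4
  rw [integral_congr_ae this, integral_add mC.integrable_sq i5, integral_add i1 i4, integral_add i2 i3,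
    integral_mul_compensated_of_disjoint hN hC hD dCD fC fD,
    integral_mul_compensated_of_disjoint hN hC hD' dCD' fC fD',
    integral_mul_compensated_of_disjoint hN hD hD' dDD' fD fD',
    integral_compensated_sq hN hC fC]
  simp

theorem AdaptedAt.indepFun_compensated (hN : IsPoissonRandomMeasure P N (intensity ν)) {a : ℝ}
    {Y : Ω → ℝ} (hY : AdaptedAt P N ν a Y) {F : Set Pt} (hF : MeasurableSet F)
    (hFa : F ⊆ Set.Ioi a ×ˢ Set.univ) : IndepFun Y (compensated N ν F) P :=
  hY.indepFun hN (measurable_compensated_cylinderSets N ν hF hFa)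

/-- Hölder would give only L¹ here. Independence of Y and N̂(F) makes the second moment of the
product factor, so no boundedness of Y is needed. -/
theorem AdaptedAt.memLp_mul_compensated (hN : IsPoissonRandomMeasure P N (intensity ν)) {a : ℝ}
    {Y : Ω → ℝ} (hY : AdaptedAt P N ν a Y) (hY2 : MemLp Y 2 P) {F : Set Pt}
    (hF : MeasurableSet F) (hμ : intensity ν F < ∞) (hFa : F ⊆ Set.Ioi a ×ˢ Set.univ) :
    MemLp (fun ω => Y ω * compensated N ν F ω) 2 P :=
  memLp_two_mul_of_indepFun (hY.indepFun_compensated hN hF hFa) hY2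
    (memLp_compensated hN hF hμ ENNReal.ofNat_ne_top)

/-- `E[Y N̂(F)] = 0` for `Y` measurable with respect to the past of `F`. -/
theorem AdaptedAt.integral_mul_compensated_eq_zero
    (hN : IsPoissonRandomMeasure P N (intensity ν)) {a : ℝ}
    {Y : Ω → ℝ} (hY : AdaptedAt P N ν a Y) {F : Set Pt}
    (hF : MeasurableSet F) (hμ : intensity ν F < ∞) (hFa : F ⊆ Set.Ioi a ×ˢ Set.univ) :
    ∫ ω, Y ω * compensated N ν F ω ∂P = 0 := by
  by_cases hm : AEStronglyMeasurable Y P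
  · rw [(hY.indepFun_compensated hN hF hFa).integral_fun_mul_eq_mul_integral hm
      (measurable_compensated hN hF).aestronglyMeasurable, integral_compensated hN hF hμ, mul_zero]
  · exact absurd (AEStronglyMeasurable.mono (noiseSigma_le hN a) hY) hm

theorem AdaptedAt.integral_mul_compensated_mul
    (hN : IsPoissonRandomMeasure P N (intensity ν)) {a : ℝ}
    {Y : Ω → ℝ} (hY : AdaptedAt P N ν a Y) {F F' : Set Pt}
    (hF : MeasurableSet F) (hF' : MeasurableSet F') (hμ : intensity ν F < ∞)
    (hμ' : intensity ν F' < ∞) (hFa : F ⊆ Set.Ioi a ×ˢ Set.univ)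
    (hFa' : F' ⊆ Set.Ioi a ×ˢ Set.univ) :
    ∫ ω, Y ω * (compensated N ν F ω * compensated N ν F' ω) ∂P =
      (∫ ω, Y ω ∂P) * (intensity ν (F ∩ F')).toReal := by
  have hi : IndepFun Y (fun ω => compensated N ν F ω * compensated N ν F' ω) P :=
    hY.indepFun hN ((measurable_compensated_cylinderSets N ν hF hFa).mul
      (measurable_compensated_cylinderSets N ν hF' hFa'))
  rw [hi.integral_fun_mul_eq_mul_integral (AEStronglyMeasurable.mono (noiseSigma_le hN a) hY)
    ((measurable_compensated hN hF).mul (measurable_compensated hN hF')).aestronglyMeasurable,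
    integral_mul_compensated hN hF hF' hμ hμ']

variable [SigmaFinite ν]

theorem Ioc_prod_subset_Ioi {a a' b : ℝ} (h : a ≤ a') (C : Set (ℝ × ℝ)) :
    Set.Ioc a' b ×ˢ C ⊆ Set.Ioi a ×ˢ Set.univ :=
  Set.prod_mono (fun _ hx => h.trans_lt hx.1) (Set.subset_univ _)

/-- The covariance of two elementary stochastic integrals. -/
theorem integral_mul_compensated_box_of_le (hN : IsPoissonRandomMeasure P N (intensity ν))
    {a b a' b' : ℝ} {A Γ A' Γ' : Set ℝ} {Y Y' : Ω → ℝ} (ha : 0 ≤ a) (hab : a ≤ b) (haa' : a ≤ a')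
    (h : FiniteRect ν A Γ) (h' : FiniteRect ν A' Γ')
    (hY : AdaptedAt P N ν a Y) (hY' : AdaptedAt P N ν a' Y')
    (hY2 : MemLp Y 2 P) (hY2' : MemLp Y' 2 P) :
    ∫ ω, (Y ω * compensated N ν (Set.Ioc a b ×ˢ A ×ˢ Γ) ω) *
      (Y' ω * compensated N ν (Set.Ioc a' b' ×ˢ A' ×ˢ Γ') ω) ∂P =
    (∫ ω, Y ω * Y' ω ∂P) *
      (intensity ν ((Set.Ioc a b ×ˢ A ×ˢ Γ) ∩ (Set.Ioc a' b' ×ˢ A' ×ˢ Γ'))).toReal := by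
  set B' := Set.Ioc a' b' ×ˢ A' ×ˢ Γ' with hB'
  -- The first box is cut at time a'. Its part `B1` lies in the past of the second box, while `B2`
  -- and `B'` both lie after a'.
  set B1 := Set.Ioc a (min b a') ×ˢ A ×ˢ Γ with hB1
  set B2 := Set.Ioc (max a a') b ×ˢ A ×ˢ Γ with hB2
  have m1 : MeasurableSet B1 := h.measurableSet measurableSet_Ioc
  have m2 : MeasurableSet B2 := h.measurableSet measurableSet_Ioc
  have m' : MeasurableSet B' := h'.measurableSet measurableSet_Ioc
  have f1 : intensity ν B1 < ∞ := h.intensity_lt_top (by simp)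
  have f2 : intensity ν B2 < ∞ := h.intensity_lt_top (by simp)
  have f' : intensity ν B' < ∞ := h'.intensity_lt_top (by simp)
  have hu : Set.Ioc a b ×ˢ A ×ˢ Γ = B1 ∪ B2 := by
    rw [hB1, hB2, ← Set.union_prod]
    congr 1
    ext s
    simp only [Set.mem_Ioc, Set.mem_union, le_min_iff, max_lt_iff]
    constructor
    · rintro ⟨h1, h2⟩
      rcases le_or_gt s a' with h3 | h3
      · exact Or.inl ⟨h1, h2, h3⟩
      · exact Or.inr ⟨⟨h1, h3⟩, h2⟩
    · rintro (⟨h1, h2, -⟩ | ⟨⟨h1, -⟩, h2⟩) <;> exact ⟨h1, h2⟩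
  have hd : Disjoint B1 B2 := by
    rw [Set.disjoint_left]
    rintro x ⟨h1, -⟩ ⟨h2, -⟩
    exact absurd (h1.2.trans (min_le_right _ _)) (not_le.2 ((le_max_right _ _).trans_lt h2.1))
  have s2 : B2 ⊆ Set.Ioi a' ×ˢ Set.univ := Ioc_prod_subset_Ioi (le_max_right _ _) _
  have s' : B' ⊆ Set.Ioi a' ×ˢ Set.univ := Ioc_prod_subset_Ioi le_rfl _
  have h_int : (B1 ∪ B2) ∩ B' = B2 ∩ B' := by
    rw [Set.union_inter_distrib_right]
    have : B1 ∩ B' = ∅ := by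
      rw [← Set.disjoint_iff_inter_eq_empty, Set.disjoint_left]
      rintro x ⟨h1, -⟩ ⟨h2, -⟩
      exact absurd (h1.2.trans (min_le_right _ _)) (not_le.2 h2.1)
    rw [this, Set.empty_union]
  rw [hu, h_int]
  have mY1 : MemLp (fun ω => Y ω * compensated N ν B1 ω) 2 P :=
    hY.memLp_mul_compensated hN hY2 m1 f1 (Ioc_prod_subset_Ioi le_rfl _)
  have mY2 : MemLp (fun ω => Y ω * compensated N ν B2 ω) 2 P :=
    hY.memLp_mul_compensated hN hY2 m2 f2 (Ioc_prod_subset_Ioi (le_max_left _ _) _)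
  have mY' : MemLp (fun ω => Y' ω * compensated N ν B' ω) 2 P :=
    hY'.memLp_mul_compensated hN hY2' m' f' s'
  have e : (fun ω => (Y ω * compensated N ν (B1 ∪ B2) ω) * (Y' ω * compensated N ν B' ω)) =ᵐ[P]
      fun ω => (Y ω * compensated N ν B1 ω) * (Y' ω * compensated N ν B' ω) +
        (Y ω * compensated N ν B2 ω) * (Y' ω * compensated N ν B' ω) := by
    filter_upwards [compensated_union_ae hN m1 m2 hd f1 f2] with ω hω
    rw [hω]; ring
  have i1 : Integrable (fun ω => (Y ω * compensated N ν B1 ω) * (Y' ω * compensated N ν B' ω)) P :=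
    mY1.integrable_mul mY'
  have i2 : Integrable (fun ω => (Y ω * compensated N ν B2 ω) * (Y' ω * compensated N ν B' ω)) P :=
    mY2.integrable_mul mY'
  rw [integral_congr_ae e, integral_add i1 i2]
  -- Everything except N̂(B') is known at time a', and N̂(B') is centred and independent of it.
  have z1 : ∫ ω, (Y ω * compensated N ν B1 ω) * (Y' ω * compensated N ν B' ω) ∂P = 0 := by
    have ad : AdaptedAt P N ν a' (fun ω => (Y ω * compensated N ν B1 ω) * Y' ω) :=
      ((hY.mono haa').mul (adaptedAt_compensated hN ha (le_min hab haa') (min_le_right _ _) h)).mul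
        hY'
    rw [← ad.integral_mul_compensated_eq_zero hN m' f' s']
    congr with ω
    ring
  have z2 : ∫ ω, (Y ω * compensated N ν B2 ω) * (Y' ω * compensated N ν B' ω) ∂P =
      (∫ ω, Y ω * Y' ω ∂P) * (intensity ν (B2 ∩ B')).toReal := by
    have ad : AdaptedAt P N ν a' (fun ω => Y ω * Y' ω) := (hY.mono haa').mul hY'
    rw [← ad.integral_mul_compensated_mul hN m2 m' f2 f' s2 s']
    congr with ω
    ring
  rw [z1, z2, zero_add]

theorem integral_mul_compensated_box (hN : IsPoissonRandomMeasure P N (intensity ν))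
    {a b a' b' : ℝ} {A Γ A' Γ' : Set ℝ} {Y Y' : Ω → ℝ} (ha : 0 ≤ a) (hab : a ≤ b)
    (ha' : 0 ≤ a') (hab' : a' ≤ b')
    (h : FiniteRect ν A Γ) (h' : FiniteRect ν A' Γ')
    (hY : AdaptedAt P N ν a Y) (hY' : AdaptedAt P N ν a' Y')
    (hY2 : MemLp Y 2 P) (hY2' : MemLp Y' 2 P) :
    ∫ ω, (Y ω * compensated N ν (Set.Ioc a b ×ˢ A ×ˢ Γ) ω) *
      (Y' ω * compensated N ν (Set.Ioc a' b' ×ˢ A' ×ˢ Γ') ω) ∂P =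
    (∫ ω, Y ω * Y' ω ∂P) *
      (intensity ν ((Set.Ioc a b ×ˢ A ×ˢ Γ) ∩ (Set.Ioc a' b' ×ˢ A' ×ˢ Γ'))).toReal := by
  rcases le_total a a' with haa' | haa'
  · exact integral_mul_compensated_box_of_le hN ha hab haa' h h' hY hY' hY2 hY2'
  · rw [Set.inter_comm]
    simp_rw [fun ω => mul_comm (Y ω * compensated N ν (Set.Ioc a b ×ˢ A ×ˢ Γ) ω)
      (Y' ω * compensated N ν (Set.Ioc a' b' ×ˢ A' ×ˢ Γ') ω), fun ω => mul_comm (Y ω) (Y' ω)]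
    exact integral_mul_compensated_box_of_le hN ha' hab' haa' h' h hY' hY hY2' hY2

end Products

end LevyWave

namespace LevyWave

/-! ### The Itô integral as an isometric closed graph in L². -/

section ItoGraph

variable {Ω : Type*} [mΩ : MeasurableSpace Ω]

/-- The Hilbert space `L²(Ω)`. -/
abbrev HSp (P : Measure Ω) : Type _ := Lp ℝ 2 P

variable {P : Measure Ω} {N : Ω → Measure Pt} {ν : Measure ℝ}

theorem inner_toLp {f g : Ω → ℝ} (hf : MemLp f 2 P) (hg : MemLp g 2 P) :
    inner ℝ (hf.toLp f) (hg.toLp g) = ∫ ω, f ω * g ω ∂P := by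
  rw [L2.inner_def]
  refine integral_congr_ae ?_
  filter_upwards [hf.coeFn_toLp, hg.coeFn_toLp] with ω h1 h2
  rw [h1, h2]
  simp [mul_comm]

/-- The pairs formed by an elementary integrand on one box, with square integrable coefficient,
and its integral. -/
def itoGenerators (P : Measure Ω) (N : Ω → Measure Pt) (ν : Measure ℝ) :
    Set (Lp (HSp P) 2 (intensity ν) × HSp P) :=
  {g | ∃ (a b : ℝ) (A Γ : Set ℝ) (Y : Ω → ℝ) (_ : 0 ≤ a) (_ : a ≤ b) (_ : FiniteRect ν A Γ)
    (_ : AdaptedAt P N ν a Y) (hY : MemLp Y 2 P)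
    (hm : MeasurableSet (Set.Ioc a b ×ˢ A ×ˢ Γ)) (hf : intensity ν (Set.Ioc a b ×ˢ A ×ˢ Γ) ≠ ∞)
    (hX : MemLp (fun ω => Y ω * compensated N ν (Set.Ioc a b ×ˢ A ×ˢ Γ) ω) 2 P),
    g = (indicatorConstLp 2 hm hf (hY.toLp Y), hX.toLp _)}

/-- The graph of the Itô integral, as a closed subspace. -/
noncomputable def itoGraph (P : Measure Ω) (N : Ω → Measure Pt) (ν : Measure ℝ) :
    Submodule ℝ (Lp (HSp P) 2 (intensity ν) × HSp P) :=
  (Submodule.span ℝ (itoGenerators P N ν)).topologicalClosure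

/-- The Itô isometry in polarised form. Overlapping boxes are covered by the covariance formula, so
no common refinement of elementary processes is ever needed. -/
theorem inner_itoGenerators [IsProbabilityMeasure P] [SigmaFinite ν]
    (hN : IsPoissonRandomMeasure P N (intensity ν))
    {g g' : Lp (HSp P) 2 (intensity ν) × HSp P} (hg : g ∈ itoGenerators P N ν)
    (hg' : g' ∈ itoGenerators P N ν) :
    inner ℝ g.1 g'.1 = inner ℝ g.2 g'.2 := by
  obtain ⟨a, b, A, Γ, Y, ha, hab, hR, hYa, hY, hm, hf, hX, rfl⟩ := hg
  obtain ⟨a', b', A', Γ', Y', ha', hab', hR', hYa', hY', hm', hf', hX', rfl⟩ := hg'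
  simp only
  rw [L2.inner_indicatorConstLp_indicatorConstLp hm hm' hf hf', inner_toLp, inner_toLp,
    integral_mul_compensated_box hN ha hab ha' hab' hR hR' hYa hYa' hY hY', smul_eq_mul, mul_comm,
    measureReal_def]

/-- Bilinearity carries the identity from generators to their span; continuity carries it to the
closure, one argument at a time. -/
theorem inner_itoGraph [IsProbabilityMeasure P] [SigmaFinite ν]
    (hN : IsPoissonRandomMeasure P N (intensity ν))
    {g g' : Lp (HSp P) 2 (intensity ν) × HSp P} (hg : g ∈ itoGraph P N ν)
    (hg' : g' ∈ itoGraph P N ν) :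
    inner ℝ g.1 g'.1 = inner ℝ g.2 g'.2 := by
  have h0 : ∀ g ∈ Submodule.span ℝ (itoGenerators P N ν),
      ∀ g' ∈ Submodule.span ℝ (itoGenerators P N ν), inner ℝ g.1 g'.1 = inner ℝ g.2 g'.2 := by
    intro g hg g' hg'
    induction hg, hg' using Submodule.span_induction₂ with
    | mem_mem x y hx hy => exact inner_itoGenerators hN hx hy
    | zero_left y hy => simp
    | zero_right x hx => simp
    | add_left x y z _ _ _ h1 h2 => simp [inner_add_left, h1, h2]
    | add_right x y z _ _ _ h1 h2 => simp [inner_add_right, h1, h2]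
    | smul_left r x y _ _ h => simp [inner_smul_left, h]
    | smul_right r x y _ _ h => simp [inner_smul_right, h]
  have h1 : ∀ g ∈ Submodule.span ℝ (itoGenerators P N ν),
      ∀ g' ∈ itoGraph P N ν, inner ℝ g.1 g'.1 = inner ℝ g.2 g'.2 := by
    intro g hg g' hg'
    refine closure_minimal (s := (Submodule.span ℝ (itoGenerators P N ν) : Set (Lp (HSp P) 2 (intensity ν) × HSp P)))
      (t := {g' : Lp (HSp P) 2 (intensity ν) × HSp P | inner ℝ g.1 g'.1 = inner ℝ g.2 g'.2}) (fun g' hg' => h0 g hg g' hg') ?_ hg'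
    exact isClosed_eq (by fun_prop) (by fun_prop)
  refine closure_minimal (s := (Submodule.span ℝ (itoGenerators P N ν) : Set (Lp (HSp P) 2 (intensity ν) × HSp P)))
      (t := {g : Lp (HSp P) 2 (intensity ν) × HSp P | inner ℝ g.1 g'.1 = inner ℝ g.2 g'.2}) (fun g hg => h1 g hg g' hg') ?_ hg
  exact isClosed_eq (by fun_prop) (by fun_prop)

theorem norm_itoGraph [IsProbabilityMeasure P] [SigmaFinite ν]
    (hN : IsPoissonRandomMeasure P N (intensity ν))
    {g : Lp (HSp P) 2 (intensity ν) × HSp P} (hg : g ∈ itoGraph P N ν) : ‖g.2‖ = ‖g.1‖ := by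
  have := inner_itoGraph hN hg hg
  rw [real_inner_self_eq_norm_sq, real_inner_self_eq_norm_sq] at this
  exact (sq_eq_sq₀ (norm_nonneg _) (norm_nonneg _)).1 this.symm

/-- `X` is the Itô integral of the Hilbert space valued integrand `V`. -/
def ItoRel (P : Measure Ω) (N : Ω → Measure Pt) (ν : Measure ℝ) (V : Pt → HSp P) (X : HSp P) :
    Prop :=
  ∃ hV : MemLp V 2 (intensity ν), (hV.toLp V, X) ∈ itoGraph P N ν

namespace ItoRel

theorem add {V V' : Pt → HSp P} {X X' : HSp P} (h : ItoRel P N ν V X) (h' : ItoRel P N ν V' X') :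
    ItoRel P N ν (fun ξ => V ξ + V' ξ) (X + X') :=
  ⟨h.1.add h'.1, (itoGraph P N ν).add_mem h.2 h'.2⟩

theorem sub {V V' : Pt → HSp P} {X X' : HSp P} (h : ItoRel P N ν V X) (h' : ItoRel P N ν V' X') :
    ItoRel P N ν (fun ξ => V ξ - V' ξ) (X - X') :=
  ⟨h.1.sub h'.1, (itoGraph P N ν).sub_mem h.2 h'.2⟩

theorem zero : ItoRel P N ν (fun _ => 0) 0 :=
  ⟨MemLp.zero, (itoGraph P N ν).zero_mem⟩

theorem sum {ι : Type*} (s : Finset ι) {V : ι → Pt → HSp P} {X : ι → HSp P}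
    (h : ∀ i ∈ s, ItoRel P N ν (V i) (X i)) :
    ItoRel P N ν (fun ξ => ∑ i ∈ s, V i ξ) (∑ i ∈ s, X i) := by
  classical
  induction s using Finset.induction_on with
  | empty => simpa using zero
  | insert i s hi ih =>
    simp only [Finset.sum_insert hi]
    exact (h i (Finset.mem_insert_self i s)).add
      (ih fun j hj => h j (Finset.mem_insert_of_mem hj))

theorem congr {V V' : Pt → HSp P} {X : HSp P} (h : ItoRel P N ν V X)
    (hV : V =ᵐ[intensity ν] V') : ItoRel P N ν V' X := by
  obtain ⟨h1, h2⟩ := h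
  refine ⟨h1.ae_eq hV, ?_⟩
  rwa [← (MemLp.toLp_eq_toLp_iff h1 (h1.ae_eq hV)).2 hV]

theorem enorm_eq [IsProbabilityMeasure P] [SigmaFinite ν]
    (hN : IsPoissonRandomMeasure P N (intensity ν)) {V : Pt → HSp P} {X : HSp P}
    (h : ItoRel P N ν V X) : ‖X‖ₑ = eLpNorm V 2 (intensity ν) := by
  obtain ⟨h1, h2⟩ := h
  have := norm_itoGraph hN h2
  simp only at this
  rw [← Lp.enorm_toLp (hf := h1), enorm_eq_iff_norm_eq]
  exact this

theorem enorm_sq_eq [IsProbabilityMeasure P] [SigmaFinite ν]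
    (hN : IsPoissonRandomMeasure P N (intensity ν)) {V : Pt → HSp P} {X : HSp P}
    (h : ItoRel P N ν V X) : ‖X‖ₑ ^ 2 = ∫⁻ ξ, ‖V ξ‖ₑ ^ 2 ∂intensity ν := by
  rw [h.enorm_eq hN, eLpNorm_eq_lintegral_rpow_enorm_toReal (by simp) (by simp)]
  rw [← ENNReal.rpow_natCast, ← ENNReal.rpow_mul]
  norm_num

theorem unique [IsProbabilityMeasure P] [SigmaFinite ν]
    (hN : IsPoissonRandomMeasure P N (intensity ν)) {V : Pt → HSp P} {X X' : HSp P}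
    (h : ItoRel P N ν V X) (h' : ItoRel P N ν V X') : X = X' := by
  have := (h.sub h').enorm_eq hN
  simp only [sub_self, eLpNorm_zero', enorm_eq_zero, sub_eq_zero] at this
  exact this

/-- The isometry turns convergence of the integrands into the Cauchy property of the integrals, and
the limit pair remains in the closed graph. This is the only source of new integrals beyond finite
sums. -/
theorem exists_of_tendsto [IsProbabilityMeasure P] [SigmaFinite ν]
    (hN : IsPoissonRandomMeasure P N (intensity ν)) {V : ℕ → Pt → HSp P} {X : ℕ → HSp P}
    {V' : Pt → HSp P} (h : ∀ k, ItoRel P N ν (V k) (X k)) (hV' : MemLp V' 2 (intensity ν))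
    (hlim : Tendsto (fun k => eLpNorm (fun ξ => V k ξ - V' ξ) 2 (intensity ν)) atTop (𝓝 0)) :
    ∃ X', ItoRel P N ν V' X' ∧ Tendsto X atTop (𝓝 X') := by
  have hL : Tendsto (fun k => (h k).1.toLp (V k)) atTop (𝓝 (hV'.toLp V')) :=
    (Lp.tendsto_Lp_iff_tendsto_eLpNorm'' _ _ _ _).2 hlim
  have hC : CauchySeq X := by
    refine (cauchySeq_iff_tendsto_dist_atTop_0).2 ?_
    have := cauchySeq_iff_tendsto_dist_atTop_0.1 hL.cauchySeq
    refine this.congr fun n => ?_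
    rw [dist_eq_norm, dist_eq_norm]
    exact (norm_itoGraph hN ((itoGraph P N ν).sub_mem (h n.1).2 (h n.2).2)).symm
  obtain ⟨X', hX'⟩ := cauchySeq_tendsto_of_complete hC
  refine ⟨X', ⟨hV', ?_⟩, hX'⟩
  exact (Submodule.isClosed_topologicalClosure _).mem_of_tendsto (hL.prodMk_nhds hX')
    (Eventually.of_forall fun k => (h k).2)

theorem of_tendsto [IsProbabilityMeasure P] [SigmaFinite ν]
    (hN : IsPoissonRandomMeasure P N (intensity ν)) {V : ℕ → Pt → HSp P} {X : ℕ → HSp P}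
    {V' : Pt → HSp P} {X' : HSp P} (h : ∀ k, ItoRel P N ν (V k) (X k))
    (hV' : MemLp V' 2 (intensity ν))
    (hlim : Tendsto (fun k => eLpNorm (fun ξ => V k ξ - V' ξ) 2 (intensity ν)) atTop (𝓝 0))
    (hX : Tendsto X atTop (𝓝 X')) : ItoRel P N ν V' X' := by
  obtain ⟨X'', h1, h2⟩ := exists_of_tendsto hN h hV' hlim
  rwa [tendsto_nhds_unique hX h2]

theorem box [SigmaFinite ν] {a b : ℝ} {A Γ : Set ℝ} {Y : Ω → ℝ}
    (ha : 0 ≤ a) (hab : a ≤ b) (hR : FiniteRect ν A Γ) (hYa : AdaptedAt P N ν a Y)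
    (hY : MemLp Y 2 P)
    (hX : MemLp (fun ω => Y ω * compensated N ν (Set.Ioc a b ×ˢ A ×ˢ Γ) ω) 2 P) :
    ItoRel P N ν ((Set.Ioc a b ×ˢ A ×ˢ Γ).indicator fun _ => hY.toLp Y) (hX.toLp _) := by
  have hm : MeasurableSet (Set.Ioc a b ×ˢ A ×ˢ Γ) := hR.measurableSet measurableSet_Ioc
  have hf : intensity ν (Set.Ioc a b ×ˢ A ×ˢ Γ) ≠ ∞ := (hR.intensity_lt_top (by simp)).ne
  refine ⟨memLp_indicator_const 2 hm _ (Or.inr hf), ?_⟩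
  exact Submodule.le_topologicalClosure _ (Submodule.subset_span
    ⟨a, b, A, Γ, Y, ha, hab, hR, hYa, hY, hm, hf, hX, rfl⟩)

end ItoRel

namespace ElementaryProcess

theorem finiteRect (W : ElementaryProcess P N ν) (i : Fin W.n) : FiniteRect ν (W.A i) (W.Γ i) :=
  ⟨W.measurableSet_A i, W.measurableSet_Γ i, W.volume_A i, W.measure_Γ i⟩

theorem adaptedAt (W : ElementaryProcess P N ν) (i : Fin W.n) : AdaptedAt P N ν (W.a i) (W.Y i) :=
  (W.measurable_Y i).stronglyMeasurable.aestronglyMeasurable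

theorem memLp_Y [IsProbabilityMeasure P] (hN : IsPoissonRandomMeasure P N (intensity ν))
    (W : ElementaryProcess P N ν) (i : Fin W.n) (q : ℝ≥0∞) : MemLp (W.Y i) q P := by
  obtain ⟨c, hc⟩ := W.bounded_Y i
  exact MemLp.of_bound (AEStronglyMeasurable.mono (noiseSigma_le hN _) (W.adaptedAt i)) c
    (ae_of_all _ hc)

variable [IsProbabilityMeasure P]

/-- The process as a function with values in `L²(Ω)`. -/
noncomputable def toHilbert (hN : IsPoissonRandomMeasure P N (intensity ν))
    (W : ElementaryProcess P N ν) (ξ : Pt) : HSp P :=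
  ∑ i, (W.box i).indicator (fun _ => (W.memLp_Y hN i 2).toLp (W.Y i)) ξ

theorem toHilbert_coe (hN : IsPoissonRandomMeasure P N (intensity ν))
    (W : ElementaryProcess P N ν) (ξ : Pt) : W.toHilbert hN ξ =ᵐ[P] W.toFun ξ := by
  have h2 : ∀ᵐ ω ∂P, ∀ i, (W.memLp_Y hN i 2).toLp (W.Y i) ω = W.Y i ω :=
    ae_all_iff.2 fun i => (W.memLp_Y hN i 2).coeFn_toLp
  have h3 : ∀ᵐ ω ∂P, ∀ i, ((W.box i).indicator
      (fun _ => (W.memLp_Y hN i 2).toLp (W.Y i)) ξ : HSp P) ω =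
        W.Y i ω * (W.box i).indicator (fun _ => (1 : ℝ)) ξ := by
    filter_upwards [h2, Lp.coeFn_zero ℝ 2 P] with ω h h0 i
    by_cases hξ : ξ ∈ W.box i
    · simp [hξ, h i]
    · simp only [hξ, not_false_eq_true, Set.indicator_of_notMem, mul_zero]
      exact h0
  filter_upwards [h3, Lp.coeFn_finsetSum Finset.univ (fun i => (W.box i).indicator
      (fun _ => (W.memLp_Y hN i 2).toLp (W.Y i)) ξ)] with ω h4 h5
  rw [toHilbert, h5, Finset.sum_apply]
  simp only [h4, ElementaryProcess.toFun]

variable [SigmaFinite ν]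

theorem memLp_term (hN : IsPoissonRandomMeasure P N (intensity ν)) (W : ElementaryProcess P N ν)
    (i : Fin W.n) : MemLp (fun ω => W.Y i ω * compensated N ν (W.box i) ω) 2 P :=
  (W.adaptedAt i).memLp_mul_compensated hN (W.memLp_Y hN i 2)
    ((W.finiteRect i).measurableSet measurableSet_Ioc)
    ((W.finiteRect i).intensity_lt_top (by simp)) (Ioc_prod_subset_Ioi le_rfl _)

theorem memLp_integral (hN : IsPoissonRandomMeasure P N (intensity ν))
    (W : ElementaryProcess P N ν) : MemLp W.integral 2 P :=
  memLp_finsetSum _ fun i _ => W.memLp_term hN i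

theorem itoRel (hN : IsPoissonRandomMeasure P N (intensity ν)) (W : ElementaryProcess P N ν) :
    ItoRel P N ν (W.toHilbert hN) ((W.memLp_integral hN).toLp W.integral) := by
  have h1 : (W.memLp_integral hN).toLp W.integral = ∑ i, (W.memLp_term hN i).toLp _ := by
    rw [Lp.ext_iff]
    refine (MemLp.coeFn_toLp _).trans ?_
    have h2 : ∀ᵐ ω ∂P, ∀ i, (W.memLp_term hN i).toLp _ ω =
        W.Y i ω * compensated N ν (W.box i) ω := ae_all_iff.2 fun i => (W.memLp_term hN i).coeFn_toLp
    filter_upwards [h2, Lp.coeFn_finsetSum Finset.univ (fun i => (W.memLp_term hN i).toLp _)]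
      with ω h3 h4
    rw [h4, Finset.sum_apply]
    simp only [ElementaryProcess.integral, h3]
  rw [h1]
  exact ItoRel.sum Finset.univ fun i _ => ItoRel.box (W.a_pos i).le (W.a_lt_b i).le
    (W.finiteRect i) (W.adaptedAt i) (W.memLp_Y hN i 2) (W.memLp_term hN i)

end ElementaryProcess

/-- Comparison of the two descriptions of square integrable fields. -/
theorem eLpNorm_prod_eq_eLpNorm_hilbert [SFinite P] [SigmaFinite ν] {f : Pt → Ω → ℝ}
    {g : Pt → HSp P} (hf : AEStronglyMeasurable (fun q : Pt × Ω => f q.1 q.2) ((intensity ν).prod P))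
    (hfg : ∀ᵐ ξ ∂intensity ν, f ξ =ᵐ[P] g ξ) :
    eLpNorm (fun q : Pt × Ω => f q.1 q.2) 2 ((intensity ν).prod P) =
      eLpNorm g 2 (intensity ν) := by
  rw [eLpNorm_eq_lintegral_rpow_enorm_toReal (by simp) (by simp),
    eLpNorm_eq_lintegral_rpow_enorm_toReal (by simp) (by simp), lintegral_prod _ (by fun_prop)]
  congr 1
  refine lintegral_congr_ae ?_
  filter_upwards [hfg] with ξ hξ
  rw [Lp.enorm_def, eLpNorm_eq_lintegral_rpow_enorm_toReal (by simp) (by simp),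
    ← ENNReal.rpow_mul]
  norm_num
  refine lintegral_congr_ae ?_
  filter_upwards [hξ] with ω hω
  rw [hω]

end ItoGraph

end LevyWave

namespace LevyWave

/-! ### Grids on time, space and jump sizes. -/

section Grid

/-- Index of the time cell `(i h, (i + 1) h]` containing `s`. -/
noncomputable def timeIdx (h s : ℝ) : ℤ := ⌈s / h⌉ - 1

/-- Index of the space cell `[j h, (j + 1) h)` containing `y`. -/
noncomputable def spaceIdx (h y : ℝ) : ℤ := ⌊y / h⌋

/-- Index of the jump size `z`, rounded towards zero. -/
noncomputable def jumpIdx (h z : ℝ) : ℤ := if 0 ≤ z then ⌊z / h⌋ else ⌈z / h⌉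

/-- Index of the cell containing a point. -/
noncomputable def cellIdx (h : ℝ) (ξ : Pt) : ℤ × ℤ × ℤ :=
  (timeIdx h ξ.1, spaceIdx h ξ.2.1, jumpIdx h ξ.2.2)

/-- Reference point of a cell. -/
def cellPt (h : ℝ) (c : ℤ × ℤ × ℤ) : Pt := (c.1 * h, c.2.1 * h, c.2.2 * h)

/-- The space cells of mesh `h`. -/
def spaceCell (h : ℝ) (j : ℤ) : Set ℝ := {y | spaceIdx h y = j}

/-- The jump cells of mesh `h`. -/
def jumpCell (h : ℝ) (l : ℤ) : Set ℝ := {z | jumpIdx h z = l}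

/-- The cells of mesh `h`. -/
def cell (h : ℝ) (c : ℤ × ℤ × ℤ) : Set Pt :=
  Set.Ioc (c.1 * h) ((c.1 + 1) * h) ×ˢ spaceCell h c.2.1 ×ˢ jumpCell h c.2.2

/-- The finite set of indices in use: times `1, …, K`, positions and jumps up to `M`. -/
noncomputable def gridIdx (K M : ℕ) : Finset (ℤ × ℤ × ℤ) :=
  -- Time index 0 is left out because elementary processes start at a positive time. Jump index 0 is
  -- left out because its cell contains a neighbourhood of 0, where ν may be infinite.
  Finset.Icc 1 (K : ℤ) ×ˢ Finset.Icc (-(M : ℤ)) M ×ˢ (Finset.Icc (-(M : ℤ)) M).erase 0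

variable {h : ℝ}

theorem timeIdx_eq_iff (hh : 0 < h) (s : ℝ) (i : ℤ) :
    timeIdx h s = i ↔ s ∈ Set.Ioc (i * h) ((i + 1) * h) := by
  rw [timeIdx, sub_eq_iff_eq_add, Int.ceil_eq_iff, Set.mem_Ioc, lt_div_iff₀ hh, div_le_iff₀ hh]
  push_cast
  rw [add_sub_cancel_right]

theorem mem_cell (hh : 0 < h) (ξ : Pt) (c : ℤ × ℤ × ℤ) : ξ ∈ cell h c ↔ cellIdx h ξ = c := by
  rw [cell, Set.mem_prod, Set.mem_prod, ← timeIdx_eq_iff hh]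
  simp only [spaceCell, jumpCell, Set.mem_ofPred_eq, cellIdx, Prod.ext_iff]

theorem disjoint_cell (hh : 0 < h) {c c' : ℤ × ℤ × ℤ} (hc : c ≠ c') :
    Disjoint (cell h c) (cell h c') := by
  rw [Set.disjoint_left]
  intro ξ h1 h2
  rw [mem_cell hh] at h1 h2
  exact hc (h1.symm.trans h2)

theorem measurable_jumpIdx (h : ℝ) : Measurable (jumpIdx h) :=
  Measurable.ite measurableSet_Ici (Int.measurable_floor.comp (measurable_id.div_const h))
    (Int.measurable_ceil.comp (measurable_id.div_const h))

theorem measurable_spaceIdx (h : ℝ) : Measurable (spaceIdx h) :=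
  Int.measurable_floor.comp (measurable_id.div_const h)

theorem measurable_cellIdx (h : ℝ) : Measurable (cellIdx h) := by
  refine Measurable.prodMk ?_ (Measurable.prodMk ?_ ?_)
  · exact (measurable_from_top (f := fun i : ℤ => i - 1)).comp
      (Int.measurable_ceil.comp (measurable_fst.div_const h))
  · exact (measurable_spaceIdx h).comp (measurable_fst.comp measurable_snd)
  · exact (measurable_jumpIdx h).comp (measurable_snd.comp measurable_snd)

theorem timeIdx_mul_lt (hh : 0 < h) (s : ℝ) : timeIdx h s * h < s :=
  ((timeIdx_eq_iff hh s _).1 rfl).1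

theorem le_timeIdx_mul (hh : 0 < h) (s : ℝ) : s ≤ timeIdx h s * h + h := by
  have := ((timeIdx_eq_iff hh s _).1 rfl).2
  linarith

theorem spaceIdx_mul_le (hh : 0 < h) (y : ℝ) : spaceIdx h y * h ≤ y :=
  (le_div_iff₀ hh).1 (Int.floor_le _)

theorem lt_spaceIdx_mul (hh : 0 < h) (y : ℝ) : y < spaceIdx h y * h + h := by
  have := (div_lt_iff₀ hh).1 (Int.lt_floor_add_one (y / h))
  unfold spaceIdx
  linarith

/-- The reason for rounding towards zero: discretised jumps are dominated by the true ones, so |z|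
serves as a majorant at every mesh. -/
theorem abs_jumpIdx_mul_le (hh : 0 < h) (z : ℝ) : |jumpIdx h z * h| ≤ |z| := by
  unfold jumpIdx
  split_ifs with hz
  · have h1 : (0 : ℝ) ≤ ⌊z / h⌋ := by exact_mod_cast Int.floor_nonneg.2 (div_nonneg hz hh.le)
    rw [abs_of_nonneg (by positivity), abs_of_nonneg hz]
    exact (le_div_iff₀ hh).1 (Int.floor_le _)
  · push Not at hz
    have h1 : (⌈z / h⌉ : ℝ) ≤ 0 := by
      exact_mod_cast Int.ceil_le.2 (by simpa using (div_neg_of_neg_of_pos hz hh).le)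
    rw [abs_of_nonpos (mul_nonpos_of_nonpos_of_nonneg h1 hh.le), abs_of_neg hz, neg_le_neg_iff]
    exact (div_le_iff₀ hh).1 (Int.le_ceil _)

theorem abs_sub_jumpIdx_mul_le (hh : 0 < h) (z : ℝ) : |jumpIdx h z * h - z| ≤ h := by
  unfold jumpIdx
  split_ifs with hz
  · have h1 := (le_div_iff₀ hh).1 (Int.floor_le (z / h))
    have h2 := (div_lt_iff₀ hh).1 (Int.lt_floor_add_one (z / h))
    rw [abs_le]; constructor <;> linarith
  · have h1 := (div_le_iff₀ hh).1 (Int.le_ceil (z / h))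
    have h2 := (lt_div_iff₀ hh).1 (sub_lt_iff_lt_add.2 (Int.ceil_lt_add_one (z / h)))
    rw [abs_le]; constructor <;> linarith

theorem jumpIdx_ne_zero (hh : 0 < h) {z : ℝ} (hz : h < |z|) : jumpIdx h z ≠ 0 := by
  intro h0
  have := abs_sub_jumpIdx_mul_le hh z
  rw [h0] at this
  simp at this
  linarith

theorem le_abs_of_mem_jumpCell (hh : 0 < h) {l : ℤ} (hl : l ≠ 0) {z : ℝ} (hz : z ∈ jumpCell h l) :
    h ≤ |z| := by
  have h1 := abs_jumpIdx_mul_le hh z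
  rw [show jumpIdx h z = l from hz, abs_mul, abs_of_pos hh] at h1
  have h2 : (1 : ℝ) ≤ |(l : ℝ)| := by exact_mod_cast Int.one_le_abs hl
  nlinarith

theorem measure_abs_ge_lt_top {ν : Measure ℝ} (hν : levyMoment ν 2 < ∞) (hh : 0 < h) :
    ν {z | h ≤ |z|} < ∞ := by
  have h1 := meas_ge_le_lintegral_div (μ := ν) (f := fun ζ => ENNReal.ofReal (|ζ| ^ (2 : ℝ)))
    (by fun_prop) (ε := ENNReal.ofReal (h ^ (2 : ℝ))) (by simp; positivity) (by simp)
  refine (measure_mono ?_).trans_lt (h1.trans_lt (ENNReal.div_lt_top hν.ne (by simp; positivity)))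
  intro z hz
  exact ENNReal.ofReal_le_ofReal (Real.rpow_le_rpow hh.le hz (by norm_num))

/-- A jump cell of non-zero index keeps distance h from the origin, and m₂ < ∞ bounds its ν-mass by
Markov's inequality. -/
theorem finiteRect_cell {ν : Measure ℝ} (hν : levyMoment ν 2 < ∞) (hh : 0 < h) {l : ℤ}
    (hl : l ≠ 0) (j : ℤ) : FiniteRect ν (spaceCell h j) (jumpCell h l) where
  measA := measurable_spaceIdx h (measurableSet_singleton j)
  measΓ := measurable_jumpIdx h (measurableSet_singleton l)
  volA := by
    have : spaceCell h j ⊆ Set.Icc (j * h) (j * h + h) := by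
      intro y hy
      have hy' : spaceIdx h y = j := hy
      have h1 := spaceIdx_mul_le hh y
      have h2 := lt_spaceIdx_mul hh y
      rw [hy'] at h1 h2
      exact ⟨h1, h2.le⟩
    exact (measure_mono this).trans_lt (by simp)
  nuΓ := (measure_mono fun _ hz => le_abs_of_mem_jumpCell hh hl hz).trans_lt
    (measure_abs_ge_lt_top hν hh)

theorem mem_gridIdx {K M : ℕ} {c : ℤ × ℤ × ℤ} : c ∈ gridIdx K M ↔
    (1 ≤ c.1 ∧ c.1 ≤ K) ∧ |c.2.1| ≤ M ∧ c.2.2 ≠ 0 ∧ |c.2.2| ≤ M := by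
  simp only [gridIdx, Finset.mem_product, Finset.mem_Icc, Finset.mem_erase, abs_le]

/-- A sequence of grids whose mesh tends to `0` and which exhaust space and jumps. -/
structure GridSeq where
  h : ℕ → ℝ
  K : ℕ → ℕ
  M : ℕ → ℕ
  pos : ∀ k, 0 < h k
  le_one : ∀ k, h k ≤ 1
  tendsto_h : Tendsto h atTop (𝓝 0)
  tendsto_M : Tendsto (fun k => M k * h k) atTop atTop

namespace GridSeq

variable (g : GridSeq)

/-- The reference point of the cell containing `ξ` at level `k`. -/
noncomputable def corner (k : ℕ) (ξ : Pt) : Pt := cellPt (g.h k) (cellIdx (g.h k) ξ)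

theorem tendsto_corner_fst (s : ℝ) : Tendsto (fun k => timeIdx (g.h k) s * g.h k) atTop (𝓝 s) := by
  have h1 : Tendsto (fun k => s - g.h k) atTop (𝓝 s) := by
    simpa using tendsto_const_nhds.sub g.tendsto_h
  refine tendsto_of_tendsto_of_tendsto_of_le_of_le h1 tendsto_const_nhds (fun k => ?_)
    (fun k => (timeIdx_mul_lt (g.pos k) s).le)
  have := le_timeIdx_mul (g.pos k) s
  simp only
  linarith

theorem tendsto_corner_snd (y : ℝ) :
    Tendsto (fun k => spaceIdx (g.h k) y * g.h k) atTop (𝓝 y) := by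
  have h1 : Tendsto (fun k => y - g.h k) atTop (𝓝 y) := by
    simpa using tendsto_const_nhds.sub g.tendsto_h
  refine tendsto_of_tendsto_of_tendsto_of_le_of_le h1 tendsto_const_nhds (fun k => ?_)
    (fun k => spaceIdx_mul_le (g.pos k) y)
  have := lt_spaceIdx_mul (g.pos k) y
  simp only
  linarith

theorem tendsto_corner_thd (z : ℝ) :
    Tendsto (fun k => jumpIdx (g.h k) z * g.h k) atTop (𝓝 z) := by
  rw [tendsto_iff_norm_sub_tendsto_zero]
  exact squeeze_zero (fun k => norm_nonneg _) (fun k => abs_sub_jumpIdx_mul_le (g.pos k) z)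
    g.tendsto_h

theorem tendsto_corner (ξ : Pt) : Tendsto (fun k => g.corner k ξ) atTop (𝓝 ξ) :=
  (g.tendsto_corner_fst ξ.1).prodMk_nhds
    ((g.tendsto_corner_snd ξ.2.1).prodMk_nhds (g.tendsto_corner_thd ξ.2.2))

/-- The extent in time is a hypothesis on the point rather than a field of `GridSeq`: some grids
stop at a fixed time t, others exhaust the half line. -/
theorem eventually_mem_gridIdx {ξ : Pt} (h0 : 0 < ξ.1) (hz : ξ.2.2 ≠ 0)
    (hK : ∀ᶠ k in atTop, ξ.1 ≤ (g.K k + 1) * g.h k) :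
    ∀ᶠ k in atTop, cellIdx (g.h k) ξ ∈ gridIdx (g.K k) (g.M k) := by
  have e1 : ∀ᶠ k in atTop, g.h k < ξ.1 := g.tendsto_h.eventually_lt_const h0
  have e2 : ∀ᶠ k in atTop, g.h k < |ξ.2.2| := g.tendsto_h.eventually_lt_const (abs_pos.2 hz)
  have e3 := g.tendsto_M.eventually_ge_atTop (|ξ.2.1| + 1)
  have e4 := g.tendsto_M.eventually_ge_atTop (|ξ.2.2|)
  filter_upwards [e1, e2, e3, e4, hK] with k h1 h2 h3 h4 h5
  have hp := g.pos k
  rw [mem_gridIdx]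
  refine ⟨⟨?_, ?_⟩, ?_, jumpIdx_ne_zero hp h2, ?_⟩
  · have h6 := le_timeIdx_mul hp ξ.1
    by_contra hlt
    have h7 : timeIdx (g.h k) ξ.1 ≤ 0 := by simp only [cellIdx] at hlt; omega
    have h8 : (timeIdx (g.h k) ξ.1 : ℝ) ≤ 0 := by exact_mod_cast h7
    nlinarith
  · have h6 := timeIdx_mul_lt hp ξ.1
    have h7 : (timeIdx (g.h k) ξ.1 : ℝ) < g.K k + 1 := by
      by_contra hlt
      push Not at hlt
      nlinarith
    have h8 : timeIdx (g.h k) ξ.1 < g.K k + 1 := by exact_mod_cast h7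
    simp only [cellIdx]; omega
  · have h6 := spaceIdx_mul_le hp ξ.2.1
    have h7 := lt_spaceIdx_mul hp ξ.2.1
    have h8 : |(spaceIdx (g.h k) ξ.2.1 : ℝ) * g.h k| ≤ |ξ.2.1| + 1 := by
      have := g.le_one k
      have h9 := neg_abs_le ξ.2.1
      have h10 := le_abs_self ξ.2.1
      rw [abs_le]; constructor <;> linarith
    rw [abs_mul, abs_of_pos hp] at h8
    have h9 : |(spaceIdx (g.h k) ξ.2.1 : ℝ)| ≤ g.M k := le_of_mul_le_mul_right (h8.trans h3) hp
    exact_mod_cast h9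
  · have h8 := abs_jumpIdx_mul_le hp ξ.2.2
    rw [abs_mul, abs_of_pos hp] at h8
    have h9 : |(jumpIdx (g.h k) ξ.2.2 : ℝ)| ≤ g.M k := le_of_mul_le_mul_right (h8.trans h4) hp
    exact_mod_cast h9

end GridSeq

theorem sum_indicator_cell {E : Type*} [AddCommMonoid E] (hh : 0 < h) (S : Finset (ℤ × ℤ × ℤ))
    (φ : ℤ × ℤ × ℤ → E) (ξ : Pt) :
    ∑ c ∈ S, (cell h c).indicator (fun _ => φ c) ξ =
      if cellIdx h ξ ∈ S then φ (cellIdx h ξ) else 0 := by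
  classical
  have : ∀ c ∈ S, (cell h c).indicator (fun _ => φ c) ξ =
      if cellIdx h ξ = c then φ c else 0 := by
    intro c _
    rw [Set.indicator_apply]
    simp only [mem_cell hh]
  rw [Finset.sum_congr rfl this, Finset.sum_ite_eq]

end Grid

/-! ### Elementary processes carried by a grid. -/

section GridProcess

variable {Ω : Type*} [mΩ : MeasurableSpace Ω] {P : Measure Ω} {N : Ω → Measure Pt} {ν : Measure ℝ}

/-- The elementary process with coefficients `Y c` on the cells of a grid. -/
noncomputable def gridProcess (hν : levyMoment ν 2 < ∞) {h : ℝ} (hh : 0 < h) (K M : ℕ)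
    (Y : ℤ × ℤ × ℤ → Ω → ℝ)
    (hY : ∀ c ∈ gridIdx K M, Measurable[noiseSigma P N ν (c.1 * h)] (Y c))
    (hb : ∀ c ∈ gridIdx K M, ∃ C : ℝ, ∀ ω, |Y c ω| ≤ C) : ElementaryProcess P N ν where
  n := (gridIdx K M).card
  a i := ((gridIdx K M).equivFin.symm i).1.1 * h
  b i := (((gridIdx K M).equivFin.symm i).1.1 + 1) * h
  A i := spaceCell h ((gridIdx K M).equivFin.symm i).1.2.1
  Γ i := jumpCell h ((gridIdx K M).equivFin.symm i).1.2.2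
  Y i := Y ((gridIdx K M).equivFin.symm i).1
  a_pos i := by
    have := (mem_gridIdx.1 ((gridIdx K M).equivFin.symm i).2).1.1
    have : (1 : ℝ) ≤ ((gridIdx K M).equivFin.symm i).1.1 := by exact_mod_cast this
    positivity
  a_lt_b i := by linarith
  measurableSet_A i := (finiteRect_cell hν hh
    (mem_gridIdx.1 ((gridIdx K M).equivFin.symm i).2).2.2.1 _).measA
  measurableSet_Γ i := (finiteRect_cell hν hh
    (mem_gridIdx.1 ((gridIdx K M).equivFin.symm i).2).2.2.1
    (((gridIdx K M).equivFin.symm i).1.2.1)).measΓ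
  volume_A i := (finiteRect_cell hν hh
    (mem_gridIdx.1 ((gridIdx K M).equivFin.symm i).2).2.2.1 _).volA
  measure_Γ i := (finiteRect_cell hν hh
    (mem_gridIdx.1 ((gridIdx K M).equivFin.symm i).2).2.2.1
    (((gridIdx K M).equivFin.symm i).1.2.1)).nuΓ
  measurable_Y i := hY _ ((gridIdx K M).equivFin.symm i).2
  bounded_Y i := hb _ ((gridIdx K M).equivFin.symm i).2

variable (hν : levyMoment ν 2 < ∞) {h : ℝ} (hh : 0 < h) {K M : ℕ} {Y : ℤ × ℤ × ℤ → Ω → ℝ}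
  (hY : ∀ c ∈ gridIdx K M, Measurable[noiseSigma P N ν (c.1 * h)] (Y c))
  (hb : ∀ c ∈ gridIdx K M, ∃ C : ℝ, ∀ ω, |Y c ω| ≤ C)

theorem sum_equivFin_symm {α E : Type*} [AddCommMonoid E] (S : Finset α) (f : α → E) :
    ∑ i : Fin S.card, f (S.equivFin.symm i).1 = ∑ c ∈ S, f c := by
  rw [Equiv.sum_comp S.equivFin.symm (fun c : S => f c.1)]
  exact Finset.sum_coe_sort S f

theorem gridProcess_toFun (ξ : Pt) (ω : Ω) :
    (gridProcess hν hh K M Y hY hb).toFun ξ ω =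
      if cellIdx h ξ ∈ gridIdx K M then Y (cellIdx h ξ) ω else 0 := by
  rw [← sum_indicator_cell hh (gridIdx K M) (fun c => Y c ω) ξ,
    ← sum_equivFin_symm (gridIdx K M) (fun c => (cell h c).indicator (fun _ => Y c ω) ξ)]
  refine Finset.sum_congr rfl fun i _ => ?_
  change Y _ ω * (cell h ((gridIdx K M).equivFin.symm i).1).indicator (fun _ => (1 : ℝ)) ξ = _
  by_cases hξ : ξ ∈ cell h ((gridIdx K M).equivFin.symm i).1 <;> simp [hξ]

theorem gridProcess_integral (ω : Ω) :
    (gridProcess hν hh K M Y hY hb).integral ω =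
      ∑ c ∈ gridIdx K M, Y c ω * compensated N ν (cell h c) ω := by
  rw [← sum_equivFin_symm (gridIdx K M) (fun c => Y c ω * compensated N ν (cell h c) ω)]
  rfl

theorem gridProcess_toHilbert [IsProbabilityMeasure P]
    (hN : IsPoissonRandomMeasure P N (intensity ν)) {y : ℤ × ℤ × ℤ → HSp P}
    (hy : ∀ c ∈ gridIdx K M, Y c =ᵐ[P] y c) (ξ : Pt) :
    (gridProcess hν hh K M Y hY hb).toHilbert hN ξ =
      if cellIdx h ξ ∈ gridIdx K M then y (cellIdx h ξ) else 0 := by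
  rw [Lp.ext_iff]
  refine (ElementaryProcess.toHilbert_coe hN _ ξ).trans ?_
  split_ifs with hc
  · filter_upwards [hy _ hc] with ω hω
    rw [gridProcess_toFun, if_pos hc, hω]
  · filter_upwards [Lp.coeFn_zero ℝ 2 P] with ω hω
    rw [gridProcess_toFun, if_neg hc, hω]
    rfl

end GridProcess

end LevyWave

namespace LevyWave

/-! ### Dominated convergence, the kernel off the light cone, and an L² majorant. -/

section Analysis

/-- Dominated convergence in `L²`. -/
theorem tendsto_eLpNorm_two_of_dominated {α E : Type*} [MeasurableSpace α] {μ : Measure α}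
    [NormedAddCommGroup E] {f : ℕ → α → E} {F : α → E} {g : α → ℝ} (hg : MemLp g 2 μ)
    (hf : ∀ k, AEStronglyMeasurable (f k) μ) (hb : ∀ k, ∀ᵐ a ∂μ, ‖f k a‖ ≤ g a)
    (hlim : ∀ᵐ a ∂μ, Tendsto (fun k => f k a) atTop (𝓝 (F a))) :
    MemLp F 2 μ ∧ Tendsto (fun k => eLpNorm (fun a => f k a - F a) 2 μ) atTop (𝓝 0) := by
  have hF : AEStronglyMeasurable F μ := aestronglyMeasurable_of_tendsto_ae _ hf hlim
  have hFb : ∀ᵐ a ∂μ, ‖F a‖ ≤ g a := by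
    filter_upwards [hlim, ae_all_iff.2 hb] with a h1 h2
    exact le_of_tendsto h1.norm (Eventually.of_forall h2)
  refine ⟨hg.mono' hF hFb, ?_⟩
  have h0 : Tendsto (fun k => ∫⁻ a, ‖f k a - F a‖ₑ ^ (2 : ℝ) ∂μ) atTop (𝓝 0) := by
    have hg2 : ∫⁻ a, (2 * ‖g a‖ₑ) ^ (2 : ℝ) ∂μ ≠ ∞ := by
      have := hg.const_mul 2
      have h3 := this.eLpNorm_lt_top
      rw [eLpNorm_lt_top_iff_lintegral_rpow_enorm_lt_top (by simp) (by simp)] at h3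
      have h4 : ‖(2 : ℝ)‖ₑ = 2 := by
        rw [Real.enorm_eq_ofReal (by norm_num)]; norm_num
      simpa [enorm_mul, h4] using h3.ne
    have := tendsto_lintegral_of_dominated_convergence' (μ := μ)
      (F := fun k a => ‖f k a - F a‖ₑ ^ (2 : ℝ)) (f := fun _ => 0)
      (fun a => (2 * ‖g a‖ₑ) ^ (2 : ℝ)) (fun k => ((hf k).sub hF).enorm.pow_const _)
      (fun k => ?_) hg2 ?_
    · simpa using this
    · filter_upwards [hb k, hFb] with a h1 h2
      have h3 : ‖f k a - F a‖ₑ ≤ 2 * ‖g a‖ₑ := by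
        have h4 : ‖f k a‖ₑ ≤ ‖g a‖ₑ := by
          rw [enorm_le_iff_norm_le]; exact h1.trans (le_abs_self _)
        have h5 : ‖F a‖ₑ ≤ ‖g a‖ₑ := by
          rw [enorm_le_iff_norm_le]; exact h2.trans (le_abs_self _)
        rw [two_mul]
        exact enorm_sub_le.trans (add_le_add h4 h5)
      gcongr
    · filter_upwards [hlim] with a ha
      have h1 : Tendsto (fun k => ‖f k a - F a‖ₑ) atTop (𝓝 0) := by
        have := (ha.sub_const (F a)).enorm
        simpa using this
      have h2 := h1.ennrpow_const 2
      simpa using h2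
  have := h0.ennrpow_const (1 / 2)
  simp only [eLpNorm_eq_lintegral_rpow_enorm_toReal (p := 2) (by simp) (by simp)]
  simpa using this

/-- Off the cone |x| = t the kernel is locally constant. -/
theorem continuousAt_waveG {q : ℝ × ℝ} (h : |q.2| ≠ q.1) :
    ContinuousAt (fun q : ℝ × ℝ => waveG q.1 q.2) q := by
  rcases lt_or_gt_of_ne h with h | h
  · have : ∀ᶠ p : ℝ × ℝ in 𝓝 q, |p.2| < p.1 :=
      (continuous_snd.abs.continuousAt).eventually_lt continuous_fst.continuousAt h
    refine (continuousAt_const (y := (1 / 2 : ℝ))).congr ?_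
    filter_upwards [this] with p hp
    simp [waveG, hp]
  · have : ∀ᶠ p : ℝ × ℝ in 𝓝 q, p.1 < |p.2| :=
      (continuous_fst.continuousAt).eventually_lt continuous_snd.abs.continuousAt h
    refine (continuousAt_const (y := (0 : ℝ))).congr ?_
    filter_upwards [this] with p hp
    simp [waveG, hp.le]

theorem measurable_waveG : Measurable (fun q : ℝ × ℝ => waveG q.1 q.2) :=
  Measurable.ite (measurableSet_lt (by fun_prop) (by fun_prop)) measurable_const measurable_const

theorem waveG_nonneg (t x : ℝ) : 0 ≤ waveG t x := by
  unfold waveG; split_ifs <;> norm_num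

theorem waveG_le (t x : ℝ) : waveG t x ≤ 1 / 2 := by
  unfold waveG; split_ifs <;> norm_num

theorem waveG_eq_zero {t x : ℝ} (h : t ≤ |x|) : waveG t x = 0 := by
  unfold waveG; rw [if_neg (not_lt.2 h)]

variable {ν : Measure ℝ} [SigmaFinite ν]

theorem ae_intensity_pos : ∀ᵐ ξ ∂intensity ν, 0 < ξ.1 := by
  rw [ae_iff]
  have : {ξ : Pt | ¬ 0 < ξ.1} = Set.Iic 0 ×ˢ Set.univ := by ext; simp
  rw [this, intensity, Measure.prod_prod, Measure.restrict_apply measurableSet_Iic,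
    Set.Iic_inter_Ici]
  simp

theorem ae_intensity_jump_ne_zero (h0 : ν {0} = 0) : ∀ᵐ ξ ∂intensity ν, ξ.2.2 ≠ 0 := by
  rw [ae_iff]
  have : {ξ : Pt | ¬ ξ.2.2 ≠ 0} = Set.univ ×ˢ Set.univ ×ˢ {0} := by ext; simp
  rw [this, intensity, Measure.prod_prod, Measure.prod_prod, h0]
  simp

/-- For each fixed time the exceptional positions form a set of at most two points. With g(s) = t -
s or g(s) = s - r this discards the boundary of a light cone, the only place where the integrands
may jump. -/
theorem ae_intensity_abs_ne {g : ℝ → ℝ} (hg : Measurable g) (y : ℝ) :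
    ∀ᵐ ξ ∂intensity ν, |ξ.2.1 - y| ≠ g ξ.1 := by
  rw [ae_iff]
  have hm : MeasurableSet {ξ : Pt | ¬ |ξ.2.1 - y| ≠ g ξ.1} := by
    simp only [ne_eq, not_not]
    exact measurableSet_eq_fun (by fun_prop) (by fun_prop)
  rw [intensity, Measure.measure_prod_null hm]
  refine ae_of_all _ fun s => ?_
  have : Prod.mk s ⁻¹' {ξ : Pt | ¬ |ξ.2.1 - y| ≠ g ξ.1} ⊆ {y + g s, y - g s} ×ˢ Set.univ := by
    rintro ⟨w, z⟩ hw
    have hw' : |w - y| = g s := by simpa using hw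
    simp only [Set.mem_prod, Set.mem_insert_iff, Set.mem_singleton_iff, Set.mem_univ, and_true]
    rcases abs_cases (w - y) with ⟨h1, -⟩ | ⟨h1, -⟩
    · left; linarith
    · right; linarith
  refine measure_mono_null this ?_
  rw [Measure.prod_prod, (Set.toFinite _).measure_zero, zero_mul]

/-- An integrable majorant for integrands supported in a light cone. -/
noncomputable def coneMajorant (C R x : ℝ) (ξ : Pt) : ℝ :=
  C * ((Set.Icc 0 R).indicator (fun _ => (1 : ℝ)) ξ.1 *
    ((Set.Icc (x - R) (x + R)).indicator (fun _ => (1 : ℝ)) ξ.2.1 * |ξ.2.2|))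

theorem integrable_sq_abs {ν : Measure ℝ} (hν : levyMoment ν 2 < ∞) : Integrable (fun z : ℝ => |z| ^ 2) ν := by
  refine ⟨by fun_prop, ?_⟩
  rw [hasFiniteIntegral_iff_ofReal (ae_of_all _ fun z => by positivity)]
  convert hν using 1
  unfold levyMoment
  norm_cast

theorem memLp_coneMajorant {ν : Measure ℝ} [SFinite ν] (hν : levyMoment ν 2 < ∞) (C R x : ℝ) :
    MemLp (coneMajorant C R x) 2 (intensity ν) := by
  have hm : Measurable (coneMajorant C R x) := by
    refine Measurable.const_mul (Measurable.mul ?_ (Measurable.mul ?_ ?_)) C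
    · exact (measurable_const.indicator measurableSet_Icc).comp measurable_fst
    · exact (measurable_const.indicator measurableSet_Icc).comp
        (measurable_fst.comp measurable_snd)
    · fun_prop
  rw [memLp_two_iff_integrable_sq hm.aestronglyMeasurable]
  have h1 : Integrable ((Set.Icc 0 R).indicator (fun _ => (1 : ℝ)))
      (volume.restrict (Set.Ici (0 : ℝ))) :=
    (integrable_indicator_iff measurableSet_Icc).2 (by
      refine integrableOn_const ?_ (by simp)
      exact ((Measure.restrict_apply_le _ _).trans_lt (by simp)).ne)
  have h2 : Integrable ((Set.Icc (x - R) (x + R)).indicator (fun _ => (1 : ℝ))) volume :=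
    (integrable_indicator_iff measurableSet_Icc).2 (integrableOn_const (by simp) (by simp))
  have h3 := (h1.mul_prod (h2.mul_prod (integrable_sq_abs hν))).const_mul (C ^ 2)
  refine h3.congr (ae_of_all _ fun ξ => ?_)
  simp only [coneMajorant, Set.indicator_apply]
  split_ifs <;> ring

end Analysis

/-! ### Adapted fields in L²(Ω) and truncation. -/

section Field

variable {Ω : Type*} [mΩ : MeasurableSpace Ω] {P : Measure Ω} {N : Ω → Measure Pt} {ν : Measure ℝ}

/-- Adapted random fields in `L²(Ω)`, locally bounded, and continuous off a light cone. -/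
structure IsWaveField (P : Measure Ω) (N : Ω → Measure Pt) (ν : Measure ℝ) (r y : ℝ)
    (u : ℝ → ℝ → HSp P) : Prop where
  adapted : ∀ t x, AdaptedAt P N ν t (u t x)
  continuousAt : ∀ q : ℝ × ℝ, |q.2 - y| ≠ q.1 - r → ContinuousAt (fun q : ℝ × ℝ => u q.1 q.2) q
  bounded : ∀ T, ∃ C : ℝ, 0 ≤ C ∧ ∀ t x, t ≤ T → ‖u t x‖ ≤ C

/-- The integrand `G_{t-s}(x-y') z' u(s,y')`. -/
noncomputable def waveIntegrand (u : ℝ → ℝ → HSp P) (t x : ℝ) (ξ : Pt) : HSp P :=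
  (waveG (t - ξ.1) (x - ξ.2.1) * ξ.2.2) • u ξ.1 ξ.2.1

/-- Truncation at level `R`. -/
noncomputable def clip (R a : ℝ) : ℝ := max (-R) (min a R)

theorem abs_clip_le {R : ℝ} (hR : 0 ≤ R) (a : ℝ) : |clip R a| ≤ R := by
  rw [abs_le]
  exact ⟨le_max_left _ _, max_le (by linarith) (min_le_right _ _)⟩

theorem abs_clip_le_abs {R : ℝ} (hR : 0 ≤ R) (a : ℝ) : |clip R a| ≤ |a| := by
  have h1 := neg_abs_le a
  have h2 := le_abs_self a
  have h3 := abs_nonneg a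
  rw [abs_le]
  constructor
  · exact le_max_of_le_right (le_min h1 (by linarith))
  · exact max_le (by linarith) ((min_le_left _ _).trans h2)

theorem clip_zero {R : ℝ} (hR : 0 ≤ R) : clip R 0 = 0 := by
  have := abs_clip_le_abs hR 0
  simpa using this

theorem clip_of_abs_le {R a : ℝ} (h : |a| ≤ R) : clip R a = a := by
  rw [abs_le] at h
  rw [clip, min_eq_left h.2, max_eq_right h.1]

theorem lipschitzWith_clip (R : ℝ) : LipschitzWith 1 (clip R) :=
  (LipschitzWith.id.min_const R).const_max (-R)

theorem continuous_clip (R : ℝ) : Continuous (clip R) := (lipschitzWith_clip R).continuous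

/-- Truncation in `L²(Ω)`. -/
noncomputable def clipH {R : ℝ} (hR : 0 ≤ R) (f : HSp P) : HSp P :=
  (lipschitzWith_clip R).compLp (clip_zero hR) f

theorem coeFn_clipH {R : ℝ} (hR : 0 ≤ R) (f : HSp P) : clipH hR f =ᵐ[P] fun ω => clip R (f ω) :=
  LipschitzWith.coeFn_compLp _ _ f

theorem norm_clipH_sub_le {R : ℝ} (hR : 0 ≤ R) (f f' : HSp P) :
    ‖clipH hR f - clipH hR f'‖ ≤ ‖f - f'‖ := by
  have := (lipschitzWith_clip R).norm_compLp_sub_le (clip_zero hR) f f'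
  simpa [clipH] using this

theorem norm_clipH_le {R : ℝ} (hR : 0 ≤ R) (f : HSp P) : ‖clipH hR f‖ ≤ ‖f‖ := by
  have := (lipschitzWith_clip R).norm_compLp_le (clip_zero hR) f
  simpa [clipH] using this

theorem tendsto_clipH (f : HSp P) :
    Tendsto (fun k : ℕ => clipH (Nat.cast_nonneg k : (0 : ℝ) ≤ k) f) atTop (𝓝 f) := by
  have h := tendsto_eLpNorm_two_of_dominated (μ := P) (f := fun (k : ℕ) ω => clip k (f ω))
    (F := f) (g := fun ω => |f ω|) (Lp.memLp f).abs
    (fun k => (continuous_clip k).comp_aestronglyMeasurable (Lp.aestronglyMeasurable f))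
    (fun k => ae_of_all _ fun ω => abs_clip_le_abs (Nat.cast_nonneg k) _)
    (ae_of_all _ fun ω => by
      refine tendsto_const_nhds.congr' ?_
      filter_upwards [eventually_ge_atTop ⌈|f ω|⌉₊] with k hk
      rw [clip_of_abs_le ((Nat.le_ceil _).trans (by exact_mod_cast hk))])
  rw [Lp.tendsto_Lp_iff_tendsto_eLpNorm']
  refine h.2.congr fun k => eLpNorm_congr_ae ?_
  filter_upwards [coeFn_clipH (Nat.cast_nonneg k : (0 : ℝ) ≤ k) f] with ω hω
  simp [hω]

/-- Truncation is 1-Lipschitz on L²(Ω), so the truncation level and its argument may move together.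
Levels are needed because elementary processes have bounded coefficients. -/
theorem tendsto_clipH_of_tendsto {f : ℕ → HSp P} {f' : HSp P} (h : Tendsto f atTop (𝓝 f')) :
    Tendsto (fun k : ℕ => clipH (Nat.cast_nonneg k : (0 : ℝ) ≤ k) (f k)) atTop (𝓝 f') := by
  have h1 := tendsto_clipH f'
  rw [tendsto_iff_norm_sub_tendsto_zero] at h h1 ⊢
  refine squeeze_zero (fun k => norm_nonneg _) (fun k => ?_) (by simpa using h.add h1)
  refine (norm_sub_le_norm_sub_add_norm_sub _ (clipH (Nat.cast_nonneg k : (0 : ℝ) ≤ k) f') _).trans ?_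
  exact add_le_add (norm_clipH_sub_le _ _ _) le_rfl

end Field

end LevyWave

namespace LevyWave

/-! ### Elementary approximation of the integrand of a stochastic convolution. -/

section Approximation

variable {Ω : Type*} [mΩ : MeasurableSpace Ω] {P : Measure Ω} {N : Ω → Measure Pt} {ν : Measure ℝ}

/-- If the kernel does not vanish at the corner, the corner lies in the backward cone of (t,x). With
mesh at most 1, the point itself then has time at most T + 1 and is within T + 1 of x in space;
replacing x by x' costs one more unit, whence the radius T + 2. -/
theorem norm_corner_le {h t x T x' C : ℝ} (hh : 0 < h) (h1 : h ≤ 1) {K M : ℕ} {ξ : Pt}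
    (hξ : cellIdx h ξ ∈ gridIdx K M) (ht : t ≤ T) (hx : |x - x'| ≤ 1) (hC : 0 ≤ C) {w : HSp P}
    (hw : timeIdx h ξ.1 * h < t → ‖w‖ ≤ C) :
    ‖(waveG (t - timeIdx h ξ.1 * h) (x - spaceIdx h ξ.2.1 * h) * (jumpIdx h ξ.2.2 * h)) • w‖ ≤
      coneMajorant C (T + 2) x' ξ := by
  have hnn : 0 ≤ coneMajorant C (T + 2) x' ξ := by
    unfold coneMajorant
    refine mul_nonneg hC (mul_nonneg ?_ (mul_nonneg ?_ (abs_nonneg _))) <;>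
    exact Set.indicator_nonneg (fun _ _ => zero_le_one) _
  by_cases hG : |x - spaceIdx h ξ.2.1 * h| < t - timeIdx h ξ.1 * h
  · have a1 := timeIdx_mul_lt hh ξ.1
    have a2 := le_timeIdx_mul hh ξ.1
    have a3 := spaceIdx_mul_le hh ξ.2.1
    have a4 := lt_spaceIdx_mul hh ξ.2.1
    have a5 : (1 : ℝ) ≤ timeIdx h ξ.1 := by exact_mod_cast (mem_gridIdx.1 hξ).1.1
    have a6 : 0 < timeIdx h ξ.1 * h := by positivity
    have a7 := (abs_nonneg _).trans_lt hG
    rw [abs_lt] at hG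
    rw [abs_le] at hx
    have m1 : ξ.1 ∈ Set.Icc 0 (T + 2) := ⟨by linarith, by linarith⟩
    have m2 : ξ.2.1 ∈ Set.Icc (x' - (T + 2)) (x' + (T + 2)) := ⟨by linarith, by linarith⟩
    rw [coneMajorant, Set.indicator_of_mem m1, Set.indicator_of_mem m2, norm_smul, norm_mul,
      Real.norm_of_nonneg (waveG_nonneg _ _), one_mul, one_mul, Real.norm_eq_abs, mul_comm C]
    refine mul_le_mul ?_ (hw (by linarith)) (norm_nonneg _) (abs_nonneg _)
    calc _ ≤ 1 * |ξ.2.2| := mul_le_mul ((waveG_le _ _).trans (by norm_num))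
          (abs_jumpIdx_mul_le hh _) (abs_nonneg _) (by norm_num)
      _ = |ξ.2.2| := one_mul _
  · rw [waveG, if_neg hG]
    simpa using hnn

/-- The kernel is continuous at the limit point since it is off the cone boundary. Coverage by the
grid is required only for times before t: from time t on the limit is 0, and dropping uncovered
cells can only decrease norms. -/
theorem tendsto_corner_smul (g : GridSeq) {ξ : Pt} {t x : ℝ} {τ χ : ℕ → ℝ}
    (hτ : Tendsto τ atTop (𝓝 t)) (hχ : Tendsto χ atTop (𝓝 x)) {w : ℕ → HSp P} {w' : HSp P}
    (hw : Tendsto w atTop (𝓝 w')) (h0 : 0 < ξ.1) (hz : ξ.2.2 ≠ 0)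
    (hc : |ξ.2.1 - x| ≠ t - ξ.1)
    (hK : ξ.1 < t → ∀ᶠ k in atTop, ξ.1 ≤ (g.K k + 1) * g.h k) :
    Tendsto (fun k => if cellIdx (g.h k) ξ ∈ gridIdx (g.K k) (g.M k) then
      (waveG (τ k - timeIdx (g.h k) ξ.1 * g.h k) (χ k - spaceIdx (g.h k) ξ.2.1 * g.h k) *
        (jumpIdx (g.h k) ξ.2.2 * g.h k)) • w k else 0) atTop
      (𝓝 ((waveG (t - ξ.1) (x - ξ.2.1) * ξ.2.2) • w')) := by
  have hG : Tendsto (fun k => waveG (τ k - timeIdx (g.h k) ξ.1 * g.h k)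
      (χ k - spaceIdx (g.h k) ξ.2.1 * g.h k)) atTop (𝓝 (waveG (t - ξ.1) (x - ξ.2.1))) := by
    have h1 : ContinuousAt (fun q : ℝ × ℝ => waveG q.1 q.2) (t - ξ.1, x - ξ.2.1) :=
      continuousAt_waveG (by simpa [abs_sub_comm] using hc)
    exact h1.tendsto.comp ((hτ.sub (g.tendsto_corner_fst ξ.1)).prodMk_nhds
      (hχ.sub (g.tendsto_corner_snd ξ.2.1)))
  have hmain := (hG.mul (g.tendsto_corner_thd ξ.2.2)).smul hw
  by_cases hs : ξ.1 < t
  · refine hmain.congr' ?_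
    filter_upwards [g.eventually_mem_gridIdx h0 hz (hK hs)] with k hk
    rw [if_pos hk]
  · have h2 : waveG (t - ξ.1) (x - ξ.2.1) = 0 :=
      waveG_eq_zero (by have := abs_nonneg (x - ξ.2.1); linarith)
    rw [h2, zero_mul, zero_smul] at hmain ⊢
    rw [tendsto_zero_iff_norm_tendsto_zero] at hmain ⊢
    refine squeeze_zero (fun k => norm_nonneg _) (fun k => ?_) hmain
    split_ifs
    · exact le_rfl
    · simp

variable {r y : ℝ} {u : ℝ → ℝ → HSp P}

/-- The coefficients of the approximation of `waveIntegrand u t x`. -/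
noncomputable def approxCoeff (hu : IsWaveField P N ν r y u) (t x h R : ℝ) (c : ℤ × ℤ × ℤ)
    (ω : Ω) : ℝ :=
  -- `mk` picks a representative that is measurable at the time of the corner itself, the left
  -- endpoint of the cell, and `clip` makes it bounded, as `ElementaryProcess` requires.
  (waveG (t - c.1 * h) (x - c.2.1 * h) * (c.2.2 * h)) *
    clip R ((hu.adapted (c.1 * h) (c.2.1 * h)).mk (u (c.1 * h) (c.2.1 * h)) ω)

theorem measurable_approxCoeff (hu : IsWaveField P N ν r y u) (t x h R : ℝ) (c : ℤ × ℤ × ℤ) :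
    Measurable[noiseSigma P N ν (c.1 * h)] (approxCoeff hu t x h R c) :=
  ((continuous_clip R).measurable.comp
    (hu.adapted (c.1 * h) (c.2.1 * h)).stronglyMeasurable_mk.measurable).const_mul _

theorem abs_approxCoeff_le (hu : IsWaveField P N ν r y u) (t x h : ℝ) {R : ℝ} (hR : 0 ≤ R)
    (c : ℤ × ℤ × ℤ) (ω : Ω) : |approxCoeff hu t x h R c ω| ≤
      |waveG (t - c.1 * h) (x - c.2.1 * h) * (c.2.2 * h)| * R := by
  rw [approxCoeff, abs_mul]
  exact mul_le_mul_of_nonneg_left (abs_clip_le hR _) (abs_nonneg _)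

theorem approxCoeff_ae_eq (hu : IsWaveField P N ν r y u) (t x h : ℝ) {R : ℝ} (hR : 0 ≤ R)
    (c : ℤ × ℤ × ℤ) : approxCoeff hu t x h R c =ᵐ[P]
      ((waveG (t - c.1 * h) (x - c.2.1 * h) * (c.2.2 * h)) •
        clipH hR (u (c.1 * h) (c.2.1 * h)) : HSp P) := by
  filter_upwards [(hu.adapted (c.1 * h) (c.2.1 * h)).ae_eq_mk, coeFn_clipH hR
    (u (c.1 * h) (c.2.1 * h)), Lp.coeFn_smul (waveG (t - c.1 * h) (x - c.2.1 * h) * (c.2.2 * h))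
    (clipH hR (u (c.1 * h) (c.2.1 * h)))] with ω h1 h2 h3
  rw [h3, Pi.smul_apply, h2, h1, smul_eq_mul, approxCoeff]

/-- Elementary approximation of `waveIntegrand u t x` on the `k`-th grid. -/
noncomputable def waveApprox (hν : levyMoment ν 2 < ∞) (g : GridSeq)
    (hu : IsWaveField P N ν r y u) (t x : ℝ) (k : ℕ) : ElementaryProcess P N ν :=
  gridProcess hν (g.pos k) (g.K k) (g.M k) (approxCoeff hu t x (g.h k) k)
    (fun c _ => measurable_approxCoeff hu t x (g.h k) k c)
    (fun c _ => ⟨_, abs_approxCoeff_le hu t x (g.h k) (Nat.cast_nonneg k) c⟩)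

theorem AdaptedAt.sum {ι : Type*} {s : Finset ι} {t : ℝ} {Y : ι → Ω → ℝ}
    (h : ∀ i ∈ s, AdaptedAt P N ν t (Y i)) : AdaptedAt P N ν t (fun ω => ∑ i ∈ s, Y i ω) := by
  classical
  induction s using Finset.induction_on with
  | empty => simpa using aestronglyMeasurable_const
  | insert i s hi ih =>
    simp only [Finset.sum_insert hi]
    exact (h i (Finset.mem_insert_self i s)).add
      (ih fun j hj => h j (Finset.mem_insert_of_mem hj))

theorem adaptedAt_of_tendsto (hN : IsPoissonRandomMeasure P N (intensity ν)) {t : ℝ}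
    {X : ℕ → HSp P} {X' : HSp P} (hX : ∀ᶠ k in atTop, AdaptedAt P N ν t (X k))
    (h : Tendsto X atTop (𝓝 X')) : AdaptedAt P N ν t X' := by
  exact (isClosed_aestronglyMeasurable (noiseSigma_le hN t)).mem_of_tendsto h hX

/-- The alternative allows cells that reach beyond t, provided that their coefficient vanishes. This
is what happens for the discrete chaoses, whose kernel is zero there. -/
theorem adaptedAt_gridProcess_integral [SigmaFinite ν] (hν : levyMoment ν 2 < ∞)
    (hN : IsPoissonRandomMeasure P N (intensity ν)) {h : ℝ} (hh : 0 < h) {K M : ℕ}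
    {Y : ℤ × ℤ × ℤ → Ω → ℝ}
    (hY : ∀ c ∈ gridIdx K M, AdaptedAt P N ν (c.1 * h) (Y c)) {t : ℝ}
    (ht : ∀ c ∈ gridIdx K M, (c.1 + 1) * h ≤ t ∨ Y c =ᵐ[P] 0) :
    AdaptedAt P N ν t (fun ω => ∑ c ∈ gridIdx K M, Y c ω * compensated N ν (cell h c) ω) := by
  refine AdaptedAt.sum (Y := fun c ω => Y c ω * compensated N ν (cell h c) ω) fun c hc => ?_
  have h1 := mem_gridIdx.1 hc
  have h2 : (1 : ℝ) ≤ c.1 := by exact_mod_cast h1.1.1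
  rcases ht c hc with h3 | h3
  · refine ((hY c hc).mono (by linarith)).mul ?_
    exact adaptedAt_compensated hN (by positivity) (by linarith) h3
      (finiteRect_cell hν hh h1.2.2.1 _)
  · refine AEStronglyMeasurable.congr (f := fun _ => 0) aestronglyMeasurable_const ?_
    filter_upwards [h3] with ω hω
    simp [hω]

variable [IsProbabilityMeasure P] [SigmaFinite ν]

/-- Dominated convergence with `coneMajorant`. Almost every point has positive time and non-zero
jump, and avoids both the backward cone boundary of (t,x), where the kernel jumps, and the forward
cone boundary of (r,y), where u may be discontinuous. -/
theorem waveApprox_tendsto (h0 : ν {0} = 0) (hν : levyMoment ν 2 < ∞)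
    (hN : IsPoissonRandomMeasure P N (intensity ν)) (g : GridSeq)
    (hu : IsWaveField P N ν r y u) (t x : ℝ)
    (hK : ∀ s < t, ∀ᶠ k in atTop, s ≤ (g.K k + 1) * g.h k) :
    MemLp (waveIntegrand u t x) 2 (intensity ν) ∧
    Tendsto (fun k => eLpNorm (fun ξ => (waveApprox hν g hu t x k).toHilbert hN ξ -
      waveIntegrand u t x ξ) 2 (intensity ν)) atTop (𝓝 0) := by
  obtain ⟨C, hC0, hC⟩ := hu.bounded t
  have hform : ∀ k ξ, (waveApprox hν g hu t x k).toHilbert hN ξ =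
      if cellIdx (g.h k) ξ ∈ gridIdx (g.K k) (g.M k) then
      (waveG (t - timeIdx (g.h k) ξ.1 * g.h k) (x - spaceIdx (g.h k) ξ.2.1 * g.h k) *
        (jumpIdx (g.h k) ξ.2.2 * g.h k)) • clipH (Nat.cast_nonneg k : (0 : ℝ) ≤ k)
          (u (timeIdx (g.h k) ξ.1 * g.h k) (spaceIdx (g.h k) ξ.2.1 * g.h k)) else 0 := by
    intro k ξ
    exact gridProcess_toHilbert hν (g.pos k) _ _ hN
      (fun c _ => approxCoeff_ae_eq hu t x (g.h k) (Nat.cast_nonneg k) c) ξ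
  refine tendsto_eLpNorm_two_of_dominated (memLp_coneMajorant hν C (t + 2) x)
    (fun k => (ElementaryProcess.itoRel hN _).1.1) (fun k => ae_of_all _ fun ξ => ?_) ?_
  · rw [hform]
    split_ifs with hc
    · exact norm_corner_le (g.pos k) (g.le_one k) hc le_rfl (by simp) hC0
        fun h => (norm_clipH_le _ _).trans (hC _ _ h.le)
    · rw [norm_zero]
      unfold coneMajorant
      refine mul_nonneg hC0 (mul_nonneg ?_ (mul_nonneg ?_ (abs_nonneg _))) <;>
      exact Set.indicator_nonneg (fun _ _ => zero_le_one) _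
  · filter_upwards [ae_intensity_pos (ν := ν), ae_intensity_jump_ne_zero h0,
      ae_intensity_abs_ne (ν := ν) (g := fun s => t - s) (by fun_prop) x,
      ae_intensity_abs_ne (ν := ν) (g := fun s => s - r) (by fun_prop) y] with ξ h1 h2 h3 h4
    simp only [hform]
    refine tendsto_corner_smul g tendsto_const_nhds tendsto_const_nhds
      (tendsto_clipH_of_tendsto ?_) h1 h2 h3 (hK ξ.1)
    exact (hu.continuousAt (ξ.1, ξ.2.1) h4).tendsto.comp
      ((g.tendsto_corner_fst ξ.1).prodMk_nhds (g.tendsto_corner_snd ξ.2.1))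

/-- The grids with mesh `t / (k + 1)`, whose cells end before time `t`. -/
noncomputable def gridUpTo {t : ℝ} (ht : 0 < t) : GridSeq where
  -- Adding ⌈t⌉₊ keeps the mesh at most 1. The last cell, of index `K k`, ends exactly at t, so
  -- integrals over the grid are ℱ_t-measurable. The square in `M` lets the extent M h diverge.
  h k := t / (k + ⌈t⌉₊ + 1 : ℕ)
  K k := k + ⌈t⌉₊
  M k := (k + ⌈t⌉₊ + 1) ^ 2
  pos k := by positivity
  le_one k := by
    rw [div_le_one (by positivity)]
    push_cast
    have := Nat.le_ceil t
    have h2 : (0 : ℝ) ≤ k := Nat.cast_nonneg k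
    linarith
  tendsto_h := by
    have h1 : Tendsto (fun k : ℕ => k + ⌈t⌉₊ + 1) atTop atTop :=
      tendsto_atTop_mono (fun k => show k ≤ k + ⌈t⌉₊ + 1 by omega) tendsto_id
    exact (tendsto_const_div_atTop_nhds_zero_nat t).comp h1
  tendsto_M := by
    have h1 : Tendsto (fun k : ℕ => k + ⌈t⌉₊ + 1) atTop atTop :=
      tendsto_atTop_mono (fun k => show k ≤ k + ⌈t⌉₊ + 1 by omega) tendsto_id
    have h2 : Tendsto (fun k : ℕ => ((k + ⌈t⌉₊ + 1 : ℕ) : ℝ) * t) atTop atTop :=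
      (tendsto_natCast_atTop_atTop.comp h1).atTop_mul_const ht
    refine h2.congr fun k => ?_
    push_cast
    field_simp

theorem gridUpTo_end {t : ℝ} (ht : 0 < t) (k : ℕ) :
    ((gridUpTo ht).K k + 1) * (gridUpTo ht).h k = t := by
  simp only [gridUpTo]
  push_cast
  field_simp

/-- Existence of the stochastic convolution, with its elementary approximations. -/
theorem exists_stochastic_convolution (h0 : ν {0} = 0) (hν : levyMoment ν 2 < ∞)
    (hN : IsPoissonRandomMeasure P N (intensity ν)) (hu : IsWaveField P N ν r y u) {t : ℝ}
    (ht : 0 < t) (x : ℝ) : ∃ X : HSp P, ItoRel P N ν (waveIntegrand u t x) X ∧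
      AdaptedAt P N ν t X ∧
      Tendsto (fun k => ((waveApprox hν (gridUpTo ht) hu t x k).memLp_integral hN).toLp _)
        atTop (𝓝 X) := by
  obtain ⟨hm, hlim⟩ := waveApprox_tendsto h0 hν hN (gridUpTo ht) hu t x
    (fun s hs => Eventually.of_forall fun k => by rw [gridUpTo_end ht]; exact hs.le)
  obtain ⟨X, hX, hXl⟩ := ItoRel.exists_of_tendsto hN
    (fun k => (waveApprox hν (gridUpTo ht) hu t x k).itoRel hN) hm hlim
  refine ⟨X, hX, adaptedAt_of_tendsto hN (Eventually.of_forall fun k => ?_) hXl, hXl⟩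
  refine AEStronglyMeasurable.congr ?_ (MemLp.coeFn_toLp _).symm
  simp only [waveApprox, funext (gridProcess_integral hν _ _ _)]
  refine adaptedAt_gridProcess_integral hν hN ((gridUpTo ht).pos k)
    (fun c _ => (measurable_approxCoeff hu t x _ k c).stronglyMeasurable.aestronglyMeasurable)
    (fun c hc => Or.inl ?_)
  have h1 : (c.1 : ℝ) ≤ (gridUpTo ht).K k := by exact_mod_cast (mem_gridIdx.1 hc).1.2
  calc _ ≤ ((gridUpTo ht).K k + 1) * (gridUpTo ht).h k := by
        have := (gridUpTo ht).pos k; gcongr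
    _ = t := gridUpTo_end ht k

end Approximation

end LevyWave

namespace LevyWave

/-! ### Integrals over backward light cones. -/

section ConeIntegrals

theorem tendsto_eLpNorm_two_of_dominated' {α E : Type*} [MeasurableSpace α] {μ : Measure α}
    [NormedAddCommGroup E] {f : ℕ → α → E} {F : α → E} {g : α → ℝ} (hg : MemLp g 2 μ)
    (hf : ∀ k, AEStronglyMeasurable (f k) μ) (hb : ∀ᶠ k in atTop, ∀ᵐ a ∂μ, ‖f k a‖ ≤ g a)
    (hlim : ∀ᵐ a ∂μ, Tendsto (fun k => f k a) atTop (𝓝 (F a))) :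
    MemLp F 2 μ ∧ Tendsto (fun k => eLpNorm (fun a => f k a - F a) 2 μ) atTop (𝓝 0) := by
  obtain ⟨k₀, hk₀⟩ := eventually_atTop.1 hb
  have := tendsto_eLpNorm_two_of_dominated (f := fun k => f (k + k₀)) (F := F) hg
    (fun k => hf _) (fun k => hk₀ _ (by omega)) (by
      filter_upwards [hlim] with a ha
      exact (tendsto_add_atTop_iff_nat k₀).2 ha)
  exact ⟨this.1, (tendsto_add_atTop_iff_nat k₀).1 this.2⟩

theorem lintegral_exp_Iic_le {c : ℝ} (hc : 0 ≤ c) (t : ℝ) :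
    ∫⁻ s in Set.Iic t, ENNReal.ofReal (c * Real.exp (c * s)) ≤ ENNReal.ofReal (Real.exp (c * t)) := by
  rcases hc.eq_or_lt with rfl | hc
  · simp
  · rw [← ofReal_integral_eq_lintegral_ofReal ((integrableOn_exp_mul_Iic hc t).const_mul c)
      (ae_of_all _ fun s => by positivity), integral_const_mul, integral_exp_mul_Iic hc]
    refine ENNReal.ofReal_le_ofReal (le_of_eq ?_)
    field_simp

variable {ν : Measure ℝ} [SigmaFinite ν]

/-- Tonelli: the slice of the cone at time s is an interval of length 2(t - s). For s ≥ t both sides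
vanish, since `ENNReal.ofReal` truncates at 0. -/
theorem lintegral_cone {φ : ℝ → ℝ≥0∞} (hφ : Measurable φ) (t x q : ℝ) :
    ∫⁻ ξ, (if |x - ξ.2.1| < t - ξ.1 then φ ξ.1 else 0) * ENNReal.ofReal (|ξ.2.2| ^ q)
      ∂intensity ν =
    levyMoment ν q * ∫⁻ s in Set.Ici 0, ENNReal.ofReal (2 * (t - s)) * φ s := by
  have hm : Measurable fun p : ℝ × ℝ => if |x - p.2| < t - p.1 then φ p.1 else 0 :=
    Measurable.ite (measurableSet_lt (by fun_prop) (by fun_prop)) (hφ.comp measurable_fst)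
      measurable_const
  have hz : Measurable fun z : ℝ => ENNReal.ofReal (|z| ^ q) := by fun_prop
  have hm' : Measurable fun ξ : Pt => (if |x - ξ.2.1| < t - ξ.1 then φ ξ.1 else 0) *
      ENNReal.ofReal (|ξ.2.2| ^ q) :=
    (hm.comp (measurable_fst.prodMk (measurable_fst.comp measurable_snd))).mul
      (hz.comp (measurable_snd.comp measurable_snd))
  rw [intensity, lintegral_prod _ hm'.aemeasurable, ← lintegral_const_mul _ (by fun_prop)]
  refine lintegral_congr fun s => ?_
  have hms : Measurable fun w : ℝ => if |x - w| < t - s then φ s else 0 :=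
    hm.comp (measurable_const.prodMk measurable_id)
  rw [lintegral_prod_mul hms.aemeasurable hz.aemeasurable, mul_comm]
  congr 1
  have : (fun w : ℝ => if |x - w| < t - s then φ s else 0) =
      (Set.Ioo (x - (t - s)) (x + (t - s))).indicator (fun _ => φ s) := by
    ext w
    rw [Set.indicator_apply]
    congr 1
    rw [Set.mem_Ioo, abs_lt]
    apply propext
    constructor <;> rintro ⟨h1, h2⟩ <;> constructor <;> linarith
  rw [this, lintegral_indicator measurableSet_Ioo, lintegral_const, Measure.restrict_apply_univ,
    Real.volume_Ioo, mul_comm]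
  congr 2
  ring

/-- The slice length is bounded by 2T on [0,t], and the density c e^{cs} integrates to at most
e^{ct} over (-∞,t]. The factor c is kept inside, so that c = 0 needs no division. -/
theorem lintegral_two_mul_sub_le {b c t T : ℝ} (hb : 0 ≤ b) (hc : 0 ≤ c) (hT : t ≤ T)
    (hT0 : 0 ≤ T) :
    ∫⁻ s in Set.Ici 0, ENNReal.ofReal (2 * (t - s)) *
      ENNReal.ofReal (b * (c * Real.exp (c * s))) ≤
    ENNReal.ofReal (2 * T * b * Real.exp (c * t)) := by
  have h1 : ∀ s ∈ Set.Ici (0 : ℝ), ENNReal.ofReal (2 * (t - s)) *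
      ENNReal.ofReal (b * (c * Real.exp (c * s))) ≤
      (Set.Iic t).indicator (fun s => ENNReal.ofReal (2 * T * b) *
        ENNReal.ofReal (c * Real.exp (c * s))) s := by
    intro s hs
    rw [Set.mem_Ici] at hs
    rw [Set.indicator_apply]
    split_ifs with h
    · rw [ENNReal.ofReal_mul hb, ← mul_assoc, ENNReal.ofReal_mul (p := 2 * T) (by positivity)]
      gcongr
      linarith
    · rw [Set.mem_Iic, not_le] at h
      rw [ENNReal.ofReal_of_nonpos (by linarith), zero_mul]
  calc _ ≤ ∫⁻ s in Set.Ici 0, (Set.Iic t).indicator (fun s => ENNReal.ofReal (2 * T * b) *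
        ENNReal.ofReal (c * Real.exp (c * s))) s := setLIntegral_mono' measurableSet_Ici h1
    _ ≤ ∫⁻ s, (Set.Iic t).indicator (fun s => ENNReal.ofReal (2 * T * b) *
        ENNReal.ofReal (c * Real.exp (c * s))) s := setLIntegral_le_lintegral _ _
    _ = ENNReal.ofReal (2 * T * b) * ∫⁻ s in Set.Iic t, ENNReal.ofReal (c * Real.exp (c * s)) := by
        rw [lintegral_indicator measurableSet_Iic, lintegral_const_mul _ (by fun_prop)]
    _ ≤ ENNReal.ofReal (2 * T * b) * ENNReal.ofReal (Real.exp (c * t)) := by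
        gcongr; exact lintegral_exp_Iic_le hc t
    _ = _ := by rw [← ENNReal.ofReal_mul (by positivity)]

end ConeIntegrals

/-! ### Stochastic convolutions: continuity, adaptedness, weighted bounds. -/

section Convolution

variable {Ω : Type*} [mΩ : MeasurableSpace Ω] {P : Measure Ω} {N : Ω → Measure Pt} {ν : Measure ℝ}
  [IsProbabilityMeasure P] [SigmaFinite ν]

/-- `u` is bounded on `(-∞, T] × ℝ` for every `T`. -/
def LocBounded (u : ℝ → ℝ → HSp P) : Prop :=
  ∀ T, ∃ C : ℝ, 0 ≤ C ∧ ∀ t x, t ≤ T → ‖u t x‖ ≤ C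

theorem norm_waveIntegrand_le {u : ℝ → ℝ → HSp P} {C t T x x' : ℝ} (hC : 0 ≤ C)
    (hu : ∀ s w, s ≤ T → ‖u s w‖ ≤ C) (ht : t ≤ T) (hx : |x - x'| ≤ 1) {ξ : Pt} (hξ : 0 < ξ.1) :
    ‖waveIntegrand u t x ξ‖ ≤ coneMajorant C (T + 2) x' ξ := by
  have hnn : 0 ≤ coneMajorant C (T + 2) x' ξ := by
    unfold coneMajorant
    refine mul_nonneg hC (mul_nonneg ?_ (mul_nonneg ?_ (abs_nonneg _))) <;>
    exact Set.indicator_nonneg (fun _ _ => zero_le_one) _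
  rw [waveIntegrand]
  by_cases hG : |x - ξ.2.1| < t - ξ.1
  · have a7 := (abs_nonneg _).trans_lt hG
    rw [abs_lt] at hG
    rw [abs_le] at hx
    have m1 : ξ.1 ∈ Set.Icc 0 (T + 2) := ⟨by linarith, by linarith⟩
    have m2 : ξ.2.1 ∈ Set.Icc (x' - (T + 2)) (x' + (T + 2)) := ⟨by linarith, by linarith⟩
    rw [coneMajorant, Set.indicator_of_mem m1, Set.indicator_of_mem m2, norm_smul, norm_mul,
      Real.norm_of_nonneg (waveG_nonneg _ _), one_mul, one_mul, Real.norm_eq_abs, mul_comm C]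
    refine mul_le_mul ?_ (hu _ _ (by linarith)) (norm_nonneg _) (abs_nonneg _)
    calc _ ≤ 1 * |ξ.2.2| := mul_le_mul ((waveG_le _ _).trans (by norm_num))
          le_rfl (abs_nonneg _) (by norm_num)
      _ = |ξ.2.2| := one_mul _
  · rw [waveG, if_neg hG]
    simpa using hnn

theorem tendsto_waveIntegrand {t x : ℝ} {τ χ : ℕ → ℝ} (hτ : Tendsto τ atTop (𝓝 t))
    (hχ : Tendsto χ atTop (𝓝 x)) {u : ℕ → ℝ → ℝ → HSp P} {u' : ℝ → ℝ → HSp P} {ξ : Pt}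
    (hu : Tendsto (fun k => u k ξ.1 ξ.2.1) atTop (𝓝 (u' ξ.1 ξ.2.1)))
    (hξ : |ξ.2.1 - x| ≠ t - ξ.1) :
    Tendsto (fun k => waveIntegrand (u k) (τ k) (χ k) ξ) atTop (𝓝 (waveIntegrand u' t x ξ)) := by
  have h1 : ContinuousAt (fun q : ℝ × ℝ => waveG q.1 q.2) (t - ξ.1, x - ξ.2.1) :=
    continuousAt_waveG (by simpa [abs_sub_comm] using hξ)
  have h2 : Tendsto (fun k => waveG (τ k - ξ.1) (χ k - ξ.2.1)) atTop
      (𝓝 (waveG (t - ξ.1) (x - ξ.2.1))) :=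
    h1.tendsto.comp ((hτ.sub_const _).prodMk_nhds (hχ.sub_const _))
  exact (h2.mul_const _).smul hu

/-- Stochastic convolutions are continuous in `L²(Ω)`. -/
theorem continuous_of_itoRel (hν : levyMoment ν 2 < ∞)
    (hN : IsPoissonRandomMeasure P N (intensity ν)) {u X : ℝ → ℝ → HSp P} (hu : LocBounded u)
    (hX : ∀ t x, ItoRel P N ν (waveIntegrand u t x) (X t x)) :
    Continuous (fun q : ℝ × ℝ => X q.1 q.2) := by
  rw [continuous_iff_seqContinuous]
  intro q q₀ hq
  have hτ : Tendsto (fun k => (q k).1) atTop (𝓝 q₀.1) := (continuous_fst.tendsto q₀).comp hq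
  have hχ : Tendsto (fun k => (q k).2) atTop (𝓝 q₀.2) := (continuous_snd.tendsto q₀).comp hq
  obtain ⟨C, hC0, hC⟩ := hu (q₀.1 + 1)
  have h := tendsto_eLpNorm_two_of_dominated' (f := fun k => waveIntegrand u (q k).1 (q k).2)
    (F := waveIntegrand u q₀.1 q₀.2) (memLp_coneMajorant hν C (q₀.1 + 1 + 2) q₀.2)
    (fun k => (hX _ _).1.1) (by
      filter_upwards [hτ.eventually_le_const (lt_add_one q₀.1),
        (tendsto_iff_norm_sub_tendsto_zero.1 hχ).eventually_le_const one_pos] with k h1 h2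
      filter_upwards [ae_intensity_pos (ν := ν)] with ξ hξ
      exact norm_waveIntegrand_le hC0 hC h1 h2 hξ) (by
      filter_upwards [ae_intensity_abs_ne (ν := ν) (g := fun s => q₀.1 - s) (by fun_prop) q₀.2]
        with ξ hξ
      exact tendsto_waveIntegrand hτ hχ tendsto_const_nhds hξ)
  rw [tendsto_iff_norm_sub_tendsto_zero]
  have h2 : Tendsto (fun k => ‖X (q k).1 (q k).2 - X q₀.1 q₀.2‖ₑ) atTop (𝓝 0) :=
    h.2.congr fun k => (((hX _ _).sub (hX _ _)).enorm_eq hN).symm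
  have h3 := (ENNReal.tendsto_toReal ENNReal.zero_ne_top).comp h2
  simpa [Function.comp_def] using h3

theorem itoRel_waveIntegrand_of_nonpos {u : ℝ → ℝ → HSp P} {t : ℝ} (ht : t ≤ 0) (x : ℝ) :
    ItoRel P N ν (waveIntegrand u t x) 0 := by
  refine ItoRel.zero.congr ?_
  filter_upwards [ae_intensity_pos (ν := ν)] with ξ hξ
  rw [waveIntegrand, waveG_eq_zero (by have := abs_nonneg (x - ξ.2.1); linarith), zero_mul,
    zero_smul]

open Classical in
/-- The stochastic convolution of the field `u` with the fundamental solution. -/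
noncomputable def conv (N : Ω → Measure Pt) (ν : Measure ℝ) (u : ℝ → ℝ → HSp P) (t x : ℝ) :
    HSp P :=
  -- The default value 0 is not reached when u is a wave field, by `conv_itoRel`.
  if h : ∃ X, ItoRel P N ν (waveIntegrand u t x) X then h.choose else 0

theorem conv_eq (hN : IsPoissonRandomMeasure P N (intensity ν)) {u : ℝ → ℝ → HSp P} {t x : ℝ}
    {X : HSp P} (h : ItoRel P N ν (waveIntegrand u t x) X) : conv N ν u t x = X := by
  have h' : ∃ X, ItoRel P N ν (waveIntegrand u t x) X := ⟨X, h⟩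
  rw [conv, dif_pos h']
  exact h'.choose_spec.unique hN h

variable {r y : ℝ} {u : ℝ → ℝ → HSp P}

theorem conv_itoRel (h0 : ν {0} = 0) (hν : levyMoment ν 2 < ∞)
    (hN : IsPoissonRandomMeasure P N (intensity ν)) (hu : IsWaveField P N ν r y u) (t x : ℝ) :
    ItoRel P N ν (waveIntegrand u t x) (conv N ν u t x) := by
  rcases le_or_gt t 0 with ht | ht
  · have h := itoRel_waveIntegrand_of_nonpos (N := N) (ν := ν) (u := u) ht x
    rwa [conv_eq hN h]
  · obtain ⟨X, hX, -⟩ := exists_stochastic_convolution h0 hν hN hu ht x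
    rwa [conv_eq hN hX]

theorem conv_adapted (h0 : ν {0} = 0) (hν : levyMoment ν 2 < ∞)
    (hN : IsPoissonRandomMeasure P N (intensity ν)) (hu : IsWaveField P N ν r y u) (t x : ℝ) :
    AdaptedAt P N ν t (conv N ν u t x) := by
  rcases le_or_gt t 0 with ht | ht
  · have h := itoRel_waveIntegrand_of_nonpos (N := N) (ν := ν) (u := u) ht x
    rw [conv_eq hN h]
    exact AEStronglyMeasurable.congr (f := fun _ => 0) aestronglyMeasurable_const
      (Lp.coeFn_zero ℝ 2 P).symm
  · obtain ⟨X, hX, hXa, -⟩ := exists_stochastic_convolution h0 hν hN hu ht x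
    rwa [conv_eq hN hX]

theorem ofReal_abs_rpow_two (a : ℝ) : ENNReal.ofReal (|a| ^ (2 : ℝ)) = ‖a‖ₑ ^ 2 := by
  rw [Real.enorm_eq_ofReal_abs, ← ENNReal.ofReal_pow (abs_nonneg a)]
  norm_cast

/-- Control of a stochastic convolution by a bound that depends on time. -/
theorem ItoRel.enorm_sq_le (hN : IsPoissonRandomMeasure P N (intensity ν)) {t x : ℝ}
    {X : HSp P} (h : ItoRel P N ν (waveIntegrand u t x) X) {φ : ℝ → ℝ≥0∞} (hφ : Measurable φ)
    (hu : ∀ s w, s < t → ‖u s w‖ₑ ^ 2 ≤ φ s) :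
    ‖X‖ₑ ^ 2 ≤ ENNReal.ofReal (1 / 4) *
      (levyMoment ν 2 * ∫⁻ s in Set.Ici 0, ENNReal.ofReal (2 * (t - s)) * φ s) := by
  rw [h.enorm_sq_eq hN, ← lintegral_cone hφ t x 2, ← lintegral_const_mul]
  · refine lintegral_mono fun ξ => ?_
    rw [waveIntegrand, enorm_smul, mul_pow, enorm_mul, mul_pow]
    split_ifs with hG
    · have h1 : ‖waveG (t - ξ.1) (x - ξ.2.1)‖ₑ ^ 2 = ENNReal.ofReal (1 / 4) := by
        rw [waveG, if_pos hG, Real.enorm_eq_ofReal (by norm_num),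
          ← ENNReal.ofReal_pow (by norm_num)]
        norm_num
      rw [h1, ofReal_abs_rpow_two, mul_assoc, mul_comm (φ _)]
      gcongr
      exact hu _ _ (by have := (abs_nonneg _).trans_lt hG; linarith)
    · rw [waveG, if_neg hG]
      simp
  · refine Measurable.mul (Measurable.ite (measurableSet_lt (by fun_prop) (by fun_prop))
      (hφ.comp measurable_fst) measurable_const) (by fun_prop)

/-- The contraction behind existence and uniqueness. Here 1/4 is the square of the kernel, the cone
contributes 2 m₂ T, and integrating e^{ls} gains 1/l; the choice of l absorbs 2 m₂ T and leaves the
factor 1/4. -/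
theorem cone_exp_le {ν : Measure ℝ} (hν : levyMoment ν 2 < ∞) {t T b l : ℝ} (hT : t ≤ T)
    (hT0 : 0 ≤ T) (hb : 0 ≤ b) (hl : 2 * (levyMoment ν 2).toReal * T ≤ l) (hl0 : 0 < l) :
    ENNReal.ofReal (1 / 4) * (levyMoment ν 2 * ∫⁻ s in Set.Ici 0, ENNReal.ofReal (2 * (t - s)) *
      ENNReal.ofReal (b * Real.exp (l * s))) ≤ ENNReal.ofReal (b / 4 * Real.exp (l * t)) := by
  have h1 := lintegral_two_mul_sub_le (b := b / l) (c := l) (by positivity) hl0.le hT hT0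
  have h2 : ∀ s : ℝ, b / l * (l * Real.exp (l * s)) = b * Real.exp (l * s) := by
    intro s; field_simp
  simp only [h2] at h1
  set m := (levyMoment ν 2).toReal with hm
  have hm0 : 0 ≤ m := ENNReal.toReal_nonneg
  calc _ ≤ ENNReal.ofReal (1 / 4) * (ENNReal.ofReal m *
        ENNReal.ofReal (2 * T * (b / l) * Real.exp (l * t))) := by
        rw [hm, ENNReal.ofReal_toReal hν.ne]; gcongr
    _ = ENNReal.ofReal (1 / 4 * (m * (2 * T * (b / l) * Real.exp (l * t)))) := by
        rw [← ENNReal.ofReal_mul hm0, ← ENNReal.ofReal_mul (by norm_num)]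
    _ ≤ _ := by
        refine ENNReal.ofReal_le_ofReal ?_
        have h3 : 1 / 4 * (m * (2 * T * (b / l) * Real.exp (l * t))) =
            (2 * m * T) / l * (b / 4 * Real.exp (l * t)) := by field_simp
        rw [h3]
        have h4 : 2 * m * T / l ≤ 1 := (div_le_one hl0).2 hl
        have h5 : 0 ≤ b / 4 * Real.exp (l * t) := by positivity
        nlinarith

theorem ItoRel.enorm_sq_le_exp (hN : IsPoissonRandomMeasure P N (intensity ν))
    (hν : levyMoment ν 2 < ∞) {t x T b l : ℝ} (hT : t ≤ T) (hT0 : 0 ≤ T) (hb : 0 ≤ b)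
    (hl : 2 * (levyMoment ν 2).toReal * T ≤ l) (hl0 : 0 < l)
    {X : HSp P} (h : ItoRel P N ν (waveIntegrand u t x) X)
    (hu : ∀ s w, s < t → ‖u s w‖ₑ ^ 2 ≤ ENNReal.ofReal (b * Real.exp (l * s))) :
    ‖X‖ₑ ^ 2 ≤ ENNReal.ofReal (b / 4 * Real.exp (l * t)) := by
  exact (h.enorm_sq_le hN (φ := fun s => ENNReal.ofReal (b * Real.exp (l * s)))
    (by fun_prop) hu).trans
    (cone_exp_le hν hT hT0 hb hl hl0)

theorem locBounded_of_itoRel (hν : levyMoment ν 2 < ∞)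
    (hN : IsPoissonRandomMeasure P N (intensity ν)) {X : ℝ → ℝ → HSp P} (hu : LocBounded u)
    (hX : ∀ t x, ItoRel P N ν (waveIntegrand u t x) (X t x)) : LocBounded X := by
  intro T
  obtain ⟨C, hC0, hC⟩ := hu T
  set T' := max T 0
  set m := (levyMoment ν 2).toReal with hm
  have hm0 : 0 ≤ m := ENNReal.toReal_nonneg
  refine ⟨Real.sqrt (1 / 4 * (m * (2 * T' * (C ^ 2) * T'))), Real.sqrt_nonneg _,
    fun t x ht => ?_⟩
  have hT' : 0 ≤ T' := le_max_right _ _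
  have h1 := (hX t x).enorm_sq_le hN (φ := fun _ => ENNReal.ofReal (C ^ 2)) measurable_const
    (fun s w hs => by
      rw [← ofReal_norm, ← ENNReal.ofReal_pow (norm_nonneg _)]
      exact ENNReal.ofReal_le_ofReal (pow_le_pow_left₀ (norm_nonneg _) (hC s w (hs.le.trans ht)) 2))
  have h2 : ∫⁻ s in Set.Ici 0, ENNReal.ofReal (2 * (t - s)) * ENNReal.ofReal (C ^ 2) ≤
      ENNReal.ofReal (2 * T' * (C ^ 2) * T') := by
    calc _ ≤ ∫⁻ s in Set.Ici 0, (Set.Icc 0 T').indicator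
            (fun _ => ENNReal.ofReal (2 * T' * (C ^ 2))) s := by
          refine setLIntegral_mono' measurableSet_Ici fun s hs => ?_
          rw [Set.mem_Ici] at hs
          rw [Set.indicator_apply]
          have : t ≤ T' := ht.trans (le_max_left _ _)
          split_ifs with h
          · rw [← ENNReal.ofReal_mul' (by positivity)]
            refine ENNReal.ofReal_le_ofReal ?_
            gcongr
            linarith
          · have : T' < s := by
              by_contra h'
              exact h ⟨hs, not_lt.1 h'⟩
            rw [ENNReal.ofReal_of_nonpos (by linarith), zero_mul]
      _ ≤ ∫⁻ s, (Set.Icc 0 T').indicator (fun _ => ENNReal.ofReal (2 * T' * (C ^ 2))) s :=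
          setLIntegral_le_lintegral _ _
      _ = _ := by
          rw [lintegral_indicator measurableSet_Icc, lintegral_const, Measure.restrict_apply_univ,
            Real.volume_Icc, sub_zero, ← ENNReal.ofReal_mul (by positivity)]
  rw [← ofReal_norm, ← ENNReal.ofReal_pow (norm_nonneg _)] at h1
  have h3 : ENNReal.ofReal (‖X t x‖ ^ 2) ≤
      ENNReal.ofReal (1 / 4 * (m * (2 * T' * (C ^ 2) * T'))) := by
    rw [ENNReal.ofReal_mul (p := 1 / 4) (by norm_num), ENNReal.ofReal_mul (p := m) hm0, hm,
      ENNReal.ofReal_toReal hν.ne]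
    exact h1.trans (by gcongr)
  rw [ENNReal.ofReal_le_ofReal_iff (by positivity)] at h3
  exact Real.le_sqrt_of_sq_le h3

/-- The convolution is even continuous everywhere: local boundedness of u suffices for that, so the
discontinuity of the first Picard term is lost after one step. -/
theorem isWaveField_conv (h0 : ν {0} = 0) (hν : levyMoment ν 2 < ∞)
    (hN : IsPoissonRandomMeasure P N (intensity ν)) (hu : IsWaveField P N ν r y u) :
    IsWaveField P N ν r y (conv N ν u) where
  adapted := conv_adapted h0 hν hN hu
  continuousAt _ _ :=
    (continuous_of_itoRel hν hN hu.bounded (conv_itoRel h0 hν hN hu)).continuousAt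
  bounded := locBounded_of_itoRel hν hN hu.bounded (conv_itoRel h0 hν hN hu)

end Convolution

end LevyWave

namespace LevyWave

/-! ### The Picard series and the mild equation. -/

section Picard

variable {Ω : Type*} [mΩ : MeasurableSpace Ω] {P : Measure Ω} {N : Ω → Measure Pt} {ν : Measure ℝ}
  [IsProbabilityMeasure P] [SigmaFinite ν]

/-- The Picard differences; the `n`-th one is the `n`-th chaos of the solution. -/
noncomputable def picardTerm (P : Measure Ω) [IsProbabilityMeasure P] (N : Ω → Measure Pt)
    (ν : Measure ℝ) (r y z : ℝ) : ℕ → ℝ → ℝ → HSp P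
  | 0 => fun t x => Lp.const 2 P (waveG (t - r) (x - y) * z)
  | n + 1 => conv N ν (picardTerm P N ν r y z n)

/-- The solution, as a field with values in `L²(Ω)`. -/
noncomputable def solH (P : Measure Ω) [IsProbabilityMeasure P] (N : Ω → Measure Pt)
    (ν : Measure ℝ) (r y z t x : ℝ) : HSp P :=
  ∑' n, picardTerm P N ν r y z n t x

theorem norm_const_HSp (c : ℝ) : ‖(Lp.const 2 P c : HSp P)‖ = |c| := by
  rw [Lp.norm_const]
  · simp
  · simp

variable {r y z : ℝ}

theorem isWaveField_picardTerm (h0 : ν {0} = 0) (hν : levyMoment ν 2 < ∞)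
    (hN : IsPoissonRandomMeasure P N (intensity ν)) (r y z : ℝ) (n : ℕ) :
    IsWaveField P N ν r y (picardTerm P N ν r y z n) := by
  induction n with
  | zero =>
    refine ⟨fun t x => ?_, fun q hq => ?_, fun T => ⟨|z|, abs_nonneg z, fun t x _ => ?_⟩⟩
    · exact AEStronglyMeasurable.congr (f := fun _ => waveG (t - r) (x - y) * z)
        aestronglyMeasurable_const (Lp.coeFn_const ..).symm
    · have h1 : ContinuousAt (fun q : ℝ × ℝ => waveG (q.1 - r) (q.2 - y) * z) q := by
        refine ContinuousAt.mul ?_ continuousAt_const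
        exact ContinuousAt.comp (g := fun q : ℝ × ℝ => waveG q.1 q.2)
          (f := fun q : ℝ × ℝ => (q.1 - r, q.2 - y)) (continuousAt_waveG hq) (by fun_prop)
      exact ((Lp.constL 2 P ℝ).continuous.continuousAt).comp h1
    · simp only [picardTerm]
      rw [norm_const_HSp, abs_mul, abs_of_nonneg (waveG_nonneg _ _)]
      nlinarith [waveG_le (t - r) (x - y), abs_nonneg z]
  | succ n ih => exact isWaveField_conv h0 hν hN ih

theorem itoRel_picardTerm (h0 : ν {0} = 0) (hν : levyMoment ν 2 < ∞)
    (hN : IsPoissonRandomMeasure P N (intensity ν)) (r y z : ℝ) (n : ℕ) (t x : ℝ) :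
    ItoRel P N ν (waveIntegrand (picardTerm P N ν r y z n) t x)
      (picardTerm P N ν r y z (n + 1) t x) :=
  conv_itoRel h0 hν hN (isWaveField_picardTerm h0 hν hN r y z n) t x

/-- If (s,w) lies in the backward cone of (t,x) and t - r ≤ |x - y|, the triangle inequality gives s
- r ≤ |w - y|. So the integrand vanishes identically by induction, and uniqueness of the integral
concludes. -/
theorem picardTerm_eq_zero (h0 : ν {0} = 0) (hν : levyMoment ν 2 < ∞)
    (hN : IsPoissonRandomMeasure P N (intensity ν)) (n : ℕ) :
    ∀ t x, t - r ≤ |x - y| → picardTerm P N ν r y z n t x = 0 := by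
  induction n with
  | zero =>
    intro t x h
    simp [picardTerm, waveG_eq_zero h]
  | succ n ih =>
    intro t x h
    refine (itoRel_picardTerm h0 hν hN r y z n t x).unique hN ?_
    convert ItoRel.zero using 1
    ext1 ξ
    rw [waveIntegrand]
    by_cases hG : |x - ξ.2.1| < t - ξ.1
    · rw [ih ξ.1 ξ.2.1, smul_zero]
      have := abs_sub_le x ξ.2.1 y
      linarith
    · rw [waveG, if_neg hG, zero_mul, zero_smul]

/-- Each convolution costs a factor 1/4 in the weighted squared norm. In the base case r ≥ 0 ensures
that the term vanishes for t ≤ 0, where the weight e^{lt} would be less than 1. -/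
theorem enorm_sq_picardTerm_le (h0 : ν {0} = 0) (hν : levyMoment ν 2 < ∞)
    (hN : IsPoissonRandomMeasure P N (intensity ν)) (hr : 0 ≤ r) {T l : ℝ} (hT : 0 ≤ T)
    (hl : 2 * (levyMoment ν 2).toReal * T ≤ l) (hl0 : 0 < l) (n : ℕ) :
    ∀ t x, t ≤ T → ‖picardTerm P N ν r y z n t x‖ₑ ^ 2 ≤
      ENNReal.ofReal (z ^ 2 * (1 / 4) ^ n * Real.exp (l * t)) := by
  induction n with
  | zero =>
    intro t x ht
    simp only [picardTerm]
    rw [← ofReal_norm, norm_const_HSp, ← ENNReal.ofReal_pow (abs_nonneg _), sq_abs]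
    refine ENNReal.ofReal_le_ofReal ?_
    rcases le_or_gt t 0 with h | h
    · rw [waveG_eq_zero (by have := abs_nonneg (x - y); linarith)]
      rw [zero_mul, zero_pow (by norm_num)]
      positivity
    · have h1 : 1 ≤ Real.exp (l * t) := Real.one_le_exp (by positivity)
      have h2 := waveG_nonneg (t - r) (x - y)
      have h3 := waveG_le (t - r) (x - y)
      have h4 : waveG (t - r) (x - y) ^ 2 ≤ 1 := by nlinarith
      rw [mul_pow, pow_zero, mul_one]
      nlinarith [sq_nonneg z]
  | succ n ih =>
    intro t x ht
    have := (itoRel_picardTerm h0 hν hN r y z n t x).enorm_sq_le_exp hN hν ht hT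
      (b := z ^ 2 * (1 / 4) ^ n) (by positivity) hl hl0 (fun s w hs => ih s w (hs.le.trans ht))
    refine this.trans (ENNReal.ofReal_le_ofReal (le_of_eq ?_))
    rw [pow_succ]; ring

theorem exists_norm_picardTerm_le (h0 : ν {0} = 0) (hν : levyMoment ν 2 < ∞)
    (hN : IsPoissonRandomMeasure P N (intensity ν)) (hr : 0 ≤ r) (y z T : ℝ) :
    ∃ C : ℝ, 0 ≤ C ∧ ∀ n t x, t ≤ T → ‖picardTerm P N ν r y z n t x‖ ≤ C * (1 / 2) ^ n := by
  set T' := max T 0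
  have hT' : 0 ≤ T' := le_max_right _ _
  -- The summand 1 only ensures l > 0, also when m₂ or T' is zero.
  set l := 2 * (levyMoment ν 2).toReal * T' + 1
  have hl0 : 0 < l := by positivity
  refine ⟨|z| * Real.exp (l * T' / 2), by positivity, fun n t x ht => ?_⟩
  have ht' : t ≤ T' := ht.trans (le_max_left _ _)
  have h1 := enorm_sq_picardTerm_le (y := y) (z := z) h0 hν hN hr hT' (l := l) (by linarith) hl0
    n t x ht'
  rw [← ofReal_norm, ← ENNReal.ofReal_pow (norm_nonneg _),
    ENNReal.ofReal_le_ofReal_iff (by positivity)] at h1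
  refine le_of_sq_le_sq ?_ (by positivity)
  refine h1.trans ?_
  rw [mul_pow, mul_pow, sq_abs, ← Real.exp_nat_mul, ← pow_mul, mul_comm n 2, pow_mul]
  have h2 : Real.exp (l * t) ≤ Real.exp (l * T') := Real.exp_le_exp.2 (by gcongr)
  have h3 : ((2 : ℕ) : ℝ) * (l * T' / 2) = l * T' := by push_cast; ring
  rw [h3]
  norm_num
  nlinarith [mul_nonneg (sq_nonneg z) (show (0 : ℝ) ≤ (1 / 4) ^ n by positivity)]

theorem summable_picardTerm (h0 : ν {0} = 0) (hν : levyMoment ν 2 < ∞)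
    (hN : IsPoissonRandomMeasure P N (intensity ν)) (hr : 0 ≤ r) (y z t x : ℝ) :
    Summable fun n => picardTerm P N ν r y z n t x := by
  obtain ⟨C, -, hC⟩ := exists_norm_picardTerm_le h0 hν hN hr y z t
  exact Summable.of_norm_bounded ((summable_geometric_of_lt_one (by norm_num)
    (by norm_num)).mul_left C) fun n => hC n t x le_rfl

theorem solH_eq (h0 : ν {0} = 0) (hν : levyMoment ν 2 < ∞)
    (hN : IsPoissonRandomMeasure P N (intensity ν)) (hr : 0 ≤ r) (y z t x : ℝ) :
    solH P N ν r y z t x = Lp.const 2 P (waveG (t - r) (x - y) * z) +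
      ∑' n, picardTerm P N ν r y z (n + 1) t x := by
  rw [solH, (summable_picardTerm h0 hν hN hr y z t x).tsum_eq_zero_add]
  rfl

theorem norm_sum_picardTerm_le (h0 : ν {0} = 0) (hν : levyMoment ν 2 < ∞)
    (hN : IsPoissonRandomMeasure P N (intensity ν)) (hr : 0 ≤ r) (y z T : ℝ) :
    ∃ C : ℝ, 0 ≤ C ∧ ∀ (s : Finset ℕ) (t x : ℝ), t ≤ T →
      ‖∑ n ∈ s, picardTerm P N ν r y z n t x‖ ≤ C := by
  obtain ⟨C, hC0, hC⟩ := exists_norm_picardTerm_le h0 hν hN hr y z T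
  refine ⟨C * 2, by positivity, fun s t x ht => ?_⟩
  have hs : Summable fun n : ℕ => C * (1 / 2 : ℝ) ^ n :=
    (summable_geometric_of_lt_one (by norm_num) (by norm_num)).mul_left C
  calc _ ≤ ∑ n ∈ s, ‖picardTerm P N ν r y z n t x‖ := norm_sum_le _ _
    _ ≤ ∑ n ∈ s, C * (1 / 2) ^ n := Finset.sum_le_sum fun n _ => hC n t x ht
    _ ≤ ∑' n, C * (1 / 2 : ℝ) ^ n := hs.sum_le_tsum _ fun n _ => by positivity
    _ = C * 2 := by rw [tsum_mul_left, tsum_geometric_two]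

/-- The mild equation for `solH`. -/
theorem itoRel_solH (h0 : ν {0} = 0) (hν : levyMoment ν 2 < ∞)
    (hN : IsPoissonRandomMeasure P N (intensity ν)) (hr : 0 ≤ r) (y z t x : ℝ) :
    ItoRel P N ν (waveIntegrand (solH P N ν r y z) t x)
      (∑' n, picardTerm P N ν r y z (n + 1) t x) := by
  set v : ℕ → ℝ → ℝ → HSp P := fun M s w => ∑ n ∈ Finset.range M, picardTerm P N ν r y z n s w
  have hsum : ∀ M, ItoRel P N ν (waveIntegrand (v M) t x)
      (∑ n ∈ Finset.range M, picardTerm P N ν r y z (n + 1) t x) := by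
    intro M
    have := ItoRel.sum (Finset.range M) fun n _ => itoRel_picardTerm h0 hν hN r y z n t x
    convert this using 1
    ext1 ξ
    simp only [waveIntegrand, v, Finset.smul_sum]
  -- A bound uniform over all partial sums provides the majorant for passing to the limit inside the
  -- integral.
  obtain ⟨C, hC0, hC⟩ := norm_sum_picardTerm_le h0 hν hN hr y z t
  obtain ⟨hm, hlim⟩ := tendsto_eLpNorm_two_of_dominated
    (f := fun M => waveIntegrand (v M) t x) (F := waveIntegrand (solH P N ν r y z) t x)
    (memLp_coneMajorant hν C (t + 2) x) (fun M => (hsum M).1.1)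
    (fun M => by
      filter_upwards [ae_intensity_pos (ν := ν)] with ξ hξ
      exact norm_waveIntegrand_le hC0 (fun s w hs => hC _ s w hs) le_rfl (by simp) hξ)
    (by
      filter_upwards [ae_intensity_abs_ne (ν := ν) (g := fun s => t - s) (by fun_prop) x] with ξ hξ
      refine tendsto_waveIntegrand tendsto_const_nhds tendsto_const_nhds ?_ hξ
      exact (summable_picardTerm h0 hν hN hr y z ξ.1 ξ.2.1).hasSum.tendsto_sum_nat)
  refine ItoRel.of_tendsto hN hsum hm hlim ?_
  exact ((summable_nat_add_iff 1).2
    (summable_picardTerm h0 hν hN hr y z t x)).hasSum.tendsto_sum_nat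

theorem locBounded_solH (h0 : ν {0} = 0) (hν : levyMoment ν 2 < ∞)
    (hN : IsPoissonRandomMeasure P N (intensity ν)) (hr : 0 ≤ r) (y z : ℝ) :
    LocBounded (solH P N ν r y z) := by
  intro T
  obtain ⟨C, hC0, hC⟩ := norm_sum_picardTerm_le h0 hν hN hr y z T
  exact ⟨C, hC0, fun t x ht => le_of_tendsto
    (summable_picardTerm h0 hν hN hr y z t x).hasSum.norm (Eventually.of_forall fun s => hC s t x ht)⟩

/-- The tail is the convolution of the locally bounded field `solH`, hence continuous in L²(Ω). The
term of order 0 is excluded, as it jumps across the light cone of (r,y). -/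
theorem continuous_tail (h0 : ν {0} = 0) (hν : levyMoment ν 2 < ∞)
    (hN : IsPoissonRandomMeasure P N (intensity ν)) (hr : 0 ≤ r) (y z : ℝ) :
    Continuous fun q : ℝ × ℝ => ∑' n, picardTerm P N ν r y z (n + 1) q.1 q.2 :=
  continuous_of_itoRel hν hN (locBounded_solH h0 hν hN hr y z) (itoRel_solH h0 hν hN hr y z)

theorem adaptedAt_tail (h0 : ν {0} = 0) (hν : levyMoment ν 2 < ∞)
    (hN : IsPoissonRandomMeasure P N (intensity ν)) (hr : 0 ≤ r) (y z t x : ℝ) :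
    AdaptedAt P N ν t (∑' n, picardTerm P N ν r y z (n + 1) t x : HSp P) := by
  refine adaptedAt_of_tendsto hN (X := fun M => ∑ n ∈ Finset.range M,
    picardTerm P N ν r y z (n + 1) t x) (Eventually.of_forall fun M => ?_)
    ((summable_nat_add_iff 1).2 (summable_picardTerm h0 hν hN hr y z t x)).hasSum.tendsto_sum_nat
  refine AEStronglyMeasurable.congr (f := fun ω => ∑ n ∈ Finset.range M,
    picardTerm P N ν r y z (n + 1) t x ω) (AdaptedAt.sum fun n _ =>
    (isWaveField_picardTerm h0 hν hN r y z (n + 1)).adapted t x) ?_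
  filter_upwards [Lp.coeFn_finsetSum (Finset.range M)
    (fun n => picardTerm P N ν r y z (n + 1) t x)] with ω hω
  rw [hω, Finset.sum_apply]

theorem IsWaveField.add {u u' : ℝ → ℝ → HSp P} (h : IsWaveField P N ν r y u)
    (h' : IsWaveField P N ν r y u') : IsWaveField P N ν r y (fun t x => u t x + u' t x) where
  adapted t x := ((h.adapted t x).add (h'.adapted t x)).congr (Lp.coeFn_add _ _).symm
  continuousAt q hq := (h.continuousAt q hq).add (h'.continuousAt q hq)
  bounded T := by
    obtain ⟨C, hC0, hC⟩ := h.bounded T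
    obtain ⟨C', hC0', hC'⟩ := h'.bounded T
    exact ⟨C + C', add_nonneg hC0 hC0', fun t x ht =>
      (norm_add_le _ _).trans (add_le_add (hC t x ht) (hC' t x ht))⟩

theorem isWaveField_solH (h0 : ν {0} = 0) (hν : levyMoment ν 2 < ∞)
    (hN : IsPoissonRandomMeasure P N (intensity ν)) (hr : 0 ≤ r) (y z : ℝ) :
    IsWaveField P N ν r y (solH P N ν r y z) := by
  have h1 : IsWaveField P N ν r y (fun t x => ∑' n, picardTerm P N ν r y z (n + 1) t x) :=
    ⟨adaptedAt_tail h0 hν hN hr y z, fun q _ => (continuous_tail h0 hν hN hr y z).continuousAt,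
      locBounded_of_itoRel hν hN (locBounded_solH h0 hν hN hr y z) (itoRel_solH h0 hν hN hr y z)⟩
  have h2 := (isWaveField_picardTerm h0 hν hN r y z 0).add h1
  convert h2 using 1
  funext t x
  exact solH_eq h0 hν hN hr y z t x

theorem solH_eq_zero (h0 : ν {0} = 0) (hν : levyMoment ν 2 < ∞)
    (hN : IsPoissonRandomMeasure P N (intensity ν)) {t x : ℝ} (h : t - r ≤ |x - y|) :
    solH P N ν r y z t x = 0 := by
  simp [solH, picardTerm_eq_zero h0 hν hN _ t x h]

end Picard

end LevyWave

namespace LevyWave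

/-! ### The p-th moment after adding one centred Poisson variable. -/

section PoissonMoments

theorem exp_sub_one_sub_le (u : ℝ) : Real.exp u - 1 - u ≤ 2 * u ^ 2 * Real.exp |u| := by
  have h1 : 1 ≤ Real.exp |u| := Real.one_le_exp (abs_nonneg u)
  rcases le_or_gt |u| 1 with h | h
  · have h2 := (abs_le.1 (Real.abs_exp_sub_one_sub_id_le h)).2
    nlinarith [sq_nonneg u]
  · have h2 : Real.exp u ≤ Real.exp |u| := Real.exp_le_exp.2 (le_abs_self u)
    have h3 := neg_abs_le u
    have h4 : |u| + 1 ≤ Real.exp |u| := Real.add_one_le_exp _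
    have h5 : 1 ≤ u ^ 2 := by rw [← sq_abs]; nlinarith
    nlinarith

/-- Second order expansion of `|a + d| ^ p`. -/
theorem exists_abs_add_rpow_le {p : ℝ} (hp : 2 ≤ p) : ∃ C : ℝ, 1 ≤ C ∧ ∀ a d : ℝ,
    |a + d| ^ p ≤ |a| ^ p + p * (|a| ^ (p - 2) * a) * d +
      C * (|a| ^ (p - 2) * d ^ 2 + |d| ^ p) := by
  have h2p : (1 : ℝ) ≤ 2 ^ p := Real.one_le_rpow (by norm_num) (by linarith)
  refine ⟨2 ^ p + p + 2 * p ^ 2 * Real.exp p, ?_, fun a d => ?_⟩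
  · have := Real.exp_pos p
    have : 0 ≤ 2 * p ^ 2 * Real.exp p := by positivity
    linarith
  set C := 2 ^ p + p + 2 * p ^ 2 * Real.exp p with hC
  have hE : 0 ≤ 2 * p ^ 2 * Real.exp p := by positivity
  -- By homogeneity, a = 1 suffices, with x = d/a. For |x| ≤ 1 the comparison (1 + x)^p ≤ e^{px} is
  -- expanded to second order; for |x| > 1 every term is absorbed into |x|^p.
  have key : ∀ x : ℝ, |1 + x| ^ p ≤ 1 + p * x + C * (x ^ 2 + |x| ^ p) := by
    intro x
    have hxp : 0 ≤ |x| ^ p := by positivity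
    rcases le_or_gt |x| 1 with h | h
    · have h0 : 0 ≤ 1 + x := by linarith [(abs_le.1 h).1]
      rw [abs_of_nonneg h0]
      have e1 : (1 + x) ^ p ≤ Real.exp (p * x) := by
        rw [mul_comm, Real.exp_mul]
        exact Real.rpow_le_rpow h0 (by linarith [Real.add_one_le_exp x]) (by linarith)
      have e2 := exp_sub_one_sub_le (p * x)
      have e3 : Real.exp |p * x| ≤ Real.exp p := by
        refine Real.exp_le_exp.2 ?_
        rw [abs_mul, abs_of_nonneg (by linarith : 0 ≤ p)]
        nlinarith
      have e4 : 2 * (p * x) ^ 2 * Real.exp |p * x| ≤ 2 * p ^ 2 * Real.exp p * x ^ 2 := by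
        calc _ ≤ 2 * (p * x) ^ 2 * Real.exp p := by gcongr
          _ = _ := by ring
      have e5 : 2 * p ^ 2 * Real.exp p * x ^ 2 ≤ C * (x ^ 2 + |x| ^ p) := by
        have : 0 ≤ x ^ 2 := sq_nonneg x
        have a1 : 2 * p ^ 2 * Real.exp p * x ^ 2 ≤ C * x ^ 2 := by
          gcongr; rw [hC]; linarith
        have a2 : 0 ≤ C * |x| ^ p := by rw [hC]; positivity
        linarith [mul_add C (x ^ 2) (|x| ^ p)]
      linarith
    · have e1 : |1 + x| ^ p ≤ 2 ^ p * |x| ^ p := by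
        rw [← Real.mul_rpow (by norm_num) (abs_nonneg x)]
        refine Real.rpow_le_rpow (abs_nonneg _) ?_ (by linarith)
        have := abs_add_le 1 x
        rw [abs_one] at this
        linarith
      have e2 : |x| ≤ |x| ^ p := by
        conv_lhs => rw [← Real.rpow_one |x|]
        exact Real.rpow_le_rpow_of_exponent_le h.le (by linarith)
      have e3 := neg_abs_le x
      have e4 : 0 ≤ C * x ^ 2 := by rw [hC]; positivity
      have e5 : 0 ≤ 2 * p ^ 2 * Real.exp p * |x| ^ p := by positivity
      have e6 : p * (-x) ≤ p * |x| ^ p := by gcongr; linarith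
      have e7 : C * |x| ^ p = 2 ^ p * |x| ^ p + p * |x| ^ p +
        2 * p ^ 2 * Real.exp p * |x| ^ p := by rw [hC]; ring
      linarith [mul_add C (x ^ 2) (|x| ^ p)]
  rcases eq_or_ne a 0 with rfl | ha
  · have h1 : (0 : ℝ) ^ p = 0 := Real.zero_rpow (by linarith)
    have h2 : 0 ≤ |d| ^ p := by positivity
    have h3 : 0 ≤ |(0 : ℝ)| ^ (p - 2) * d ^ 2 := by positivity
    simp only [zero_add, abs_zero, h1, mul_zero, zero_mul] at h3 ⊢
    have hC1 : 1 ≤ C := by rw [hC]; linarith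
    nlinarith
  · have h := key (d / a)
    have hap : 0 < |a| := abs_pos.2 ha
    have e0 : |a| ^ p = |a| ^ (p - 2) * a ^ 2 := by
      rw [← sq_abs a, ← Real.rpow_natCast |a| 2, ← Real.rpow_add hap]
      norm_num
    have e1 : |a + d| ^ p = |a| ^ p * |1 + d / a| ^ p := by
      rw [← Real.mul_rpow (abs_nonneg _) (abs_nonneg _), ← abs_mul]
      congr 2
      field_simp
    have e2 : |d| ^ p = |a| ^ p * |d / a| ^ p := by
      rw [← Real.mul_rpow (abs_nonneg _) (abs_nonneg _), ← abs_mul]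
      congr 2
      field_simp
    rw [e1]
    calc _ ≤ |a| ^ p * (1 + p * (d / a) + C * ((d / a) ^ 2 + |d / a| ^ p)) := by gcongr
      _ = |a| ^ p + p * (|a| ^ p * (d / a)) +
          C * (|a| ^ p * (d / a) ^ 2 + |a| ^ p * |d / a| ^ p) := by ring
      _ = _ := by
        rw [← e2, e0]
        have f1 : |a| ^ (p - 2) * a ^ 2 * (d / a) = |a| ^ (p - 2) * a * d := by field_simp
        have f2 : |a| ^ (p - 2) * a ^ 2 * (d / a) ^ 2 = |a| ^ (p - 2) * d ^ 2 := by field_simp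
        rw [f1, f2]; ring

theorem hasSum_poisson_exp (r : ℝ≥0) (s : ℝ) :
    HasSum (fun k : ℕ => Real.exp (-r) * r ^ k / k.factorial * Real.exp (s * (k - r)))
      (Real.exp (r * (Real.exp s - 1 - s))) := by
  have h := (NormedSpace.expSeries_div_hasSum_exp ((r : ℝ) * Real.exp s)).mul_left
    (Real.exp (-r) * Real.exp (-(s * r)))
  rw [← Real.exp_eq_exp_ℝ, ← Real.exp_add, ← Real.exp_add] at h
  convert! h using 1
  · funext k
    rw [mul_pow, ← Real.exp_nat_mul, mul_sub, sub_eq_add_neg, Real.exp_add, Real.exp_add,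
      mul_comm (k : ℝ) s]
    ring
  · congr 1; ring

theorem integrable_exp_poisson (r : ℝ≥0) (s : ℝ) :
    Integrable (fun k : ℕ => Real.exp (s * (k - r))) (poissonMeasure r) := by
  rw [integrable_poissonMeasure_iff]
  simpa using (hasSum_poisson_exp r s).summable

theorem integral_exp_poisson (r : ℝ≥0) (s : ℝ) :
    ∫ k : ℕ, Real.exp (s * (k - r)) ∂poissonMeasure r = Real.exp (r * (Real.exp s - 1 - s)) := by
  rw [integral_poissonMeasure]
  simpa using (hasSum_poisson_exp r s).tsum_eq

/-- The right-hand side is a multiple of cosh u - 1, which vanishes to second order at 0, as p ≥ 2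
permits. Without the -2, the Poisson moment would not be bounded linearly in a small intensity. The
constant comes from the terms of order 2 and n of the exponential series. -/
theorem abs_rpow_le_exp_add_exp {p : ℝ} (hp : 2 ≤ p) {n : ℕ} (hn : p ≤ n) (u : ℝ) :
    |u| ^ p ≤ (2 + n.factorial) * (Real.exp u + Real.exp (-u) - 2) := by
  have h0 := abs_nonneg u
  have e : Real.exp u + Real.exp (-u) = Real.exp |u| + Real.exp (-|u|) := by
    rcases abs_cases u with ⟨h, -⟩ | ⟨h, -⟩ <;> rw [h]
    rw [neg_neg, add_comm]
  have h1 : 1 + -|u| ≤ Real.exp (-|u|) := by linarith [Real.add_one_le_exp (-|u|)]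
  have hn2 : 2 ≤ n := by exact_mod_cast hp.trans hn
  have hq : ∀ m : ℕ, 2 ≤ m → |u| ^ m / m.factorial ≤ Real.exp |u| - 1 - |u| := by
    intro m hm
    have := Real.sum_le_exp_of_nonneg h0 (m + 1)
    have h2 : ∑ i ∈ ({0, 1, m} : Finset ℕ), |u| ^ i / i.factorial ≤
        ∑ i ∈ Finset.range (m + 1), |u| ^ i / i.factorial := by
      refine Finset.sum_le_sum_of_subset_of_nonneg ?_ fun i _ _ => by positivity
      intro i hi
      simp only [Finset.mem_insert, Finset.mem_singleton] at hi
      rw [Finset.mem_range]; omega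
    rw [Finset.sum_insert (by simp; omega), Finset.sum_insert (by simp; omega),
      Finset.sum_singleton] at h2
    simp at h2
    linarith
  have h2 : |u| ^ p ≤ u ^ 2 + |u| ^ n := by
    rcases le_or_gt |u| 1 with h | h
    · have : |u| ^ p ≤ |u| ^ (2 : ℝ) := by
        rcases h0.eq_or_lt with h' | h'
        · rw [← h', Real.zero_rpow (by linarith), Real.zero_rpow (by norm_num)]
        · exact Real.rpow_le_rpow_of_exponent_ge h' h hp
      rw [Real.rpow_two, sq_abs] at this
      have : 0 ≤ |u| ^ n := by positivity
      linarith
    · have : |u| ^ p ≤ |u| ^ (n : ℝ) := Real.rpow_le_rpow_of_exponent_le h.le hn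
      rw [Real.rpow_natCast] at this
      nlinarith [sq_nonneg u]
  have h3 := hq 2 le_rfl
  have h4 := hq n hn2
  rw [div_le_iff₀ (by positivity)] at h3 h4
  rw [sq_abs] at h3
  norm_num at h3
  have hf : (0 : ℝ) < n.factorial := by positivity
  rw [e]
  nlinarith

theorem integrable_abs_rpow_poisson (r : ℝ≥0) {p : ℝ} (hp : 2 ≤ p) :
    Integrable (fun k : ℕ => |(k : ℝ) - r| ^ p) (poissonMeasure r) := by
  have hi := (((integrable_exp_poisson r 1).add (integrable_exp_poisson r (-1))).sub
    (integrable_const 2)).const_mul (2 + (⌈p⌉₊.factorial : ℝ))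
  refine hi.mono' (by exact Measurable.of_discrete.aestronglyMeasurable) (ae_of_all _ fun k => ?_)
  rw [Real.norm_of_nonneg (by positivity)]
  have := abs_rpow_le_exp_add_exp hp (Nat.le_ceil p) ((k : ℝ) - r)
  simpa using this

/-- Exponential moments at scale s, with s = 1 if r ≤ 1 and s = r^{-1/2} otherwise. Then r s² ≤ 1,
so the expectation of cosh(s(k - r)) - 1 is O(r s²); dividing by s^p gives O(r) in the first case
and O(r^{p/2}) in the second. -/
theorem exists_integral_abs_rpow_poisson_le {p : ℝ} (hp : 2 ≤ p) : ∃ C : ℝ, 0 < C ∧ ∀ r : ℝ≥0,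
    ∫ k : ℕ, |(k : ℝ) - r| ^ p ∂poissonMeasure r ≤ C * (r + (r : ℝ) ^ (p / 2)) := by
  refine ⟨4 * (2 + (⌈p⌉₊.factorial : ℝ)), by positivity, fun r => ?_⟩
  set K := 2 + (⌈p⌉₊.factorial : ℝ) with hK
  have hr : (0 : ℝ) ≤ r := r.2
  -- the scale
  obtain ⟨s, hs0, hs1, hsr, hs2⟩ : ∃ s : ℝ, 0 < s ∧ s ≤ 1 ∧ r * s ^ 2 ≤ 1 ∧
      r * s ^ 2 ≤ s ^ p * (r + (r : ℝ) ^ (p / 2)) := by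
    rcases le_or_gt (r : ℝ) 1 with h | h
    · refine ⟨1, one_pos, le_rfl, by linarith, ?_⟩
      have : 0 ≤ (r : ℝ) ^ (p / 2) := by positivity
      rw [Real.one_rpow]; linarith
    · have h0 : (0 : ℝ) < r := by linarith
      have hq : (0 : ℝ) < Real.sqrt r := Real.sqrt_pos.2 h0
      have e1 : r * (1 / Real.sqrt r) ^ 2 = 1 := by
        rw [div_pow, Real.sq_sqrt hr]; field_simp
      refine ⟨1 / Real.sqrt r, by positivity, ?_, e1.le, ?_⟩
      · rw [div_le_one hq, Real.one_le_sqrt]; exact h.le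
      · rw [e1, Real.div_rpow zero_le_one hq.le, Real.one_rpow, Real.sqrt_eq_rpow,
          ← Real.rpow_mul hr, show 1 / 2 * p = p / 2 by ring, mul_add]
        have : 0 < (r : ℝ) ^ (p / 2) := by positivity
        have e2 : 1 / (r : ℝ) ^ (p / 2) * (r : ℝ) ^ (p / 2) = 1 := by field_simp
        rw [e2]
        have : 0 ≤ 1 / (r : ℝ) ^ (p / 2) * r := by positivity
        linarith
  have hi := (((integrable_exp_poisson r s).add (integrable_exp_poisson r (-s))).sub
    (integrable_const 2)).const_mul K
  have h1 : s ^ p * ∫ k : ℕ, |(k : ℝ) - r| ^ p ∂poissonMeasure r ≤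
      K * (Real.exp (r * (Real.exp s - 1 - s)) + Real.exp (r * (Real.exp (-s) - 1 - -s)) - 2) := by
    rw [← integral_exp_poisson, ← integral_exp_poisson, ← integral_const_mul]
    have h2 : K * (∫ k : ℕ, Real.exp (s * (k - r)) ∂poissonMeasure r +
        ∫ k : ℕ, Real.exp (-s * (k - r)) ∂poissonMeasure r - 2) =
        ∫ k : ℕ, K * (Real.exp (s * (k - r)) + Real.exp (-s * (k - r)) - 2) ∂poissonMeasure r := by
      rw [integral_const_mul, integral_sub (f := fun k : ℕ => Real.exp (s * (k - r)) +
        Real.exp (-s * (k - r))) ((integrable_exp_poisson r s).add (integrable_exp_poisson r (-s)))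
        (integrable_const 2), integral_add (integrable_exp_poisson r s)
        (integrable_exp_poisson r (-s))]
      simp
    rw [h2]
    refine integral_mono ((integrable_abs_rpow_poisson r hp).const_mul _) hi fun k => ?_
    have := abs_rpow_le_exp_add_exp hp (Nat.le_ceil p) (s * ((k : ℝ) - r))
    rw [abs_mul, abs_of_pos hs0, Real.mul_rpow hs0.le (abs_nonneg _), ← neg_mul] at this
    simpa using this
  have h3 : ∀ a : ℝ, |a| = s → Real.exp (r * (Real.exp a - 1 - a)) ≤ 1 + 2 * (r * s ^ 2) := by
    intro a ha
    have b1 := (abs_le.1 (Real.abs_exp_sub_one_sub_id_le (x := a) (by rw [ha]; exact hs1))).2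
    rw [← sq_abs, ha] at b1
    have b2 : r * (Real.exp a - 1 - a) ≤ r * s ^ 2 := by gcongr
    refine (Real.exp_le_exp.2 b2).trans ?_
    have b0 : 0 ≤ r * s ^ 2 := by positivity
    have b3 := (abs_le.1 (Real.abs_exp_sub_one_sub_id_le (x := r * s ^ 2)
      (by rw [abs_of_nonneg b0]; exact hsr))).2
    nlinarith
  have h4 := h3 s (abs_of_pos hs0)
  have h5 := h3 (-s) (by rw [abs_neg, abs_of_pos hs0])
  have hsp : 0 < s ^ p := by positivity
  have hK0 : 0 < K := by positivity
  refine le_of_mul_le_mul_left ?_ hsp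
  calc _ ≤ _ := h1
    _ ≤ K * (4 * (r * s ^ 2)) := by gcongr; linarith
    _ ≤ K * (4 * (s ^ p * (r + (r : ℝ) ^ (p / 2)))) := by gcongr
    _ = _ := by ring

theorem integrable_id_poisson (r : ℝ≥0) : Integrable (fun k : ℕ => (k : ℝ)) (poissonMeasure r) := by
  simpa using integrable_pow_poissonMeasure r 1

/-- One step of the moment estimate, for fixed values of the past. -/
theorem exists_lintegral_add_poisson_le {p : ℝ} (hp : 2 ≤ p) : ∃ C : ℝ, 0 < C ∧
    ∀ (r : ℝ≥0) (w : ℝ), (0 < w ∨ w = 0 ∧ r = 0) → ∀ a b : ℝ,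
    ∫⁻ k : ℕ, ENNReal.ofReal (|a + b * (k - r)| ^ p) ∂poissonMeasure r ≤
      ENNReal.ofReal ((1 + C * w) * |a| ^ p +
        C * ((r : ℝ) ^ (p / 2) * w ^ (1 - p / 2) + r + (r : ℝ) ^ (p / 2)) * |b| ^ p) := by
  obtain ⟨C₁, hC₁, hT⟩ := exists_abs_add_rpow_le hp
  obtain ⟨C₂, hC₂, hM⟩ := exists_integral_abs_rpow_poisson_le hp
  have hp0 : 0 < p := by linarith
  refine ⟨C₁ * (1 + C₂), by positivity, fun r w hw a b => ?_⟩
  have hr : (0 : ℝ) ≤ r := r.2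
  have hw0 : 0 ≤ w := by rcases hw with h | h <;> linarith
  have i1 : Integrable (fun k : ℕ => (k : ℝ) - r) (poissonMeasure r) :=
    (integrable_id_poisson r).sub (integrable_const _)
  have i2 : Integrable (fun k : ℕ => ((k : ℝ) - r) ^ 2) (poissonMeasure r) := by
    have := ((integrable_pow_poissonMeasure r 2).sub ((integrable_id_poisson r).const_mul
      (2 * (r : ℝ)))).add (integrable_const ((r : ℝ) ^ 2))
    refine this.congr (ae_of_all _ fun k => ?_)
    simp only [Pi.add_apply, Pi.sub_apply]; ring
  have i3 := integrable_abs_rpow_poisson r hp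
  have e1 : ∫ k : ℕ, ((k : ℝ) - r) ∂poissonMeasure r = 0 := by
    rw [integral_sub (integrable_id_poisson r) (integrable_const _), integral_id_poissonMeasure]
    simp
  have e2 : ∫ k : ℕ, ((k : ℝ) - r) ^ 2 ∂poissonMeasure r = r := by
    have : ∀ k : ℕ, ((k : ℝ) - r) ^ 2 = ((k : ℝ) ^ 2 - (2 * r) * k) + (r : ℝ) ^ 2 := by
      intro k; ring
    simp only [this]
    rw [integral_add (f := fun k : ℕ => (k : ℝ) ^ 2 - (2 * r) * k)
      ((integrable_pow_poissonMeasure r 2).sub ((integrable_id_poisson r).const_mul _))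
      (integrable_const _), integral_sub (integrable_pow_poissonMeasure r 2)
      ((integrable_id_poisson r).const_mul _), integral_const_mul, integral_sq_poissonMeasure,
      integral_id_poissonMeasure]
    simp; ring
  -- The second order expansion with d = b(k - r). Its linear term has mean zero, which leaves
  -- |a|^p, a quadratic term and the centred p-th moment.
  set f : ℕ → ℝ := fun k => (|a| ^ p + (p * (|a| ^ (p - 2) * a) * b) * (k - r)) +
    ((C₁ * (|a| ^ (p - 2) * b ^ 2)) * ((k : ℝ) - r) ^ 2 +
      (C₁ * |b| ^ p) * |(k : ℝ) - r| ^ p) with hf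
  have hle : ∀ k : ℕ, |a + b * (k - r)| ^ p ≤ f k := by
    intro k
    refine (hT a (b * (k - r))).trans (le_of_eq ?_)
    rw [abs_mul b, Real.mul_rpow (abs_nonneg _) (abs_nonneg _), hf]
    ring
  have j1 : Integrable (fun k : ℕ => |a| ^ p + (p * (|a| ^ (p - 2) * a) * b) * ((k : ℝ) - r))
      (poissonMeasure r) := (integrable_const _).add (i1.const_mul _)
  have j2 : Integrable (fun k : ℕ => (C₁ * (|a| ^ (p - 2) * b ^ 2)) * ((k : ℝ) - r) ^ 2 +
      (C₁ * |b| ^ p) * |(k : ℝ) - r| ^ p) (poissonMeasure r) :=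
    (i2.const_mul _).add (i3.const_mul _)
  have hfi : Integrable f (poissonMeasure r) := j1.add j2
  have h_int : ∫ k, f k ∂poissonMeasure r = |a| ^ p + (C₁ * (|a| ^ (p - 2) * b ^ 2) * r +
      C₁ * |b| ^ p * ∫ k : ℕ, |(k : ℝ) - r| ^ p ∂poissonMeasure r) := by
    rw [hf, integral_add j1 j2, integral_add (integrable_const _) (i1.const_mul _),
      integral_add (i2.const_mul _) (i3.const_mul _), integral_const_mul, integral_const_mul,
      integral_const_mul, e1, e2]
    simp
  calc _ ≤ ∫⁻ k, ENNReal.ofReal (f k) ∂poissonMeasure r :=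
        lintegral_mono fun k => ENNReal.ofReal_le_ofReal (hle k)
    _ = ENNReal.ofReal (∫ k, f k ∂poissonMeasure r) :=
        (ofReal_integral_eq_lintegral_ofReal hfi (ae_of_all _ fun k =>
          (by positivity : (0 : ℝ) ≤ |a + b * (k - r)| ^ p).trans (hle k))).symm
    _ ≤ _ := by
        refine ENNReal.ofReal_le_ofReal ?_
        rw [h_int]
        -- Young's inequality with the weight w, by comparing b² r with w a²: whichever is larger
        -- dominates. The case w = 0, r = 0 serves cells of measure zero.
        have hY : |a| ^ (p - 2) * b ^ 2 * r ≤
            w * |a| ^ p + (r : ℝ) ^ (p / 2) * w ^ (1 - p / 2) * |b| ^ p := by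
          rcases hw with hw | ⟨-, rfl⟩
          · rcases le_or_gt (b ^ 2 * r) (w * a ^ 2) with h | h
            · have e0 : |a| ^ p = |a| ^ (p - 2) * a ^ 2 := by
                rcases (abs_nonneg a).eq_or_lt with h0 | h0
                · rw [← sq_abs, ← h0, Real.zero_rpow hp0.ne']
                  norm_num
                · rw [← sq_abs a, ← Real.rpow_natCast |a| 2, ← Real.rpow_add h0]
                  norm_num
              have h1 : |a| ^ (p - 2) * (b ^ 2 * r) ≤ |a| ^ (p - 2) * (w * a ^ 2) := by gcongr
              have h2 : 0 ≤ (r : ℝ) ^ (p / 2) * w ^ (1 - p / 2) * |b| ^ p := by positivity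
              rw [e0]
              linarith
            · have hq : 0 < b ^ 2 * r := lt_of_le_of_lt (by positivity) h
              have h1 : |a| ^ (p - 2) ≤ (b ^ 2 * r / w) ^ (p / 2 - 1) := by
                have h3 : a ^ 2 ≤ b ^ 2 * r / w := by
                  rw [le_div_iff₀ hw]; linarith
                have h4 : |a| ^ (p - 2) = (a ^ 2) ^ (p / 2 - 1) := by
                  rw [← sq_abs, ← Real.rpow_natCast |a| 2, ← Real.rpow_mul (abs_nonneg a)]
                  congr 1; push_cast; ring
                rw [h4]
                exact Real.rpow_le_rpow (sq_nonneg a) h3 (by linarith)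
              have h2 : (b ^ 2 * r / w) ^ (p / 2 - 1) * (b ^ 2 * r) =
                  (r : ℝ) ^ (p / 2) * w ^ (1 - p / 2) * |b| ^ p := by
                have h5 : |b| ^ p = (b ^ 2) ^ (p / 2) := by
                  rw [← sq_abs, ← Real.rpow_natCast |b| 2, ← Real.rpow_mul (abs_nonneg b)]
                  congr 1; push_cast; ring
                have h7 : (b ^ 2) ^ (p / 2) * (r : ℝ) ^ (p / 2) =
                    (b ^ 2 * r) ^ (p / 2 - 1) * (b ^ 2 * r) := by
                  rw [← Real.mul_rpow (sq_nonneg b) hr, ← Real.rpow_add_one hq.ne']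
                  congr 1; ring
                rw [Real.div_rpow hq.le hw.le, h5, show 1 - p / 2 = -(p / 2 - 1) by ring,
                  Real.rpow_neg hw.le, div_mul_eq_mul_div, ← h7, div_eq_mul_inv]
                ring
              have h6 : 0 ≤ w * |a| ^ p := by positivity
              calc _ = |a| ^ (p - 2) * (b ^ 2 * r) := by ring
                _ ≤ (b ^ 2 * r / w) ^ (p / 2 - 1) * (b ^ 2 * r) := by gcongr
                _ ≤ _ := by rw [h2]; linarith
          · have : 0 ≤ |a| ^ p := by positivity
            have : ((0 : ℝ≥0) : ℝ) ^ (p / 2) = 0 := by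
              rw [NNReal.coe_zero, Real.zero_rpow (by positivity)]
            rw [this]
            simp
            positivity
        have hM' := hM r
        have hbp : 0 ≤ |b| ^ p := by positivity
        have hap : 0 ≤ |a| ^ p := by positivity
        have s1 : C₁ * |b| ^ p * ∫ k : ℕ, |(k : ℝ) - r| ^ p ∂poissonMeasure r ≤
          C₁ * |b| ^ p * (C₂ * (r + (r : ℝ) ^ (p / 2))) := by gcongr
        have s2 : C₁ * (|a| ^ (p - 2) * b ^ 2 * r) ≤ C₁ * (w * |a| ^ p +
          (r : ℝ) ^ (p / 2) * w ^ (1 - p / 2) * |b| ^ p) := by gcongr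
        have q1 : 0 ≤ C₁ * C₂ * (w * |a| ^ p + (r : ℝ) ^ (p / 2) * w ^ (1 - p / 2) * |b| ^ p) := by
          positivity
        have q2 : 0 ≤ C₁ * (r + (r : ℝ) ^ (p / 2)) * |b| ^ p := by positivity
        nlinarith
end PoissonMoments

end LevyWave

namespace LevyWave

/-! ### Moments of sums over grid cells. -/

section Moments

variable {Ω : Type*} [mΩ : MeasurableSpace Ω] {P : Measure Ω} {N : Ω → Measure Pt} {ν : Measure ℝ}
  [IsProbabilityMeasure P] [SigmaFinite ν]

/-- The constant of the one-step moment estimate. -/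
noncomputable def stepConst (p : ℝ) : ℝ :=
  -- The default 1 for p < 2 keeps the constant positive for every p; the estimates all assume 2 ≤
  -- p.
  if h : 2 ≤ p then (exists_lintegral_add_poisson_le h).choose else 1

theorem stepConst_pos (p : ℝ) : 0 < stepConst p := by
  unfold stepConst
  split_ifs with h
  · exact (exists_lintegral_add_poisson_le h).choose_spec.1
  · exact one_pos

/-- The factor of the new term in the one-step moment estimate. -/
noncomputable def stepWeight (p l w : ℝ) : ℝ :=
  stepConst p * (l ^ (p / 2) * w ^ (1 - p / 2) + l + l ^ (p / 2))

theorem lintegral_add_poisson_le {p : ℝ} (hp : 2 ≤ p) (r : ℝ≥0) {w : ℝ}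
    (hw : 0 < w ∨ w = 0 ∧ r = 0) (a b : ℝ) :
    ∫⁻ k : ℕ, ENNReal.ofReal (|a + b * (k - r)| ^ p) ∂poissonMeasure r ≤
      ENNReal.ofReal ((1 + stepConst p * w) * |a| ^ p + stepWeight p r w * |b| ^ p) := by
  have := (exists_lintegral_add_poisson_le hp).choose_spec.2 r w hw a b
  rw [stepWeight, stepConst, dif_pos hp]
  exact this

/-- By independence the joint law of (Z, Y) and N(F) is a product, so the deterministic estimate
applies to the inner integral for each value of (Z, Y). -/
theorem lintegral_add_mul_compensated_le (hN : IsPoissonRandomMeasure P N (intensity ν))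
    {p : ℝ} (hp : 2 ≤ p) {F : Set Pt} (hF : MeasurableSet F) (hFi : intensity ν F < ∞) {w : ℝ}
    (hw : 0 < w ∨ w = 0 ∧ intensity ν F = 0) {Z Y : Ω → ℝ} (hZ : AEMeasurable Z P)
    (hY : AEMeasurable Y P) (hI : IndepFun (fun ω => (Z ω, Y ω)) (fun ω => (N ω F).toReal) P) :
    ∫⁻ ω, ENNReal.ofReal (|Z ω + Y ω * compensated N ν F ω| ^ p) ∂P ≤
      ENNReal.ofReal (1 + stepConst p * w) * ∫⁻ ω, ENNReal.ofReal (|Z ω| ^ p) ∂P +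
      ENNReal.ofReal (stepWeight p (intensity ν F).toReal w) *
        ∫⁻ ω, ENNReal.ofReal (|Y ω| ^ p) ∂P := by
  set l := (intensity ν F).toNNReal with hl
  have hlr : (intensity ν F).toReal = l := rfl
  have hn := (hN.measurable_toReal hF).aemeasurable (μ := P)
  have hC := stepConst_pos p
  have hw0 : 0 ≤ w := by rcases hw with h | h <;> linarith
  have hmap := (indepFun_iff_map_prod_eq_prod_map_map (hZ.prodMk hY) hn).1 hI
  have hf : Measurable fun q : (ℝ × ℝ) × ℝ => ENNReal.ofReal (|q.1.1 + q.1.2 * (q.2 - l)| ^ p) := by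
    fun_prop
  calc _ = ∫⁻ q, ENNReal.ofReal (|q.1.1 + q.1.2 * (q.2 - l)| ^ p)
          ∂(P.map fun ω => ((Z ω, Y ω), (N ω F).toReal)) := by
        rw [lintegral_map' hf.aemeasurable ((hZ.prodMk hY).prodMk hn)]
        rfl
    _ = ∫⁻ q, ∫⁻ k : ℕ, ENNReal.ofReal (|q.1 + q.2 * (k - l)| ^ p) ∂poissonMeasure l
          ∂(P.map fun ω => (Z ω, Y ω)) := by
        have := Measure.isProbabilityMeasure_map hn (μ := P)
        rw [hmap, lintegral_prod _ hf.aemeasurable]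
        refine lintegral_congr fun q => ?_
        rw [hN.map_toReal hF hFi, lintegral_map (by fun_prop) Measurable.of_discrete]
    _ ≤ ∫⁻ q, ENNReal.ofReal ((1 + stepConst p * w) * |q.1| ^ p + stepWeight p l w * |q.2| ^ p)
          ∂(P.map fun ω => (Z ω, Y ω)) := by
        refine lintegral_mono fun q => lintegral_add_poisson_le hp l ?_ q.1 q.2
        rcases hw with h | ⟨h, h'⟩
        · exact Or.inl h
        · exact Or.inr ⟨h, by rw [hl, h']; rfl⟩
    _ = ∫⁻ ω, ENNReal.ofReal ((1 + stepConst p * w) * |Z ω| ^ p + stepWeight p l w * |Y ω| ^ p)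
          ∂P := lintegral_map' (by fun_prop) (hZ.prodMk hY)
    _ = _ := by
        rw [hlr, ← lintegral_const_mul' _ _ ENNReal.ofReal_ne_top,
          ← lintegral_const_mul' _ _ ENNReal.ofReal_ne_top, ← lintegral_add_left']
        · refine lintegral_congr fun ω => ?_
          have h1 : 0 ≤ stepWeight p l w := by
            unfold stepWeight; positivity
          rw [ENNReal.ofReal_add (by positivity) (by positivity), ENNReal.ofReal_mul (by positivity),
            ENNReal.ofReal_mul h1]
        · exact ((hZ.abs.pow_const p).ennreal_ofReal).const_mul _

/-- The events determined by the noise outside of `F`, up to null sets. -/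
abbrev outsideSigma (P : Measure Ω) (N : Ω → Measure Pt) (F : Set Pt) : MeasurableSpace Ω :=
  eventuallyMeasurableSpace (MeasurableSpace.generateFrom (cylinderSets N Fᶜ)) (ae P)

theorem outsideSigma_indep (hN : IsPoissonRandomMeasure P N (intensity ν)) {F : Set Pt}
    (hF : MeasurableSet F) : Indep (outsideSigma P N F)
      (MeasurableSpace.generateFrom (cylinderSets N F)) P := by
  have hI := hN.indep_generateFrom_cylinderSets hF.compl hF disjoint_compl_left
  rw [Indep_iff] at hI ⊢
  rintro S S' ⟨R, hR, hRS⟩ hS'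
  rw [measure_congr hRS, ← hI R S' hR hS']
  exact measure_congr (hRS.inter (EventuallyEq.refl _ _))

theorem cylinderSets_mono {N : Ω → Measure Pt} {U V : Set Pt} (h : U ⊆ V) :
    cylinderSets N U ⊆ cylinderSets N V := by
  rintro _ ⟨n, F, T, hF, hT, rfl⟩
  exact ⟨n, F, T, fun i => ⟨(hF i).1, (hF i).2.trans h⟩, hT, rfl⟩

theorem AdaptedAt.outside {a : ℝ} {Y : Ω → ℝ} (hY : AdaptedAt P N ν a Y) {F : Set Pt}
    (hF : F ⊆ Set.Ioi a ×ˢ Set.univ) : AEStronglyMeasurable[outsideSigma P N F] Y P := by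
  refine AEStronglyMeasurable.mono ?_ hY
  refine (noiseSigma_le_eventuallyMeasurableSpace a).trans ?_
  rintro S ⟨R, hR, hRS⟩
  refine ⟨R, MeasurableSpace.generateFrom_mono (cylinderSets_mono ?_) R hR, hRS⟩
  intro ξ hξ hξF
  exact absurd (Set.mem_Iic.1 (Set.mem_prod.1 hξ).1) (not_le.2 (Set.mem_Ioi.1 (hF hξF).1))

theorem outside_compensated {F F' : Set Pt} (hF' : MeasurableSet F') (hd : F' ⊆ Fᶜ) :
    AEStronglyMeasurable[outsideSigma P N F] (compensated N ν F') P := by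
  have h1 := measurable_compensated_cylinderSets N ν hF' hd
  have h2 : Measurable[outsideSigma P N F] (compensated N ν F') := fun T hT =>
    ⟨_, h1 hT, EventuallyEq.refl _ _⟩
  exact h2.stronglyMeasurable.aestronglyMeasurable

theorem aestronglyMeasurable_sum' {m : MeasurableSpace Ω} {ι : Type*} {s : Finset ι}
    {Y : ι → Ω → ℝ} (h : ∀ i ∈ s, AEStronglyMeasurable[m] (Y i) P) :
    AEStronglyMeasurable[m] (fun ω => ∑ i ∈ s, Y i ω) P := by
  classical
  induction s using Finset.induction_on with
  | empty => simpa using aestronglyMeasurable_const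
  | insert i s hi ih =>
    simp only [Finset.sum_insert hi]
    exact (h i (Finset.mem_insert_self i s)).add
      (ih fun j hj => h j (Finset.mem_insert_of_mem hj))

theorem indepFun_of_outside (hN : IsPoissonRandomMeasure P N (intensity ν)) {F : Set Pt}
    (hF : MeasurableSet F) {Z Y : Ω → ℝ} (hZ : AEStronglyMeasurable[outsideSigma P N F] Z P)
    (hY : AEStronglyMeasurable[outsideSigma P N F] Y P) :
    IndepFun (fun ω => (Z ω, Y ω)) (fun ω => (N ω F).toReal) P := by
  obtain ⟨Z', hZ', hZe⟩ := hZ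
  obtain ⟨Y', hY', hYe⟩ := hY
  have he : (fun ω => (Z' ω, Y' ω)) =ᵐ[P] fun ω => (Z ω, Y ω) := by
    filter_upwards [hZe, hYe] with ω h1 h2
    rw [h1, h2]
  refine IndepFun.congr ?_ he (EventuallyEq.refl _ _)
  rw [IndepFun_iff_Indep]
  refine indep_of_indep_of_le (outsideSigma_indep hN hF) ?_ ?_
  · exact (hZ'.measurable.prodMk hY'.measurable).comap_le
  · exact (measurable_apply_cylinderSets N hF subset_rfl).ennreal_toReal.comap_le

/-- Moments of integrals of grid processes. -/
theorem lintegral_grid_sum_le (hN : IsPoissonRandomMeasure P N (intensity ν))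
    (hν : levyMoment ν 2 < ∞) {p : ℝ} (hp : 2 ≤ p) {h : ℝ} (hh : 0 < h)
    {Y : ℤ × ℤ × ℤ → Ω → ℝ} (w : ℤ × ℤ × ℤ → ℝ) (S : Finset (ℤ × ℤ × ℤ)) :
    (∀ c ∈ S, 1 ≤ c.1 ∧ c.2.2 ≠ 0) → (∀ c ∈ S, AdaptedAt P N ν (c.1 * h) (Y c)) →
    (∀ c ∈ S, 0 < w c ∨ w c = 0 ∧ intensity ν (cell h c) = 0) →
    ∫⁻ ω, ENNReal.ofReal (|∑ c ∈ S, Y c ω * compensated N ν (cell h c) ω| ^ p) ∂P ≤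
      ENNReal.ofReal (Real.exp (stepConst p * ∑ c ∈ S, w c)) *
        ∑ c ∈ S, ENNReal.ofReal (stepWeight p (intensity ν (cell h c)).toReal (w c)) *
          ∫⁻ ω, ENNReal.ofReal (|Y c ω| ^ p) ∂P := by
  classical
  have hp0 : p ≠ 0 := by linarith
  have hC := stepConst_pos p
  -- The cell added last has maximal time index. All coefficients are then known at its left
  -- endpoint, but values on other cells of the same time slab are not. Those are handled by
  -- disjointness, which is why independence is phrased with `outsideSigma` instead of the
  -- filtration.
  induction S using Finset.induction_on_max_value (fun c : ℤ × ℤ × ℤ => c.1) with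
  | empty => simp [Real.zero_rpow hp0]
  | insert a S ha hmax ih =>
    intro hS hY hw
    have ih' := ih (fun c hc => hS c (Finset.mem_insert_of_mem hc))
      (fun c hc => hY c (Finset.mem_insert_of_mem hc))
      (fun c hc => hw c (Finset.mem_insert_of_mem hc))
    have hmem := Finset.mem_insert_self a S
    have hrect : ∀ c ∈ insert a S, FiniteRect ν (spaceCell h c.2.1) (jumpCell h c.2.2) :=
      fun c hc => finiteRect_cell hν hh (hS c hc).2 _
    have hmc : ∀ c ∈ insert a S, MeasurableSet (cell h c) :=
      fun c hc => (hrect c hc).measurableSet measurableSet_Ioc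
    have hsub : ∀ c : ℤ × ℤ × ℤ, cell h c ⊆ Set.Ioi (c.1 * h) ×ˢ Set.univ :=
      fun c => Set.prod_mono Set.Ioc_subset_Ioi_self (Set.subset_univ _)
    have hYo : ∀ c ∈ insert a S, AEStronglyMeasurable[outsideSigma P N (cell h a)] (Y c) P := by
      intro c hc
      refine (hY c hc).outside ((hsub a).trans (Set.prod_mono (Set.Ioi_subset_Ioi ?_) subset_rfl))
      have : (c.1 : ℝ) ≤ a.1 := by
        rcases Finset.mem_insert.1 hc with rfl | hc
        · exact le_rfl
        · exact_mod_cast hmax c hc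
      gcongr
    have hZo : AEStronglyMeasurable[outsideSigma P N (cell h a)]
        (fun ω => ∑ c ∈ S, Y c ω * compensated N ν (cell h c) ω) P := by
      refine aestronglyMeasurable_sum' fun c hc => ?_
      refine (hYo c (Finset.mem_insert_of_mem hc)).mul (outside_compensated
        (hmc c (Finset.mem_insert_of_mem hc)) ?_)
      rw [Set.subset_compl_iff_disjoint_right]
      exact disjoint_cell hh fun h' => ha (h' ▸ hc)
    have hYm : ∀ c ∈ insert a S, AEMeasurable (Y c) P := fun c hc =>
      (AEStronglyMeasurable.mono (noiseSigma_le hN _) (hY c hc)).aemeasurable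
    have hZm : AEMeasurable (fun ω => ∑ c ∈ S, Y c ω * compensated N ν (cell h c) ω) P :=
      Finset.aemeasurable_fun_sum _ fun c hc => (hYm c (Finset.mem_insert_of_mem hc)).mul
        (measurable_compensated hN (hmc c (Finset.mem_insert_of_mem hc))).aemeasurable
    have hstep := lintegral_add_mul_compensated_le hN hp (hmc a hmem)
      ((hrect a hmem).intensity_lt_top (by simp)) (hw a hmem) hZm (hYm a hmem)
      (indepFun_of_outside hN (hmc a hmem) hZo (hYo a hmem))
    have hw0 : ∀ c ∈ insert a S, 0 ≤ w c := by
      intro c hc; rcases hw c hc with h | h <;> linarith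
    have hsum0 : 0 ≤ ∑ c ∈ S, w c :=
      Finset.sum_nonneg fun c hc => hw0 c (Finset.mem_insert_of_mem hc)
    simp only [Finset.sum_insert ha]
    have e1 : ∀ ω, Y a ω * compensated N ν (cell h a) ω +
        ∑ c ∈ S, Y c ω * compensated N ν (cell h c) ω =
        ∑ c ∈ S, Y c ω * compensated N ν (cell h c) ω + Y a ω * compensated N ν (cell h a) ω :=
      fun ω => add_comm _ _
    simp only [e1]
    refine hstep.trans ?_
    rw [mul_add (stepConst p), Real.exp_add, ENNReal.ofReal_mul (Real.exp_pos _).le, mul_add,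
      add_comm]
    have b1 : ENNReal.ofReal (1 + stepConst p * w a) ≤
        ENNReal.ofReal (Real.exp (stepConst p * w a)) :=
      ENNReal.ofReal_le_ofReal (by linarith [Real.add_one_le_exp (stepConst p * w a)])
    -- The old terms pick up 1 + Cw ≤ e^{Cw}. The new term needs no factor, but receives one so that
    -- the bound has the same form at every step.
    have b2 : 1 ≤ ENNReal.ofReal (Real.exp (stepConst p * w a)) *
        ENNReal.ofReal (Real.exp (stepConst p * ∑ c ∈ S, w c)) := by
      have f1 : 0 ≤ stepConst p * w a := mul_nonneg hC.le (hw0 a hmem)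
      have f2 : 0 ≤ stepConst p * ∑ c ∈ S, w c := mul_nonneg hC.le hsum0
      rw [← ENNReal.ofReal_mul (Real.exp_pos _).le, ← Real.exp_add, ← ENNReal.ofReal_one]
      exact ENNReal.ofReal_le_ofReal (Real.one_le_exp (by positivity))
    refine add_le_add ?_ ?_
    · exact le_mul_of_one_le_left zero_le b2
    · rw [mul_assoc]
      exact mul_le_mul' b1 ih'

end Moments

end LevyWave

namespace LevyWave

/-! ### The p-th moment of a stochastic convolution. -/

section MomentBound

variable {Ω : Type*} [mΩ : MeasurableSpace Ω] {P : Measure Ω} {N : Ω → Measure Pt} {ν : Measure ℝ}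
  [IsProbabilityMeasure P] [SigmaFinite ν]

/-- Compares a Riemann sum with an integral. Left endpoints and rounding towards zero put the
summand below the integrand, as φ is increasing; the cone must be widened by 2h to contain whole
cells. The constant is 2(t + 2h) ≤ 6t ≤ 6T, thanks to h ≤ t. -/
theorem sum_cell_le {h t T x q : ℝ} (hh : 0 < h) (hht : h ≤ t) (htT : t ≤ T) (hq : 0 ≤ q)
    {φ : ℝ → ℝ≥0∞} (hφ : Monotone φ) {S : Finset (ℤ × ℤ × ℤ)}
    (hS : ∀ c ∈ S, 1 ≤ c.1 ∧ (c.1 + 1) * h ≤ t ∧ |x - c.2.1 * h| < t - c.1 * h) :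
    ∑ c ∈ S, intensity ν (cell h c) * (ENNReal.ofReal (|c.2.2 * h| ^ q) * φ (c.1 * h)) ≤
      levyMoment ν q * (ENNReal.ofReal (6 * T) * ∫⁻ s in Set.Icc 0 t, φ s) := by
  classical
  have hφm : Measurable φ := hφ.measurable
  have hψ : Measurable ((Set.Iic t).indicator φ) := hφm.indicator measurableSet_Iic
  have hmc : ∀ c, MeasurableSet (cell h c) := fun c => by
    have : cell h c = cellIdx h ⁻¹' {c} := by
      ext ξ; rw [mem_cell hh]; rfl
    rw [this]
    exact measurable_cellIdx h (measurableSet_singleton c)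
  set f : Pt → ℝ≥0∞ := fun ξ => (if |x - ξ.2.1| < (t + 2 * h) - ξ.1 then
    (Set.Iic t).indicator φ ξ.1 else 0) * ENNReal.ofReal (|ξ.2.2| ^ q) with hf
  have h1 : ∀ c ∈ S, intensity ν (cell h c) *
      (ENNReal.ofReal (|c.2.2 * h| ^ q) * φ (c.1 * h)) ≤ ∫⁻ ξ in cell h c, f ξ ∂intensity ν := by
    intro c hc
    rw [mul_comm, ← setLIntegral_const]
    refine setLIntegral_mono' (hmc c) fun ξ hξ => ?_
    rw [mem_cell hh] at hξ
    obtain ⟨c1, c2, c3⟩ := hS c hc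
    have a1 : timeIdx h ξ.1 = c.1 := congrArg (·.1) hξ
    have a2 : spaceIdx h ξ.2.1 = c.2.1 := congrArg (·.2.1) hξ
    have a3 : jumpIdx h ξ.2.2 = c.2.2 := congrArg (·.2.2) hξ
    have b1 := timeIdx_mul_lt hh ξ.1
    have b2 := le_timeIdx_mul hh ξ.1
    have b3 := spaceIdx_mul_le hh ξ.2.1
    have b4 := lt_spaceIdx_mul hh ξ.2.1
    have b5 := abs_jumpIdx_mul_le hh ξ.2.2
    rw [a1] at b1 b2
    rw [a2] at b3 b4
    rw [a3] at b5
    have d1 : |x - ξ.2.1| < (t + 2 * h) - ξ.1 := by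
      rw [abs_lt] at c3 ⊢
      constructor <;> linarith
    have d2 : ξ.1 ∈ Set.Iic t := by rw [Set.mem_Iic]; linarith
    rw [hf]
    simp only
    rw [if_pos d1, Set.indicator_of_mem d2, mul_comm]
    refine mul_le_mul' (hφ b1.le) (ENNReal.ofReal_le_ofReal ?_)
    exact Real.rpow_le_rpow (abs_nonneg _) b5 hq
  calc _ ≤ ∑ c ∈ S, ∫⁻ ξ in cell h c, f ξ ∂intensity ν := Finset.sum_le_sum h1
    _ = ∫⁻ ξ in ⋃ c ∈ S, cell h c, f ξ ∂intensity ν := by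
        rw [lintegral_biUnion_finset (fun c _ c' _ hcc => disjoint_cell hh hcc) fun c _ => hmc c]
    _ ≤ ∫⁻ ξ, f ξ ∂intensity ν := setLIntegral_le_lintegral _ _
    _ = _ := lintegral_cone hψ (t + 2 * h) x q
    _ ≤ _ := by
        gcongr
        rw [← lintegral_const_mul _ hφm, ← lintegral_indicator measurableSet_Icc,
          ← lintegral_indicator measurableSet_Ici]
        refine lintegral_mono fun s => ?_
        simp only [Set.indicator_apply, Set.mem_Ici, Set.mem_Icc, Set.mem_Iic]
        by_cases h0 : 0 ≤ s <;> by_cases h2 : s ≤ t <;> simp only [h0, h2, if_true, if_false,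
          and_true, and_false, mul_zero, le_refl]
        refine mul_le_mul' (ENNReal.ofReal_le_ofReal ?_) le_rfl
        linarith

/-- With w = l a²/L the powers of l a² cancel in l^{p/2} w^{1-p/2} |a|^p, leaving L^{p/2-1} l a².
This is linear in the cell measure l, so the contributions of the cells add up to an integral. -/
theorem stepWeight_mul_le {p l a L : ℝ} (hp : 2 ≤ p) (hl : 0 ≤ l) (ha : a ≠ 0)
    (hL : l * a ^ 2 ≤ L) :
    stepWeight p l (l * a ^ 2 / L) * |a| ^ p ≤
      stepConst p * (2 * L ^ (p / 2 - 1) * (l * |a| ^ (2 : ℝ)) + l * |a| ^ p) := by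
  have hC := stepConst_pos p
  have hapos : 0 < |a| := abs_pos.2 ha
  rw [Real.rpow_two, sq_abs]
  rcases hl.eq_or_lt with rfl | hl
  · rw [stepWeight, Real.zero_rpow (by linarith)]
    simp
  · have hla : 0 < l * a ^ 2 := by positivity
    have hL0 : 0 < L := lt_of_lt_of_le hla hL
    have e0 : |a| ^ p = (a ^ 2) ^ (p / 2) := by
      rw [← sq_abs, ← Real.rpow_natCast |a| 2, ← Real.rpow_mul (abs_nonneg a)]
      congr 1; push_cast; ring
    have e1 : l ^ (p / 2) * |a| ^ p = (l * a ^ 2) * (l * a ^ 2) ^ (p / 2 - 1) := by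
      rw [e0, ← Real.mul_rpow hl.le (sq_nonneg a), mul_comm (l * a ^ 2), ← Real.rpow_add_one hla.ne']
      congr 1; ring
    have e2 : (l * a ^ 2 / L) ^ (1 - p / 2) * (l * a ^ 2) ^ (p / 2 - 1) = L ^ (p / 2 - 1) := by
      rw [show 1 - p / 2 = -(p / 2 - 1) by ring, Real.rpow_neg (by positivity),
        Real.div_rpow hla.le hL0.le, inv_div, div_mul_cancel₀]
      positivity
    have e3 : (l * a ^ 2) ^ (p / 2 - 1) ≤ L ^ (p / 2 - 1) :=
      Real.rpow_le_rpow hla.le hL (by linarith)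
    have e4 : l ^ (p / 2) * (l * a ^ 2 / L) ^ (1 - p / 2) * |a| ^ p =
        L ^ (p / 2 - 1) * (l * a ^ 2) := by
      calc _ = (l * a ^ 2 / L) ^ (1 - p / 2) * (l ^ (p / 2) * |a| ^ p) := by ring
        _ = _ := by rw [e1, ← e2]; ring
    have e5 : l ^ (p / 2) * |a| ^ p ≤ L ^ (p / 2 - 1) * (l * a ^ 2) := by
      rw [e1, mul_comm]; gcongr
    calc _ = stepConst p * (l ^ (p / 2) * (l * a ^ 2 / L) ^ (1 - p / 2) * |a| ^ p + l * |a| ^ p +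
          l ^ (p / 2) * |a| ^ p) := by rw [stepWeight]; ring
      _ ≤ _ := by
          refine mul_le_mul_of_nonneg_left ?_ hC.le
          rw [e4]
          linarith

/-- Fatou's lemma for moments along `L²`-convergent sequences. -/
theorem lintegral_rpow_le_of_tendsto {f : ℕ → HSp P} {f' : HSp P} (hf : Tendsto f atTop (𝓝 f'))
    {p : ℝ} (hp : 0 ≤ p) {A : ℝ≥0∞} (h : ∀ k, ∫⁻ ω, ENNReal.ofReal (|f k ω| ^ p) ∂P ≤ A) :
    ∫⁻ ω, ENNReal.ofReal (|f' ω| ^ p) ∂P ≤ A := by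
  obtain ⟨ns, -, hns⟩ := (tendstoInMeasure_of_tendsto_Lp hf).exists_seq_tendsto_ae
  calc _ = ∫⁻ ω, liminf (fun k => ENNReal.ofReal (|f (ns k) ω| ^ p)) atTop ∂P := by
        refine lintegral_congr_ae ?_
        filter_upwards [hns] with ω hω
        refine (Tendsto.liminf_eq ?_).symm
        refine (ENNReal.continuous_ofReal.tendsto _).comp ?_
        exact (hω.abs).rpow_const (Or.inr hp)
    _ ≤ liminf (fun k => ∫⁻ ω, ENNReal.ofReal (|f (ns k) ω| ^ p) ∂P) atTop := by
        refine lintegral_liminf_le' fun k => ?_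
        exact ((Lp.aestronglyMeasurable (f (ns k))).aemeasurable.abs.pow_const p).ennreal_ofReal
    _ ≤ liminf (fun _ => A) atTop := liminf_le_liminf (Eventually.of_forall fun k => h _)
    _ = A := by simp

/-- The factor of the moment estimate for stochastic convolutions. -/
noncomputable def convConst (p : ℝ) : ℝ :=
  12 * 6 ^ (p / 2) * (Real.exp (stepConst p) * stepConst p)

theorem convConst_pos (p : ℝ) : 0 < convConst p := by
  have := stepConst_pos p
  unfold convConst
  positivity

/-- A bound with the same constant on every grid, fit for Fatou's lemma. Cells outside the backward
cone of (t,x) have zero coefficient and are removed first, since only the others obey the Riemann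
sum comparison. -/
theorem lintegral_waveApprox_le (hN : IsPoissonRandomMeasure P N (intensity ν))
    (hν : levyMoment ν 2 < ∞) {p : ℝ} (hp : 2 ≤ p) (hνp : levyMoment ν p < ∞) {r y : ℝ}
    {u : ℝ → ℝ → HSp P} (hu : IsWaveField P N ν r y u) {t T : ℝ} (ht : 0 < t) (htT : t ≤ T)
    {φ : ℝ → ℝ≥0∞} (hφ : Monotone φ)
    (huφ : ∀ s w, s < t → ∫⁻ ω, ENNReal.ofReal (|u s w ω| ^ p) ∂P ≤ φ s) (x : ℝ) (k : ℕ) :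
    ∫⁻ ω, ENNReal.ofReal (|(waveApprox hν (gridUpTo ht) hu t x k).integral ω| ^ p) ∂P ≤
      ENNReal.ofReal (convConst p * ((levyMoment ν 2).toReal ^ (p / 2) * T ^ (p - 1) +
        (levyMoment ν p).toReal * T)) * ∫⁻ s in Set.Icc 0 t, φ s := by
  classical
  set g := gridUpTo ht with hg
  set h := g.h k with hh'
  have hh : 0 < h := g.pos k
  have hht : h ≤ t := by
    have := gridUpTo_end ht k
    have h2 : (0 : ℝ) ≤ g.K k := Nat.cast_nonneg _
    rw [← hg, ← hh'] at this
    nlinarith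
  have hT0 : 0 < T := lt_of_lt_of_le ht htT
  have hp0 : 0 < p := by linarith
  set m₂ := (levyMoment ν 2).toReal with hm₂
  set mp := (levyMoment ν p).toReal with hmp
  have hm₂0 : 0 ≤ m₂ := ENNReal.toReal_nonneg
  have hmp0 : 0 ≤ mp := ENNReal.toReal_nonneg
  have em₂ : levyMoment ν 2 = ENNReal.ofReal m₂ := (ENNReal.ofReal_toReal hν.ne).symm
  have emp : levyMoment ν p = ENNReal.ofReal mp := (ENNReal.ofReal_toReal hνp.ne).symm
  have hC := stepConst_pos p
  set S := (gridIdx (g.K k) (g.M k)).filter fun c => |x - c.2.1 * h| < t - c.1 * h with hSdef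
  set Y := approxCoeff hu t x h k with hYdef
  have hS : ∀ c ∈ S, (1 ≤ c.1 ∧ (c.1 + 1) * h ≤ t ∧ |x - c.2.1 * h| < t - c.1 * h) ∧
      c.2.2 ≠ 0 := by
    intro c hc
    rw [hSdef, Finset.mem_filter] at hc
    have h1 := mem_gridIdx.1 hc.1
    refine ⟨⟨h1.1.1, ?_, hc.2⟩, h1.2.2.1⟩
    have h2 : (c.1 : ℝ) ≤ g.K k := by exact_mod_cast h1.1.2
    calc _ ≤ (g.K k + 1) * h := by gcongr
      _ = t := gridUpTo_end ht k
  have h_int : ∀ ω, (waveApprox hν g hu t x k).integral ω =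
      ∑ c ∈ S, Y c ω * compensated N ν (cell h c) ω := by
    intro ω
    rw [waveApprox, gridProcess_integral, hSdef, Finset.sum_filter]
    refine Finset.sum_congr rfl fun c _ => ?_
    split_ifs with hc
    · rfl
    · rw [approxCoeff, waveG, if_neg hc]
      simp
  have hfin : ∀ c ∈ S, intensity ν (cell h c) < ∞ := fun c hc =>
    (finiteRect_cell hν hh (hS c hc).2 _).intensity_lt_top (by simp)
  -- An upper bound for the total quadratic variation, the sum of cell measure times squared jump:
  -- `sum_cell_le` with φ = 1.
  set L := 6 * T * T * m₂ with hL
  have hL0 : 0 ≤ L := by positivity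
  have hsumL : ∑ c ∈ S, (intensity ν (cell h c)).toReal * (c.2.2 * h) ^ 2 ≤ L := by
    have h1 := sum_cell_le (ν := ν) (x := x) (q := 2) hh hht htT (by norm_num)
      (φ := fun _ => 1) (fun _ _ _ => le_rfl) (S := S) (fun c hc => (hS c hc).1)
    have h2 : ENNReal.ofReal (∑ c ∈ S, (intensity ν (cell h c)).toReal * (c.2.2 * h) ^ 2) ≤
        ENNReal.ofReal L := by
      rw [ENNReal.ofReal_sum_of_nonneg fun c _ => by positivity]
      calc _ = ∑ c ∈ S, intensity ν (cell h c) * (ENNReal.ofReal (|c.2.2 * h| ^ (2 : ℝ)) * 1) := by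
            refine Finset.sum_congr rfl fun c hc => ?_
            rw [ENNReal.ofReal_mul ENNReal.toReal_nonneg, ENNReal.ofReal_toReal (hfin c hc).ne,
              Real.rpow_two, sq_abs, mul_one]
        _ ≤ _ := h1
        _ ≤ ENNReal.ofReal m₂ * (ENNReal.ofReal (6 * T) * ENNReal.ofReal T) := by
            rw [em₂, setLIntegral_const, Real.volume_Icc, one_mul, sub_zero]
            gcongr
        _ = _ := by
            rw [← ENNReal.ofReal_mul (by positivity), ← ENNReal.ofReal_mul hm₂0, hL]
            congr 1; ring
    exact (ENNReal.ofReal_le_ofReal_iff hL0).1 h2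
  have hterm : ∀ c ∈ S, (intensity ν (cell h c)).toReal * (c.2.2 * h) ^ 2 ≤ L := fun c hc =>
    (Finset.single_le_sum (f := fun c : ℤ × ℤ × ℤ => (intensity ν (cell h c)).toReal *
      (c.2.2 * h) ^ 2) (fun c _ => by positivity) hc).trans hsumL
  -- The share of each cell in L. The shares sum to at most 1, so the growth factor is at most
  -- exp(`stepConst p`), whatever the number of cells.
  set w : ℤ × ℤ × ℤ → ℝ := fun c => (intensity ν (cell h c)).toReal * (c.2.2 * h) ^ 2 / L
    with hw
  have hzc : ∀ c ∈ S, (c.2.2 * h : ℝ) ≠ 0 := fun c hc =>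
    mul_ne_zero (by exact_mod_cast (hS c hc).2) hh.ne'
  have hwc : ∀ c ∈ S, 0 < w c ∨ w c = 0 ∧ intensity ν (cell h c) = 0 := by
    intro c hc
    rcases (ENNReal.toReal_nonneg (a := intensity ν (cell h c))).eq_or_lt with h1 | h1
    · right
      refine ⟨by simp [hw, ← h1], ?_⟩
      rcases (ENNReal.toReal_eq_zero_iff _).1 h1.symm with h2 | h2
      · exact h2
      · exact absurd h2 (hfin c hc).ne
    · left
      have h2 : 0 < (intensity ν (cell h c)).toReal * (c.2.2 * h) ^ 2 := by
        have := hzc c hc; positivity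
      exact div_pos h2 (lt_of_lt_of_le h2 (hterm c hc))
  have hwsum : ∑ c ∈ S, w c ≤ 1 := by
    rw [hw, ← Finset.sum_div]
    exact div_le_one_of_le₀ hsumL hL0
  have hmain := lintegral_grid_sum_le hN hν hp hh (Y := Y) w S
    (fun c hc => ⟨(hS c hc).1.1, (hS c hc).2⟩)
    (fun c _ => (measurable_approxCoeff hu t x h k c).stronglyMeasurable.aestronglyMeasurable) hwc
  have hYb : ∀ c ∈ S, ∫⁻ ω, ENNReal.ofReal (|Y c ω| ^ p) ∂P ≤
      ENNReal.ofReal (|c.2.2 * h| ^ p) * φ (c.1 * h) := by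
    intro c hc
    have hlt : (c.1 : ℝ) * h < t := by
      have := (abs_nonneg _).trans_lt (hS c hc).1.2.2
      linarith
    refine le_trans ?_ (mul_le_mul' le_rfl (huφ (c.1 * h) (c.2.1 * h) hlt))
    rw [← lintegral_const_mul' _ _ ENNReal.ofReal_ne_top]
    refine lintegral_mono_ae ?_
    filter_upwards [(hu.adapted (c.1 * h) (c.2.1 * h)).ae_eq_mk] with ω hω
    rw [← ENNReal.ofReal_mul (by positivity), ← Real.mul_rpow (abs_nonneg _) (abs_nonneg _)]
    refine ENNReal.ofReal_le_ofReal (Real.rpow_le_rpow (abs_nonneg _) ?_ hp0.le)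
    rw [hYdef, approxCoeff, ← hω, abs_mul, abs_mul, abs_of_nonneg (waveG_nonneg _ _)]
    refine mul_le_mul ?_ (abs_clip_le_abs (Nat.cast_nonneg k) _) (abs_nonneg _) (abs_nonneg _)
    have h1 := waveG_le (t - c.1 * h) (x - c.2.1 * h)
    have h2 := abs_nonneg ((c.2.2 : ℝ) * h)
    nlinarith
  set I := ∫⁻ s in Set.Icc 0 t, φ s with hI
  have hsumB : ∑ c ∈ S, ENNReal.ofReal (stepWeight p (intensity ν (cell h c)).toReal (w c)) *
      ∫⁻ ω, ENNReal.ofReal (|Y c ω| ^ p) ∂P ≤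
      ENNReal.ofReal (stepConst p * (2 * L ^ (p / 2 - 1) * (m₂ * (6 * T)) + mp * (6 * T))) * I := by
    have h2 := sum_cell_le (ν := ν) (x := x) (q := 2) hh hht htT (by norm_num) hφ (S := S)
      (fun c hc => (hS c hc).1)
    have hpS := sum_cell_le (ν := ν) (x := x) (q := p) hh hht htT hp0.le hφ (S := S)
      (fun c hc => (hS c hc).1)
    calc _ ≤ ∑ c ∈ S, (ENNReal.ofReal (stepConst p * (2 * L ^ (p / 2 - 1))) *
          (intensity ν (cell h c) * (ENNReal.ofReal (|c.2.2 * h| ^ (2 : ℝ)) * φ (c.1 * h))) +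
          ENNReal.ofReal (stepConst p) *
          (intensity ν (cell h c) * (ENNReal.ofReal (|c.2.2 * h| ^ p) * φ (c.1 * h)))) := by
          refine Finset.sum_le_sum fun c hc => ?_
          refine (mul_le_mul' le_rfl (hYb c hc)).trans ?_
          have h3 := stepWeight_mul_le hp (ENNReal.toReal_nonneg (a := intensity ν (cell h c)))
            (hzc c hc) (hterm c hc)
          rw [← mul_assoc, ← ENNReal.ofReal_mul' (by positivity)]
          refine (mul_le_mul' (ENNReal.ofReal_le_ofReal h3) le_rfl).trans (le_of_eq ?_)
          rw [mul_add, ENNReal.ofReal_add (by positivity) (by positivity), add_mul]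
          conv_rhs => rw [← ENNReal.ofReal_toReal (hfin c hc).ne]
          congr 1
          · rw [← mul_assoc (stepConst p), ENNReal.ofReal_mul (p := stepConst p * _)
              (by positivity), ENNReal.ofReal_mul (p := ENNReal.toReal _) (by positivity)]
            ring
          · rw [ENNReal.ofReal_mul hC.le, ENNReal.ofReal_mul (p := ENNReal.toReal _)
              (by positivity)]
            ring
      _ = ENNReal.ofReal (stepConst p * (2 * L ^ (p / 2 - 1))) *
          ∑ c ∈ S, (intensity ν (cell h c) *
            (ENNReal.ofReal (|c.2.2 * h| ^ (2 : ℝ)) * φ (c.1 * h))) +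
          ENNReal.ofReal (stepConst p) * ∑ c ∈ S, (intensity ν (cell h c) *
            (ENNReal.ofReal (|c.2.2 * h| ^ p) * φ (c.1 * h))) := by
          rw [Finset.sum_add_distrib, Finset.mul_sum, Finset.mul_sum]
      _ ≤ ENNReal.ofReal (stepConst p * (2 * L ^ (p / 2 - 1))) *
          (ENNReal.ofReal m₂ * (ENNReal.ofReal (6 * T) * I)) + ENNReal.ofReal (stepConst p) *
          (ENNReal.ofReal mp * (ENNReal.ofReal (6 * T) * I)) := by
          rw [← em₂, ← emp]; gcongr
      _ = _ := by
          have f1 : ENNReal.ofReal (stepConst p * (2 * L ^ (p / 2 - 1) * (m₂ * (6 * T)))) =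
              ENNReal.ofReal (stepConst p * (2 * L ^ (p / 2 - 1))) *
                (ENNReal.ofReal m₂ * ENNReal.ofReal (6 * T)) := by
            rw [← ENNReal.ofReal_mul hm₂0, ← ENNReal.ofReal_mul (by positivity)]
            congr 1; ring
          have f2 : ENNReal.ofReal (stepConst p * (mp * (6 * T))) = ENNReal.ofReal (stepConst p) *
              (ENNReal.ofReal mp * ENNReal.ofReal (6 * T)) := by
            rw [← ENNReal.ofReal_mul hmp0, ← ENNReal.ofReal_mul hC.le]
          rw [mul_add (stepConst p), ENNReal.ofReal_add (by positivity) (by positivity), add_mul,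
            f1, f2]
          ring
  simp only [h_int]
  refine (hmain.trans (mul_le_mul' (ENNReal.ofReal_le_ofReal (Real.exp_le_exp.2
    (mul_le_of_le_one_right hC.le hwsum))) hsumB)).trans ?_
  rw [← mul_assoc, ← ENNReal.ofReal_mul (Real.exp_pos _).le]
  refine mul_le_mul' (ENNReal.ofReal_le_ofReal ?_) le_rfl
  -- Here the powers m₂^{p/2} and T^{p-1} arise; the missing power of T comes from the exponential
  -- rate being multiplied by the time.
  have hLp : L ^ (p / 2 - 1) * m₂ * T = 6 ^ (p / 2 - 1) * (m₂ ^ (p / 2) * T ^ (p - 1)) := by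
    rcases hm₂0.eq_or_lt with h1 | h1
    · rw [← h1, Real.zero_rpow (by positivity)]; ring
    · rw [hL, Real.mul_rpow (by positivity) hm₂0, mul_assoc (6 : ℝ), Real.mul_rpow (by norm_num)
        (by positivity), ← sq, ← Real.rpow_natCast T 2, ← Real.rpow_mul hT0.le,
        show m₂ ^ (p / 2) = m₂ ^ (p / 2 - 1) * m₂ by
          rw [← Real.rpow_add_one h1.ne']; congr 1; ring,
        show T ^ (p - 1) = T ^ (((2 : ℕ) : ℝ) * (p / 2 - 1)) * T by
          rw [← Real.rpow_add_one hT0.ne']; congr 1; push_cast; ring]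
      ring
  have h6 : (1 : ℝ) ≤ 6 ^ (p / 2) := Real.one_le_rpow (by norm_num) (by positivity)
  have h6' : (6 : ℝ) ^ (p / 2) = 6 ^ (p / 2 - 1) * 6 := by
    rw [← Real.rpow_add_one (by norm_num)]; congr 1; ring
  have hA : 0 ≤ m₂ ^ (p / 2) * T ^ (p - 1) := by positivity
  have hB : 0 ≤ mp * T := by positivity
  have hE : 0 ≤ Real.exp (stepConst p) * stepConst p := by positivity
  calc _ = (Real.exp (stepConst p) * stepConst p) *
        (12 * (L ^ (p / 2 - 1) * m₂ * T) + 6 * (mp * T)) := by ring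
    _ = (Real.exp (stepConst p) * stepConst p) *
        (2 * 6 ^ (p / 2) * (m₂ ^ (p / 2) * T ^ (p - 1)) + 6 * (mp * T)) := by
        rw [hLp, h6']; ring
    _ ≤ (Real.exp (stepConst p) * stepConst p) *
        (12 * 6 ^ (p / 2) * (m₂ ^ (p / 2) * T ^ (p - 1)) + 12 * 6 ^ (p / 2) * (mp * T)) := by
        gcongr <;> nlinarith
    _ = _ := by rw [convConst]; ring

end MomentBound

end LevyWave

namespace LevyWave

/-! ### The moment bound for the solution. -/

section SolutionMoments

variable {Ω : Type*} [mΩ : MeasurableSpace Ω] {P : Measure Ω} {N : Ω → Measure Pt} {ν : Measure ℝ}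
  [IsProbabilityMeasure P] [SigmaFinite ν] {r y z : ℝ}

/-- The approximations on `gridUpTo` converge in L²(Ω) to the integral, and Fatou's lemma transfers
their common p-th moment bound. -/
theorem lintegral_conv_le (h0 : ν {0} = 0) (hN : IsPoissonRandomMeasure P N (intensity ν))
    (hν : levyMoment ν 2 < ∞) {p : ℝ} (hp : 2 ≤ p) (hνp : levyMoment ν p < ∞)
    {u : ℝ → ℝ → HSp P} (hu : IsWaveField P N ν r y u) {t T : ℝ} (ht : 0 < t) (htT : t ≤ T)
    {φ : ℝ → ℝ≥0∞} (hφ : Monotone φ)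
    (huφ : ∀ s w, s < t → ∫⁻ ω, ENNReal.ofReal (|u s w ω| ^ p) ∂P ≤ φ s) {x : ℝ} {X : HSp P}
    (hX : ItoRel P N ν (waveIntegrand u t x) X) :
    ∫⁻ ω, ENNReal.ofReal (|X ω| ^ p) ∂P ≤
      ENNReal.ofReal (convConst p * ((levyMoment ν 2).toReal ^ (p / 2) * T ^ (p - 1) +
        (levyMoment ν p).toReal * T)) * ∫⁻ s in Set.Icc 0 t, φ s := by
  obtain ⟨X', hX', -, hlim⟩ := exists_stochastic_convolution h0 hν hN hu ht x
  rw [hX.unique hN hX']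
  refine lintegral_rpow_le_of_tendsto hlim (by linarith) fun k => ?_
  refine le_trans (le_of_eq (lintegral_congr_ae ?_))
    (lintegral_waveApprox_le hN hν hp hνp hu ht htT hφ huφ x k)
  filter_upwards [MemLp.coeFn_toLp ((waveApprox hν (gridUpTo ht) hu t x k).memLp_integral hN)]
    with ω hω
  rw [hω]

theorem isWaveField_sum_picardTerm (h0 : ν {0} = 0) (hν : levyMoment ν 2 < ∞)
    (hN : IsPoissonRandomMeasure P N (intensity ν)) (r y z : ℝ) (M : ℕ) :
    IsWaveField P N ν r y fun t x => ∑ n ∈ Finset.range M, picardTerm P N ν r y z n t x := by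
  induction M with
  | zero =>
    refine ⟨fun t x => ?_, fun q _ => ?_, fun T => ⟨0, le_rfl, fun t x _ => ?_⟩⟩
    · simp only [Finset.range_zero, Finset.sum_empty]
      exact AEStronglyMeasurable.congr (f := fun _ => 0) aestronglyMeasurable_const
        (Lp.coeFn_zero ℝ 2 P).symm
    · simp only [Finset.range_zero, Finset.sum_empty]
      exact continuousAt_const
    · simp
  | succ M ih =>
    simp only [Finset.sum_range_succ]
    exact ih.add (isWaveField_picardTerm h0 hν hN r y z M)

/-- The exponential rate in the moment bound up to time `T`. -/
noncomputable def momentRate (ν : Measure ℝ) (p T : ℝ) : ℝ :=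
  2 ^ p * (convConst p * ((levyMoment ν 2).toReal ^ (p / 2) * T ^ (p - 1) +
    (levyMoment ν p).toReal * T))

theorem momentRate_nonneg (ν : Measure ℝ) (p : ℝ) {T : ℝ} (hT : 0 ≤ T) :
    0 ≤ momentRate ν p T := by
  have := convConst_pos p
  unfold momentRate
  positivity

/-- Grönwall by induction on the number of terms: a partial sum is the free term plus the
convolution of the previous one. The rate is 2^p A, so that integration in time gains 2^{-p}; the
kernel bound 1/2 gives the free term the same gain. Together they offset the 2^{p-1} from convexity.
-/
theorem lintegral_sum_picardTerm_le (h0 : ν {0} = 0) (hν : levyMoment ν 2 < ∞)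
    (hN : IsPoissonRandomMeasure P N (intensity ν)) (hr : 0 ≤ r) {p : ℝ} (hp : 2 ≤ p)
    (hνp : levyMoment ν p < ∞) {T : ℝ} (hT : 0 < T) (M : ℕ) : ∀ t x, t ≤ T →
    ∫⁻ ω, ENNReal.ofReal
      (|(∑ n ∈ Finset.range M, picardTerm P N ν r y z n t x : HSp P) ω| ^ p) ∂P ≤
      ENNReal.ofReal (|z| ^ p * Real.exp (momentRate ν p T * t)) := by
  have hp0 : 0 < p := by linarith
  have hzero : ∀ A : ℝ≥0∞, ∫⁻ ω, ENNReal.ofReal (|(0 : HSp P) ω| ^ p) ∂P ≤ A := by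
    intro A
    refine le_trans (le_of_eq ?_) (zero_le (a := A))
    rw [lintegral_eq_zero_iff' ((Lp.aestronglyMeasurable
      (0 : HSp P)).aemeasurable.abs.pow_const p).ennreal_ofReal]
    filter_upwards [Lp.coeFn_zero ℝ 2 P] with ω hω
    simp [Real.zero_rpow hp0.ne']
  set c := momentRate ν p T with hc
  have hc0 : 0 ≤ c := momentRate_nonneg ν p hT.le
  induction M with
  | zero =>
    intro t x _
    simp only [Finset.range_zero, Finset.sum_empty]
    exact hzero _
  | succ M ih =>
    intro t x htT
    rcases le_or_gt t 0 with ht | ht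
    · have : ∑ n ∈ Finset.range (M + 1), picardTerm P N ν r y z n t x = 0 :=
        Finset.sum_eq_zero fun n _ => picardTerm_eq_zero h0 hν hN n t x (by
          have := abs_nonneg (x - y); linarith)
      rw [this]
      exact hzero _
    · set X : HSp P := ∑ n ∈ Finset.range M, picardTerm P N ν r y z (n + 1) t x with hX
      have hXrel : ItoRel P N ν (waveIntegrand
          (fun t x => ∑ n ∈ Finset.range M, picardTerm P N ν r y z n t x) t x) X := by
        have := ItoRel.sum (Finset.range M) fun n _ => itoRel_picardTerm h0 hν hN r y z n t x
        convert this using 1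
        ext1 ξ
        simp only [waveIntegrand, Finset.smul_sum]
      have hmono : Monotone fun s => ENNReal.ofReal (|z| ^ p * Real.exp (c * s)) := by
        intro s s' hs
        refine ENNReal.ofReal_le_ofReal ?_
        gcongr
      have h1 := lintegral_conv_le h0 hN hν hp hνp
        (isWaveField_sum_picardTerm h0 hν hN r y z M) ht htT hmono
        (fun s w hs => ih s w (hs.le.trans htT)) hXrel
      set A := convConst p * ((levyMoment ν 2).toReal ^ (p / 2) * T ^ (p - 1) +
        (levyMoment ν p).toReal * T) with hA
      have hA0 : 0 ≤ A := by
        have := convConst_pos p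
        positivity
      have hcA : c = 2 ^ p * A := rfl
      have h2p : (0 : ℝ) < 2 ^ p := by positivity
      have h2 : ∫⁻ ω, ENNReal.ofReal (|X ω| ^ p) ∂P ≤
          ENNReal.ofReal ((2 ^ p)⁻¹ * (|z| ^ p * Real.exp (c * t))) := by
        calc _ ≤ _ := h1
          _ ≤ ENNReal.ofReal A * ∫⁻ s in Set.Iic t, ENNReal.ofReal (|z| ^ p * Real.exp (c * s)) := by
              gcongr
              exact Set.Icc_subset_Iic_self
          _ = ENNReal.ofReal ((2 ^ p)⁻¹ * |z| ^ p) *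
              ∫⁻ s in Set.Iic t, ENNReal.ofReal (c * Real.exp (c * s)) := by
              rw [← lintegral_const_mul _ (by fun_prop), ← lintegral_const_mul _ (by fun_prop)]
              refine lintegral_congr fun s => ?_
              rw [← ENNReal.ofReal_mul hA0, ← ENNReal.ofReal_mul (by positivity), hcA]
              congr 1
              field_simp
          _ ≤ ENNReal.ofReal ((2 ^ p)⁻¹ * |z| ^ p) * ENNReal.ofReal (Real.exp (c * t)) := by
              gcongr
              exact lintegral_exp_Iic_le hc0 t
          _ = _ := by
              rw [← ENNReal.ofReal_mul (by positivity), mul_assoc]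
      have hdec : ∑ n ∈ Finset.range (M + 1), picardTerm P N ν r y z n t x =
          Lp.const 2 P (waveG (t - r) (x - y) * z) + X := by
        rw [Finset.sum_range_succ', add_comm]
        rfl
      rw [hdec]
      calc _ ≤ ∫⁻ ω, ENNReal.ofReal (2 ^ (p - 1)) * (ENNReal.ofReal ((2 ^ p)⁻¹ * |z| ^ p) +
            ENNReal.ofReal (|X ω| ^ p)) ∂P := by
            refine lintegral_mono_ae ?_
            filter_upwards [Lp.coeFn_add (Lp.const 2 P (waveG (t - r) (x - y) * z)) X,
              Lp.coeFn_const (p := 2) (μ := P) (waveG (t - r) (x - y) * z)] with ω e1 e2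
            rw [e1, Pi.add_apply, e2, ← ENNReal.ofReal_add (by positivity) (by positivity),
              ← ENNReal.ofReal_mul (by positivity)]
            refine ENNReal.ofReal_le_ofReal ?_
            have f1 : |waveG (t - r) (x - y) * z| ^ p ≤ (2 ^ p)⁻¹ * |z| ^ p := by
              rw [← Real.inv_rpow (by norm_num), ← Real.mul_rpow (by norm_num) (abs_nonneg _),
                abs_mul, abs_of_nonneg (waveG_nonneg _ _)]
              refine Real.rpow_le_rpow (mul_nonneg (waveG_nonneg _ _) (abs_nonneg _)) ?_ hp0.le
              have := waveG_le (t - r) (x - y)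
              gcongr
              linarith
            have f2 : (|waveG (t - r) (x - y) * z| + |X ω|) ^ p ≤
                2 ^ (p - 1) * (|waveG (t - r) (x - y) * z| ^ p + |X ω| ^ p) := by
              exact_mod_cast NNReal.rpow_add_le_mul_rpow_add_rpow
                ⟨|waveG (t - r) (x - y) * z|, abs_nonneg _⟩ ⟨|X ω|, abs_nonneg _⟩
                (by linarith : 1 ≤ p)
            calc _ ≤ (|waveG (t - r) (x - y) * z| + |X ω|) ^ p :=
                  Real.rpow_le_rpow (abs_nonneg _) (abs_add_le _ _) hp0.le
              _ ≤ _ := f2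
              _ ≤ _ := by gcongr
        _ = ENNReal.ofReal (2 ^ (p - 1)) * (ENNReal.ofReal ((2 ^ p)⁻¹ * |z| ^ p) +
            ∫⁻ ω, ENNReal.ofReal (|X ω| ^ p) ∂P) := by
            rw [lintegral_const_mul' _ _ ENNReal.ofReal_ne_top, lintegral_add_left
              measurable_const]
            simp
        _ ≤ ENNReal.ofReal (2 ^ (p - 1)) * (ENNReal.ofReal ((2 ^ p)⁻¹ * |z| ^ p) +
            ENNReal.ofReal ((2 ^ p)⁻¹ * (|z| ^ p * Real.exp (c * t)))) := by gcongr
        _ ≤ _ := by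
            rw [← ENNReal.ofReal_add (by positivity) (by positivity),
              ← ENNReal.ofReal_mul (by positivity)]
            refine ENNReal.ofReal_le_ofReal ?_
            have g1 : 1 ≤ Real.exp (c * t) := Real.one_le_exp (by positivity)
            have g2 : (2 : ℝ) ^ p = 2 ^ (p - 1) * 2 := by
              rw [← Real.rpow_add_one (by norm_num)]; congr 1; ring
            have g3 : (0 : ℝ) < 2 ^ (p - 1) := by positivity
            rw [g2]
            field_simp
            have : 0 ≤ |z| ^ p := by positivity
            nlinarith

theorem lintegral_solH_le (h0 : ν {0} = 0) (hν : levyMoment ν 2 < ∞)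
    (hN : IsPoissonRandomMeasure P N (intensity ν)) (hr : 0 ≤ r) {p : ℝ} (hp : 2 ≤ p)
    (hνp : levyMoment ν p < ∞) {T : ℝ} (hT : 0 < T) {t : ℝ} (htT : t ≤ T) (x : ℝ) :
    ∫⁻ ω, ENNReal.ofReal (|solH P N ν r y z t x ω| ^ p) ∂P ≤
      ENNReal.ofReal (|z| ^ p * Real.exp (momentRate ν p T * t)) :=
  lintegral_rpow_le_of_tendsto
    (summable_picardTerm h0 hν hN hr y z t x).hasSum.tendsto_sum_nat (by linarith)
    fun M => lintegral_sum_picardTerm_le h0 hν hN hr hp hνp hT M t x htT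

/-- The constant in the moment bound. -/
noncomputable def momentB (p : ℝ) : ℝ := (2 ^ p * convConst p) ^ (1 / p)

theorem momentB_pos (p : ℝ) : 0 < momentB p := by
  have := convConst_pos p
  unfold momentB
  positivity

theorem momentConst_momentB {p : ℝ} (hp : 2 ≤ p) {T : ℝ} (hT : 0 < T) (ν : Measure ℝ) :
    momentConst (momentB p) T p ν = Real.exp (momentRate ν p T * T) := by
  have := convConst_pos p
  rw [momentConst, momentB, ← Real.rpow_mul (by positivity), one_div_mul_cancel (by linarith),
    Real.rpow_one, momentRate]
  congr 1
  have h1 : T ^ p = T ^ (p - 1) * T := by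
    rw [← Real.rpow_add_one hT.ne']; congr 1; ring
  rw [h1]; ring

theorem eLpNorm_solH_le (h0 : ν {0} = 0) (hν : levyMoment ν 2 < ∞)
    (hN : IsPoissonRandomMeasure P N (intensity ν)) (hr : 0 ≤ r) {p : ℝ} (hp : 2 ≤ p)
    (hνp : levyMoment ν p < ∞) {T : ℝ} (hT : 0 < T) {t : ℝ} (htT : t ≤ T) (x : ℝ) :
    eLpNorm (solH P N ν r y z t x) (ENNReal.ofReal p) P ≤
      ENNReal.ofReal (momentConst (momentB p) T p ν * |z|) := by
  have hp0 : 0 < p := by linarith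
  have hc0 : 0 ≤ momentRate ν p T := momentRate_nonneg ν p hT.le
  rw [eLpNorm_eq_lintegral_rpow_enorm_toReal (by simpa using hp0) ENNReal.ofReal_ne_top,
    ENNReal.toReal_ofReal hp0.le]
  have h1 : ∀ ω, ‖solH P N ν r y z t x ω‖ₑ ^ p =
      ENNReal.ofReal (|solH P N ν r y z t x ω| ^ p) := by
    intro ω
    rw [Real.enorm_eq_ofReal_abs, ENNReal.ofReal_rpow_of_nonneg (abs_nonneg _) hp0.le]
  simp only [h1]
  refine (ENNReal.rpow_le_rpow (lintegral_solH_le h0 hν hN hr hp hνp hT htT x)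
    (by positivity)).trans ?_
  rw [ENNReal.ofReal_rpow_of_nonneg (by positivity) (by positivity), momentConst_momentB hp hT]
  refine ENNReal.ofReal_le_ofReal ?_
  rw [Real.mul_rpow (by positivity) (by positivity), ← Real.rpow_mul (abs_nonneg _),
    mul_one_div_cancel hp0.ne', Real.rpow_one, mul_comm]
  refine mul_le_mul_of_nonneg_right ?_ (abs_nonneg z)
  -- The p-th root divides the exponent by p; as p ≥ 1 this gain is simply dropped.
  rw [← Real.exp_mul]
  refine Real.exp_le_exp.2 ?_
  have h2 : momentRate ν p T * t ≤ momentRate ν p T * T := by gcongr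
  have h3 : 0 ≤ momentRate ν p T * T := by positivity
  rw [mul_one_div, div_le_iff₀ hp0]
  nlinarith

end SolutionMoments

end LevyWave

namespace LevyWave

/-! ### Discrete iterated integrals and their convergence to the Picard terms. -/

section DiscreteChaos

/-- Discretization of the chaos terms on a grid. -/
noncomputable def gridChaos {Ω : Type*} [MeasurableSpace Ω] (N : Ω → Measure Pt) (ν : Measure ℝ)
    (r y z h : ℝ) (K M : ℕ) : ℕ → ℝ → ℝ → Ω → ℝ
  | 0, t, x, _ => waveG (t - r) (x - y) * z
  | n + 1, t, x, ω => ∑ c ∈ gridIdx K M, (waveG (t - c.1 * h) (x - c.2.1 * h) * (c.2.2 * h) *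
      gridChaos N ν r y z h K M n (c.1 * h) (c.2.1 * h) ω) * compensated N ν (cell h c) ω

variable {Ω : Type*} [mΩ : MeasurableSpace Ω] {P : Measure Ω} {N : Ω → Measure Pt} {ν : Measure ℝ}
  [IsProbabilityMeasure P] [SigmaFinite ν] {r y z : ℝ}

/-- The two claims are proved together: adaptedness at corners yields square integrability of the
next order. At a grid time ih, a cell either ends by then or starts no earlier, in which case the
kernel vanishes; at other times adaptedness may fail. -/
theorem gridChaos_aux (hν : levyMoment ν 2 < ∞)
    (hN : IsPoissonRandomMeasure P N (intensity ν)) {h : ℝ} (hh : 0 < h) (K M n : ℕ) :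
    (∀ t x, MemLp (gridChaos N ν r y z h K M n t x) 2 P) ∧
    ∀ (i : ℤ) (x : ℝ), AdaptedAt P N ν (i * h) (gridChaos N ν r y z h K M n (i * h) x) := by
  induction n with
  | zero => exact ⟨fun t x => memLp_const _, fun i x => aestronglyMeasurable_const⟩
  | succ n ih =>
    have hY : ∀ (t x : ℝ) (c : ℤ × ℤ × ℤ), AdaptedAt P N ν (c.1 * h) (fun ω =>
        waveG (t - c.1 * h) (x - c.2.1 * h) * (c.2.2 * h) *
          gridChaos N ν r y z h K M n (c.1 * h) (c.2.1 * h) ω) :=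
      fun t x c => (ih.2 c.1 (c.2.1 * h)).const_mul _
    constructor
    · intro t x
      refine memLp_finsetSum _ fun c hc => ?_
      have hR := finiteRect_cell hν hh (mem_gridIdx.1 hc).2.2.1 c.2.1
      exact (hY t x c).memLp_mul_compensated hN ((ih.1 _ _).const_mul _)
        (hR.measurableSet measurableSet_Ioc) (hR.intensity_lt_top (by simp))
        (Ioc_prod_subset_Ioi le_rfl _)
    · intro i x
      refine adaptedAt_gridProcess_integral hν hN hh (Y := fun c ω =>
        waveG (i * h - c.1 * h) (x - c.2.1 * h) * (c.2.2 * h) *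
          gridChaos N ν r y z h K M n (c.1 * h) (c.2.1 * h) ω) (fun c _ => hY _ _ c) fun c _ => ?_
      rcases lt_or_ge c.1 i with hci | hci
      · left
        have : ((c.1 + 1 : ℤ) : ℝ) ≤ i := by exact_mod_cast hci
        push_cast at this
        gcongr
      · right
        have : (i : ℝ) ≤ c.1 := by exact_mod_cast hci
        have h1 : waveG (i * h - c.1 * h) (x - c.2.1 * h) = 0 :=
          waveG_eq_zero (by
            have := abs_nonneg (x - c.2.1 * h)
            nlinarith)
        simp only [h1, zero_mul]
        rfl

theorem memLp_gridChaos (hν : levyMoment ν 2 < ∞)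
    (hN : IsPoissonRandomMeasure P N (intensity ν)) {h : ℝ} (hh : 0 < h) (K M n : ℕ) (t x : ℝ) :
    MemLp (gridChaos N ν r y z h K M n t x) 2 P :=
  (gridChaos_aux hν hN hh K M n).1 t x

/-- `gridChaos` as an element of `L²(Ω)`. -/
noncomputable def gridChaosH (hν : levyMoment ν 2 < ∞)
    (hN : IsPoissonRandomMeasure P N (intensity ν)) (r y z : ℝ) {h : ℝ} (hh : 0 < h)
    (K M n : ℕ) (t x : ℝ) : HSp P :=
  (memLp_gridChaos (r := r) (y := y) (z := z) hν hN hh K M n t x).toLp _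

/-- The integrand whose Itô integral is the next discrete chaos. -/
noncomputable def gridIntegrand (h : ℝ) (K M : ℕ) (u : ℝ → ℝ → HSp P) (t x : ℝ) (ξ : Pt) : HSp P :=
  if cellIdx h ξ ∈ gridIdx K M then
    (waveG (t - timeIdx h ξ.1 * h) (x - spaceIdx h ξ.2.1 * h) * (jumpIdx h ξ.2.2 * h)) •
      u (timeIdx h ξ.1 * h) (spaceIdx h ξ.2.1 * h) else 0

/-- The coefficients are unbounded, so this is no `ElementaryProcess`. The graph admits square
integrable coefficients on a box, and the sum over cells is taken there. -/
theorem itoRel_gridChaosH (hν : levyMoment ν 2 < ∞)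
    (hN : IsPoissonRandomMeasure P N (intensity ν)) {h : ℝ} (hh : 0 < h) (K M n : ℕ) (t x : ℝ) :
    ItoRel P N ν (gridIntegrand h K M (gridChaosH hν hN r y z hh K M n) t x)
      (gridChaosH hν hN r y z hh K M (n + 1) t x) := by
  classical
  have hA := (gridChaos_aux (r := r) (y := y) (z := z) hν hN hh K M n).2
  set Y : ℤ × ℤ × ℤ → Ω → ℝ := fun c ω => waveG (t - c.1 * h) (x - c.2.1 * h) * (c.2.2 * h) *
    gridChaos N ν r y z h K M n (c.1 * h) (c.2.1 * h) ω with hYdef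
  have hYa : ∀ c : ℤ × ℤ × ℤ, AdaptedAt P N ν (c.1 * h) (Y c) :=
    fun c => (hA c.1 (c.2.1 * h)).const_mul _
  have hY : ∀ c, MemLp (Y c) 2 P := fun c => (memLp_gridChaos hν hN hh K M n _ _).const_mul _
  have hR : ∀ c ∈ gridIdx K M, FiniteRect ν (spaceCell h c.2.1) (jumpCell h c.2.2) :=
    fun c hc => finiteRect_cell hν hh (mem_gridIdx.1 hc).2.2.1 c.2.1
  have hX : ∀ c : gridIdx K M, MemLp (fun ω => Y c ω * compensated N ν (cell h c) ω) 2 P :=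
    fun c => (hYa c).memLp_mul_compensated hN (hY c) ((hR c c.2).measurableSet measurableSet_Ioc)
      ((hR c c.2).intensity_lt_top (by simp)) (Ioc_prod_subset_Ioi le_rfl _)
  have hbox := ItoRel.sum (P := P) (N := N) (ν := ν) Finset.univ (V := fun (c : gridIdx K M) =>
    (cell h c).indicator fun _ => (hY c).toLp (Y c)) (X := fun c => (hX c).toLp _) (fun c _ => by
      have h1 : (1 : ℝ) ≤ c.1.1 := by exact_mod_cast (mem_gridIdx.1 c.2).1.1
      exact ItoRel.box (by positivity) (by gcongr; linarith) (hR c c.2) (hYa c) (hY c) (hX c))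
  convert hbox using 1
  · funext ξ
    rw [Finset.sum_coe_sort (gridIdx K M) (fun c => (cell h c).indicator
      (fun _ => (hY c).toLp (Y c)) ξ), sum_indicator_cell hh, gridIntegrand]
    split_ifs with hc
    · rw [Lp.ext_iff]
      filter_upwards [(hY (cellIdx h ξ)).coeFn_toLp, Lp.coeFn_smul (waveG
        (t - timeIdx h ξ.1 * h) (x - spaceIdx h ξ.2.1 * h) * (jumpIdx h ξ.2.2 * h))
        (gridChaosH hν hN r y z hh K M n (timeIdx h ξ.1 * h) (spaceIdx h ξ.2.1 * h)),
        (memLp_gridChaos (r := r) (y := y) (z := z) hν hN hh K M n (timeIdx h ξ.1 * h)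
        (spaceIdx h ξ.2.1 * h)).coeFn_toLp] with ω e1 e2 e3
      rw [e1, e2, Pi.smul_apply, gridChaosH, e3, smul_eq_mul]
      rfl
    · rfl
  · rw [Lp.ext_iff]
    refine (MemLp.coeFn_toLp _).trans ?_
    have h2 : ∀ᵐ ω ∂P, ∀ c : gridIdx K M, (hX c).toLp _ ω = Y c ω * compensated N ν (cell h c) ω :=
      ae_all_iff.2 fun c => (hX c).coeFn_toLp
    filter_upwards [h2, Lp.coeFn_finsetSum Finset.univ (fun c => (hX c).toLp _)] with ω h3 h4
    rw [h4, Finset.sum_apply]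
    simp only [h3]
    rw [Finset.sum_coe_sort (gridIdx K M) (fun c => Y c ω * compensated N ν (cell h c) ω)]
    rfl

/-- Space translation preserves the intensity, so bounds obtained from the majorant are uniform in
x. -/
theorem eLpNorm_coneMajorant (C R x : ℝ) :
    eLpNorm (coneMajorant C R x) 2 (intensity ν) = eLpNorm (coneMajorant C R 0) 2 (intensity ν) := by
  have hmp : MeasurePreserving (fun ξ : Pt => (ξ.1, ξ.2.1 + x, ξ.2.2)) (intensity ν)
      (intensity ν) :=
    (MeasurePreserving.id _).prod ((measurePreserving_add_right volume x).prod
      (MeasurePreserving.id ν))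
  have hm : Measurable (coneMajorant C R x) := by
    refine Measurable.const_mul (Measurable.mul ?_ (Measurable.mul ?_ ?_)) C
    · exact (measurable_const.indicator measurableSet_Icc).comp measurable_fst
    · exact (measurable_const.indicator measurableSet_Icc).comp
        (measurable_fst.comp measurable_snd)
    · fun_prop
  rw [← eLpNorm_comp_measurePreserving hm.aestronglyMeasurable hmp]
  congr 1
  funext ξ
  simp only [Function.comp_def, coneMajorant, Set.indicator_apply, Set.mem_Icc]
  congr 3
  congr 1
  apply propext
  constructor <;> rintro ⟨h1, h2⟩ <;> constructor <;> linarith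

theorem coneMajorant_nonneg {C : ℝ} (hC : 0 ≤ C) (R x : ℝ) (ξ : Pt) : 0 ≤ coneMajorant C R x ξ := by
  unfold coneMajorant
  refine mul_nonneg hC (mul_nonneg ?_ (mul_nonneg ?_ (abs_nonneg _))) <;>
  exact Set.indicator_nonneg (fun _ _ => zero_le_one) _

theorem norm_gridIntegrand_le {h t x T x' C : ℝ} (hh : 0 < h) (h1 : h ≤ 1) {K M : ℕ}
    (ht : t ≤ T) (hx : |x - x'| ≤ 1) (hC : 0 ≤ C) {u : ℝ → ℝ → HSp P}
    (hu : ∀ s w, s ≤ T → ‖u s w‖ ≤ C) (ξ : Pt) :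
    ‖gridIntegrand h K M u t x ξ‖ ≤ coneMajorant C (T + 2) x' ξ := by
  rw [gridIntegrand]
  split_ifs with hc
  · exact norm_corner_le hh h1 hc ht hx hC fun hlt => hu _ _ (hlt.le.trans ht)
  · rw [norm_zero]; exact coneMajorant_nonneg hC _ _ _

/-- The constant precedes the mesh, the extents and the evaluation point: the convergence proof
needs one majorant along the whole sequence of grids. -/
theorem exists_norm_gridChaosH_le (hν : levyMoment ν 2 < ∞)
    (hN : IsPoissonRandomMeasure P N (intensity ν)) (r y z T : ℝ) (n : ℕ) :
    ∃ C : ℝ, 0 ≤ C ∧ ∀ {h : ℝ} (hh : 0 < h), h ≤ 1 → ∀ (K M : ℕ) (t x : ℝ), t ≤ T →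
      ‖gridChaosH hν hN r y z hh K M n t x‖ ≤ C := by
  induction n with
  | zero =>
    refine ⟨|z|, abs_nonneg z, fun {h} hh _ K M t x _ => ?_⟩
    have : gridChaosH hν hN r y z hh K M 0 t x = Lp.const 2 P (waveG (t - r) (x - y) * z) := by
      rw [Lp.ext_iff]
      exact (MemLp.coeFn_toLp _).trans (Lp.coeFn_const ..).symm
    rw [this, norm_const_HSp, abs_mul, abs_of_nonneg (waveG_nonneg _ _)]
    nlinarith [waveG_le (t - r) (x - y), abs_nonneg z]
  | succ n ih =>
    obtain ⟨C, hC0, hC⟩ := ih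
    have hfin := (memLp_coneMajorant (ν := ν) hν C (T + 2) 0).2
    refine ⟨(eLpNorm (coneMajorant C (T + 2) 0) 2 (intensity ν)).toReal, ENNReal.toReal_nonneg,
      fun {h} hh h1 K M t x ht => ?_⟩
    rw [← toReal_enorm]
    refine ENNReal.toReal_mono hfin.ne ?_
    rw [(itoRel_gridChaosH hν hN hh K M n t x).enorm_eq hN, ← eLpNorm_coneMajorant C (T + 2) x]
    refine eLpNorm_mono_real fun ξ => ?_
    exact norm_gridIntegrand_le hh h1 ht (by simp) hC0 (fun s w hs => hC hh h1 K M s w hs) ξ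

/-- The discrete chaos terms converge to the Picard differences. -/
theorem tendsto_gridChaosH (h0 : ν {0} = 0) (hν : levyMoment ν 2 < ∞)
    (hN : IsPoissonRandomMeasure P N (intensity ν)) (g : GridSeq)
    (hK : Tendsto (fun k => (g.K k + 1) * g.h k) atTop atTop) (r y z : ℝ) (n : ℕ) :
    ∀ t x, (n = 0 → |x - y| ≠ t - r) → ∀ τ χ : ℕ → ℝ, Tendsto τ atTop (𝓝 t) →
      Tendsto χ atTop (𝓝 x) →
      Tendsto (fun k => gridChaosH hν hN r y z (g.pos k) (g.K k) (g.M k) n (τ k) (χ k)) atTop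
        (𝓝 (picardTerm P N ν r y z n t x)) := by
  -- The evaluation points move with k because the recursion samples the previous chaos at corners,
  -- which depend on the grid. Only order 0 is discontinuous, hence the condition at n = 0.
  induction n with
  | zero =>
    intro t x hne τ χ hτ hχ
    have : ∀ k, gridChaosH hν hN r y z (g.pos k) (g.K k) (g.M k) 0 (τ k) (χ k) =
        Lp.const 2 P (waveG (τ k - r) (χ k - y) * z) := by
      intro k
      rw [Lp.ext_iff]
      exact (MemLp.coeFn_toLp _).trans (Lp.coeFn_const ..).symm
    simp only [this]
    have h1 : ContinuousAt (fun q : ℝ × ℝ => waveG q.1 q.2) (t - r, x - y) :=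
      continuousAt_waveG (hne rfl)
    have h2 : Tendsto (fun k => waveG (τ k - r) (χ k - y) * z) atTop
        (𝓝 (waveG (t - r) (x - y) * z)) :=
      (h1.tendsto.comp ((hτ.sub_const r).prodMk_nhds (hχ.sub_const y))).mul_const z
    exact ((Lp.constL 2 P ℝ).continuous.tendsto _).comp h2
  | succ n ih =>
    intro t x _ τ χ hτ hχ
    obtain ⟨C, hC0, hC⟩ := exists_norm_gridChaosH_le hν hN r y z (t + 1) n
    have hrel := fun k => itoRel_gridChaosH (r := r) (y := y) (z := z) hν hN (g.pos k) (g.K k)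
      (g.M k) n (τ k) (χ k)
    have hdom := tendsto_eLpNorm_two_of_dominated' (f := fun k => gridIntegrand (g.h k) (g.K k)
      (g.M k) (gridChaosH hν hN r y z (g.pos k) (g.K k) (g.M k) n) (τ k) (χ k))
      (F := waveIntegrand (picardTerm P N ν r y z n) t x)
      (memLp_coneMajorant hν C (t + 1 + 2) x) (fun k => (hrel k).1.1) (by
        filter_upwards [hτ.eventually_le_const (lt_add_one t),
          (tendsto_iff_norm_sub_tendsto_zero.1 hχ).eventually_le_const one_pos] with k h1 h2
        refine ae_of_all _ fun ξ => ?_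
        exact norm_gridIntegrand_le (g.pos k) (g.le_one k) h1 h2 hC0
          (fun s w hs => hC (g.pos k) (g.le_one k) _ _ s w hs) ξ) (by
        filter_upwards [ae_intensity_pos (ν := ν), ae_intensity_jump_ne_zero h0,
          ae_intensity_abs_ne (ν := ν) (g := fun s => t - s) (by fun_prop) x,
          ae_intensity_abs_ne (ν := ν) (g := fun s => s - r) (by fun_prop) y] with ξ h1 h2 h3 h4
        exact tendsto_corner_smul g hτ hχ (ih ξ.1 ξ.2.1 (fun _ => h4) _ _
          (g.tendsto_corner_fst ξ.1) (g.tendsto_corner_snd ξ.2.1)) h1 h2 h3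
          (fun _ => hK.eventually_ge_atTop _))
    obtain ⟨X', hX', hlim⟩ := ItoRel.exists_of_tendsto hN hrel hdom.1 hdom.2
    rwa [(itoRel_picardTerm h0 hν hN r y z n t x).unique hN hX']

/-- Grids exhausting `(0, ∞) × ℝ × (ℝ \ {0})`. -/
noncomputable def fullGrid : GridSeq where
  h k := 1 / (k + 1)
  -- With mesh 1/(k + 1), the square makes all extents at least k + 1.
  K k := (k + 1) ^ 2
  M k := (k + 1) ^ 2
  pos k := by positivity
  le_one k := by
    rw [div_le_one (by positivity)]
    linarith [(Nat.cast_nonneg k : (0 : ℝ) ≤ k)]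
  tendsto_h := tendsto_one_div_add_atTop_nhds_zero_nat
  tendsto_M := by
    refine tendsto_atTop_mono (fun k => ?_) tendsto_natCast_atTop_atTop
    push_cast
    have : ((k : ℝ) + 1) ^ 2 * (1 / (k + 1)) = k + 1 := by field_simp
    rw [this]; linarith

theorem fullGrid_tendsto_K :
    Tendsto (fun k => (fullGrid.K k + 1) * fullGrid.h k) atTop atTop := by
  refine tendsto_atTop_mono (fun k => ?_) tendsto_natCast_atTop_atTop
  simp only [fullGrid]
  push_cast
  have : (((k : ℝ) + 1) ^ 2 + 1) * (1 / (k + 1)) = k + 1 + 1 / (k + 1) := by field_simp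
  rw [this]
  have : (0 : ℝ) ≤ 1 / (k + 1) := by positivity
  linarith

end DiscreteChaos

end LevyWave

namespace LevyWave

/-! ### Step kernels and multiple integrals. -/

section ChaosKernel

/-- The factors G force each time below the next, and the triangle inequality chains the cones.
Distinct times yield vanishing on diagonals; the cone yields the L² majorant. -/
theorem chaosKernel_support {r y z : ℝ} {n : ℕ} : ∀ {t x : ℝ} {ξ : Fin n → Pt},
    chaosKernel r y z n t x ξ ≠ 0 → StrictMono (fun j => (ξ j).1) ∧
      ∀ j, |x - (ξ j).2.1| < t - (ξ j).1 := by
  induction n with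
  | zero => intro t x ξ _; exact ⟨fun i => i.elim0, fun i => i.elim0⟩
  | succ n ih =>
    intro t x ξ hne
    rw [chaosKernel] at hne
    obtain ⟨h1, h2⟩ := ih (right_ne_zero_of_mul hne)
    have h3 : |x - (ξ (Fin.last n)).2.1| < t - (ξ (Fin.last n)).1 := by
      by_contra hG
      rw [waveG, if_neg hG] at hne
      simp at hne
    have h4 : ∀ j : Fin n, (ξ j.castSucc).1 < (ξ (Fin.last n)).1 := fun j => by
      have := (abs_nonneg _).trans_lt (h2 j)
      simp only [Fin.init] at this
      linarith
    constructor
    · intro i j hij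
      rcases Fin.eq_castSucc_or_eq_last j with ⟨j', rfl⟩ | rfl
      · have hi : i ≠ Fin.last n := (hij.trans_le (Fin.le_last _)).ne
        obtain ⟨i', rfl⟩ := Fin.exists_castSucc_eq.2 hi
        exact h1 (Fin.castSucc_lt_castSucc_iff.1 hij)
      · obtain ⟨i', rfl⟩ := Fin.exists_castSucc_eq.2 hij.ne
        exact h4 i'
    · intro j
      rcases Fin.eq_castSucc_or_eq_last j with ⟨j', rfl⟩ | rfl
      · have h5 := h2 j'
        simp only [Fin.init] at h5
        have := abs_sub_le x (ξ (Fin.last n)).2.1 (ξ j'.castSucc).2.1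
        linarith
      · exact h3

theorem abs_chaosKernel_le (r y z : ℝ) (n : ℕ) : ∀ (t x : ℝ) (ξ : Fin n → Pt),
    |chaosKernel r y z n t x ξ| ≤ |z| * ∏ j, |(ξ j).2.2| := by
  have hG : ∀ s w : ℝ, |waveG s w| ≤ 1 := fun s w => by
    rw [abs_of_nonneg (waveG_nonneg _ _)]
    exact (waveG_le s w).trans (by norm_num)
  induction n with
  | zero =>
    intro t x ξ
    rw [chaosKernel, abs_mul]
    simp only [Finset.univ_eq_empty, Finset.prod_empty, mul_one]
    exact mul_le_of_le_one_left (abs_nonneg z) (hG _ _)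
  | succ n ih =>
    intro t x ξ
    rw [chaosKernel, abs_mul, abs_mul, Fin.prod_univ_castSucc]
    have h1 := ih (ξ (Fin.last n)).1 (ξ (Fin.last n)).2.1 (Fin.init ξ)
    simp only [Fin.init] at h1
    calc _ ≤ (1 * |(ξ (Fin.last n)).2.2|) * (|z| * ∏ j : Fin n, |(ξ j.castSucc).2.2|) := by
          gcongr
          exact hG _ _
      _ = _ := by ring

/-- Expansion of the sum over all chains of points. -/
theorem sum_chaosKernel_succ (r y z : ℝ) {m : ℕ} (Q : Fin m → Pt) (a : Fin m → ℝ) (n : ℕ)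
    (t x : ℝ) :
    ∑ ι : Fin (n + 1) → Fin m, chaosKernel r y z (n + 1) t x (fun j => Q (ι j)) * ∏ j, a (ι j) =
      ∑ i, (waveG (t - (Q i).1) (x - (Q i).2.1) * (Q i).2.2 * ∑ ι : Fin n → Fin m,
        chaosKernel r y z n (Q i).1 (Q i).2.1 (fun j => Q (ι j)) * ∏ j, a (ι j)) * a i := by
  rw [← (Fin.snocEquiv fun _ : Fin (n + 1) => Fin m).sum_comp, Fintype.sum_prod_type]
  refine Finset.sum_congr rfl fun i _ => ?_
  rw [Finset.mul_sum, Finset.sum_mul]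
  refine Finset.sum_congr rfl fun ι _ => ?_
  simp only [Fin.snocEquiv, Equiv.coe_fn_mk, chaosKernel, Fin.snoc_last, Fin.prod_univ_castSucc,
    Fin.snoc_castSucc]
  have : (Fin.init fun j : Fin (n + 1) => Q (Fin.snoc (α := fun _ => Fin m) ι i j)) =
      fun j => Q (ι j) := by
    funext j; simp [Fin.init]
  rw [this]
  ring

variable {ν : Measure ℝ}

/-- The chaos kernel on a grid. -/
noncomputable def gridKernel (hν : levyMoment ν 2 < ∞) [SigmaFinite ν] (r y z : ℝ) {h : ℝ}
    (hh : 0 < h) (K M n : ℕ) (t x : ℝ) : SimpleKernel ν n where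
  m := (gridIdx K M).card
  A i := Set.Ioc (((gridIdx K M).equivFin.symm i).1.1 * h)
    ((((gridIdx K M).equivFin.symm i).1.1 + 1) * h)
  B i := spaceCell h ((gridIdx K M).equivFin.symm i).1.2.1
  C i := jumpCell h ((gridIdx K M).equivFin.symm i).1.2.2
  coeff ι := chaosKernel r y z n t x fun j => cellPt h ((gridIdx K M).equivFin.symm (ι j)).1
  measurableSet_A i := measurableSet_Ioc
  measurableSet_B i := (finiteRect_cell hν hh
    (mem_gridIdx.1 ((gridIdx K M).equivFin.symm i).2).2.2.1 _).measA
  measurableSet_C i := (finiteRect_cell hν hh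
    (mem_gridIdx.1 ((gridIdx K M).equivFin.symm i).2).2.2.1
    (((gridIdx K M).equivFin.symm i).1.2.1)).measΓ
  finite_measure i := (finiteRect_cell hν hh
    (mem_gridIdx.1 ((gridIdx K M).equivFin.symm i).2).2.2.1 _).intensity_lt_top (by simp)
  disjoint i j hij := disjoint_cell hh fun h' =>
    hij ((gridIdx K M).equivFin.symm.injective (Subtype.ext h'))
  -- A repeated cell would repeat a reference time, whereas the kernel requires strictly increasing
  -- times.
  coeff_eq_zero ι hι := by
    by_contra hne
    refine hι fun i j hij => (chaosKernel_support hne).1.injective ?_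
    simp only [hij]

/-- Peeling off the last point of the chain reproduces the recursion of `gridChaos`. This exact
identity is where multiple and iterated integrals meet. -/
theorem gridKernel_integral (hν : levyMoment ν 2 < ∞) [SigmaFinite ν] {Ω : Type*}
    [MeasurableSpace Ω] (N : Ω → Measure Pt) (r y z : ℝ) {h : ℝ}
    (hh : 0 < h) (K M n : ℕ) (ω : Ω) : ∀ t x,
    (gridKernel hν r y z hh K M n t x).integral N ω = gridChaos N ν r y z h K M n t x ω := by
  have hform : ∀ n t x, (gridKernel hν r y z hh K M n t x).integral N ω =
      ∑ ι : Fin n → Fin (gridIdx K M).card, chaosKernel r y z n t x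
        (fun j => cellPt h ((gridIdx K M).equivFin.symm (ι j)).1) *
        ∏ j, compensated N ν (cell h ((gridIdx K M).equivFin.symm (ι j)).1) ω :=
    fun n t x => rfl
  induction n with
  | zero =>
    intro t x
    rw [hform]
    simp [chaosKernel, gridChaos]
  | succ n ih =>
    intro t x
    rw [hform, sum_chaosKernel_succ r y z
      (fun i => cellPt h ((gridIdx K M).equivFin.symm i).1)
      (fun i => compensated N ν (cell h ((gridIdx K M).equivFin.symm i).1) ω), gridChaos,
      ← sum_equivFin_symm (gridIdx K M)]
    refine Finset.sum_congr rfl fun i _ => ?_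
    rw [← hform, ih]
    rfl

/-- Cells are disjoint, so at most one multi-index contributes at a given chain: that of the cells
containing its points. -/
theorem gridKernel_toFun (hν : levyMoment ν 2 < ∞) [SigmaFinite ν] (r y z : ℝ) {h : ℝ}
    (hh : 0 < h) (K M n : ℕ) (t x : ℝ) (ξ : Fin n → Pt) [Decidable (∀ j, cellIdx h (ξ j) ∈ gridIdx K M)] :
    (gridKernel hν r y z hh K M n t x).toFun ξ =
      if ∀ j, cellIdx h (ξ j) ∈ gridIdx K M then
        chaosKernel r y z n t x fun j => cellPt h (cellIdx h (ξ j)) else 0 := by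
  have hform : (gridKernel hν r y z hh K M n t x).toFun ξ =
      ∑ ι : Fin n → Fin (gridIdx K M).card, chaosKernel r y z n t x
        (fun j => cellPt h ((gridIdx K M).equivFin.symm (ι j)).1) *
        ∏ j, (cell h ((gridIdx K M).equivFin.symm (ι j)).1).indicator (fun _ => (1 : ℝ)) (ξ j) :=
    rfl
  have hz : ∀ ι : Fin n → Fin (gridIdx K M).card,
      (¬ ∀ j, cellIdx h (ξ j) = ((gridIdx K M).equivFin.symm (ι j)).1) →
      ∏ j, (cell h ((gridIdx K M).equivFin.symm (ι j)).1).indicator (fun _ => (1 : ℝ)) (ξ j) = 0 := by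
    intro ι hι
    push Not at hι
    obtain ⟨j, hj⟩ := hι
    refine Finset.prod_eq_zero (Finset.mem_univ j) (Set.indicator_of_notMem ?_ _)
    rwa [mem_cell hh]
  rw [hform]
  split_ifs with hall
  · rw [Finset.sum_eq_single fun j => (gridIdx K M).equivFin ⟨_, hall j⟩]
    · simp only [Equiv.symm_apply_apply]
      rw [Finset.prod_eq_one, mul_one]
      intro j _
      rw [Set.indicator_of_mem]
      rw [mem_cell hh]
    · intro ι _ hι
      rw [hz, mul_zero]
      intro hall'
      refine hι (funext fun j => ?_)
      have h1 : (gridIdx K M).equivFin.symm (ι j) = ⟨_, hall j⟩ := Subtype.ext (hall' j).symm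
      rw [← h1, Equiv.apply_symm_apply]
    · simp
  · refine Finset.sum_eq_zero fun ι _ => ?_
    rw [hz, mul_zero]
    intro hall'
    exact hall fun j => (hall' j) ▸ ((gridIdx K M).equivFin.symm (ι j)).2

/-- The chains of points at which the chaos kernel is continuous. -/
def RegularChain (r y : ℝ) : (n : ℕ) → (t x : ℝ) → (Fin n → Pt) → Prop
  | 0, t, x, _ => |x - y| ≠ t - r
  | n + 1, t, x, ξ => (0 < (ξ (Fin.last n)).1 ∧ (ξ (Fin.last n)).2.2 ≠ 0 ∧
      |(ξ (Fin.last n)).2.1 - x| ≠ t - (ξ (Fin.last n)).1) ∧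
      RegularChain r y n (ξ (Fin.last n)).1 (ξ (Fin.last n)).2.1 (Fin.init ξ)

theorem RegularChain.pos_and_ne {r y : ℝ} {n : ℕ} : ∀ {t x : ℝ} {ξ : Fin n → Pt},
    RegularChain r y n t x ξ → ∀ j, 0 < (ξ j).1 ∧ (ξ j).2.2 ≠ 0 := by
  induction n with
  | zero => intro t x ξ _ j; exact j.elim0
  | succ n ih =>
    intro t x ξ h j
    rcases Fin.eq_castSucc_or_eq_last j with ⟨j', rfl⟩ | rfl
    · exact ih h.2 j'
    · exact ⟨h.1.1, h.1.2.1⟩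

theorem RegularChain.tendsto {r y z : ℝ} {n : ℕ} : ∀ {t x : ℝ} {ξ : Fin n → Pt},
    RegularChain r y n t x ξ → ∀ {τ χ : ℕ → ℝ} {η : ℕ → Fin n → Pt}, Tendsto τ atTop (𝓝 t) →
    Tendsto χ atTop (𝓝 x) → Tendsto η atTop (𝓝 ξ) →
    Tendsto (fun k => chaosKernel r y z n (τ k) (χ k) (η k)) atTop
      (𝓝 (chaosKernel r y z n t x ξ)) := by
  induction n with
  | zero =>
    intro t x ξ h τ χ η hτ hχ _
    have h1 : ContinuousAt (fun q : ℝ × ℝ => waveG q.1 q.2) (t - r, x - y) := continuousAt_waveG h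
    exact (h1.tendsto.comp ((hτ.sub_const r).prodMk_nhds (hχ.sub_const y))).mul_const z
  | succ n ih =>
    intro t x ξ h τ χ η hτ hχ hη
    have hl := tendsto_pi_nhds.1 hη (Fin.last n)
    have hl1 : Tendsto (fun k => (η k (Fin.last n)).1) atTop (𝓝 (ξ (Fin.last n)).1) :=
      (continuous_fst.tendsto _).comp hl
    have hl2 : Tendsto (fun k => (η k (Fin.last n)).2.1) atTop (𝓝 (ξ (Fin.last n)).2.1) :=
      ((continuous_fst.comp continuous_snd).tendsto _).comp hl
    have hl3 : Tendsto (fun k => (η k (Fin.last n)).2.2) atTop (𝓝 (ξ (Fin.last n)).2.2) :=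
      ((continuous_snd.comp continuous_snd).tendsto _).comp hl
    have hi : Tendsto (fun k => Fin.init (η k)) atTop (𝓝 (Fin.init ξ)) :=
      tendsto_pi_nhds.2 fun j => tendsto_pi_nhds.1 hη j.castSucc
    have h1 : ContinuousAt (fun q : ℝ × ℝ => waveG q.1 q.2)
        (t - (ξ (Fin.last n)).1, x - (ξ (Fin.last n)).2.1) :=
      continuousAt_waveG (by simpa [abs_sub_comm] using h.1.2.2)
    have h2 := h1.tendsto.comp ((hτ.sub hl1).prodMk_nhds (hχ.sub hl2))
    exact (h2.mul hl3).mul (ih h.2 hl1 hl2 hi)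

theorem measurableSet_regularChain (r y : ℝ) (n : ℕ) :
    MeasurableSet {q : ℝ × ℝ × (Fin n → Pt) | RegularChain r y n q.1 q.2.1 q.2.2} := by
  induction n with
  | zero =>
    simp only [RegularChain]
    exact (measurableSet_eq_fun (by fun_prop) (by fun_prop)).compl
  | succ n ih =>
    have hl : Measurable fun q : ℝ × ℝ × (Fin (n + 1) → Pt) => q.2.2 (Fin.last n) := by fun_prop
    simp only [RegularChain]
    refine MeasurableSet.inter (MeasurableSet.inter ?_ (MeasurableSet.inter ?_ ?_)) ?_
    · exact measurableSet_lt measurable_const hl.fst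
    · exact (measurableSet_eq_fun hl.snd.snd measurable_const).compl
    · refine (measurableSet_eq_fun ?_ ?_).compl
      · exact (hl.snd.fst.sub (by fun_prop)).abs
      · exact Measurable.sub (by fun_prop) hl.fst
    · have hm : Measurable fun q : ℝ × ℝ × (Fin (n + 1) → Pt) =>
          ((q.2.2 (Fin.last n)).1, (q.2.2 (Fin.last n)).2.1, Fin.init q.2.2) := by
        refine hl.fst.prodMk (hl.snd.fst.prodMk (measurable_pi_lambda _ fun j => ?_))
        simp only [Fin.init]
        fun_prop
      exact hm ih

/-- Fubini, peeling off the last point: almost every choice of it is off both cone boundaries, so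
the induction hypothesis applies with the new endpoint. For n = 0 no integration is left to discard
the cone, hence the condition. -/
theorem ae_regularChain [SigmaFinite ν] (h0 : ν {0} = 0) (r y : ℝ) (n : ℕ) :
    ∀ t x, (n = 0 → |x - y| ≠ t - r) →
    ∀ᵐ ξ ∂(Measure.pi fun _ : Fin n => intensity ν), RegularChain r y n t x ξ := by
  induction n with
  | zero => intro t x h; exact ae_of_all _ fun _ => h rfl
  | succ n ih =>
    intro t x _
    have hmp := measurePreserving_piFinSuccAbove (fun _ : Fin (n + 1) => intensity ν) (Fin.last n)
    have key : ∀ᵐ q ∂(intensity ν).prod (Measure.pi fun _ : Fin n => intensity ν),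
        (0 < q.1.1 ∧ q.1.2.2 ≠ 0 ∧ |q.1.2.1 - x| ≠ t - q.1.1) ∧
          RegularChain r y n q.1.1 q.1.2.1 q.2 := by
      have hm : MeasurableSet {q : Pt × (Fin n → Pt) |
          (0 < q.1.1 ∧ q.1.2.2 ≠ 0 ∧ |q.1.2.1 - x| ≠ t - q.1.1) ∧
          RegularChain r y n q.1.1 q.1.2.1 q.2} := by
        refine MeasurableSet.inter (MeasurableSet.inter ?_ (MeasurableSet.inter ?_ ?_)) ?_
        · exact measurableSet_lt measurable_const measurable_fst.fst
        · exact (measurableSet_eq_fun measurable_fst.snd.snd measurable_const).compl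
        · exact (measurableSet_eq_fun (by fun_prop) (by fun_prop)).compl
        · have : Measurable fun q : Pt × (Fin n → Pt) => (q.1.1, q.1.2.1, q.2) := by fun_prop
          exact this (measurableSet_regularChain r y n)
      refine (Measure.ae_prod_mem_iff_ae_ae_mem hm).2 ?_
      filter_upwards [ae_intensity_pos (ν := ν), ae_intensity_jump_ne_zero h0,
        ae_intensity_abs_ne (ν := ν) (g := fun s => t - s) (by fun_prop) x,
        ae_intensity_abs_ne (ν := ν) (g := fun s => s - r) (by fun_prop) y] with ξ h1 h2 h3 h4
      filter_upwards [ih ξ.1 ξ.2.1 fun _ => h4] with η hη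
      exact ⟨⟨h1, h2, h3⟩, hη⟩
    have := hmp.quasiMeasurePreserving.ae key
    filter_upwards [this] with ξ hξ
    refine ⟨hξ.1, ?_⟩
    have e : Fin.init ξ =
        ((MeasurableEquiv.piFinSuccAbove (fun _ => Pt) (Fin.last n)) ξ).2 := by
      funext j
      simp [MeasurableEquiv.piFinSuccAbove, Fin.insertNthEquiv, Fin.init]
    rw [e]
    exact hξ.2

theorem memLp_prod_coneMajorant [SigmaFinite ν] (hν : levyMoment ν 2 < ∞) (z R x : ℝ) (n : ℕ) :
    MemLp (fun ξ : Fin n → Pt => |z| * ∏ j, coneMajorant 1 R x (ξ j)) 2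
      (Measure.pi fun _ : Fin n => intensity ν) := by
  have h1 := memLp_coneMajorant (ν := ν) hν 1 R x
  have hi : Integrable (fun ξ : Fin n → Pt => ∏ j, coneMajorant 1 R x (ξ j) ^ 2)
      (Measure.pi fun _ : Fin n => intensity ν) :=
    Integrable.fintype_prod (f := fun _ ξ => coneMajorant 1 R x ξ ^ 2) fun _ => h1.integrable_sq
  refine MemLp.const_mul ?_ _
  have hm : Measurable (coneMajorant 1 R x) := by
    refine Measurable.const_mul (Measurable.mul ?_ (Measurable.mul ?_ ?_)) 1
    · exact (measurable_const.indicator measurableSet_Icc).comp measurable_fst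
    · exact (measurable_const.indicator measurableSet_Icc).comp
        (measurable_fst.comp measurable_snd)
    · fun_prop
  have hmm : Measurable (fun ξ : Fin n → Pt => ∏ j, coneMajorant 1 R x (ξ j)) :=
    Finset.measurable_prod _ fun j _ => hm.comp (measurable_pi_apply j)
  rw [memLp_two_iff_integrable_sq hmm.aestronglyMeasurable]
  simpa only [Finset.prod_pow] using hi

theorem measurable_simpleKernel_toFun {n : ℕ} (h : SimpleKernel ν n) : Measurable h.toFun := by
  refine Finset.measurable_sum _ fun ι _ => Measurable.const_mul
    (Finset.measurable_prod _ fun j _ => ?_) _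
  have : MeasurableSet (h.box (ι j)) :=
    (h.measurableSet_A _).prod ((h.measurableSet_B _).prod (h.measurableSet_C _))
  exact (measurable_const.indicator this).comp (measurable_pi_apply j)

/-- Where the discretised kernel does not vanish, every corner lies in the backward cone of (t,x),
so the product of cone majorants dominates. Pointwise convergence holds at regular chains. -/
theorem gridKernel_tendsto [SigmaFinite ν] (h0 : ν {0} = 0) (hν : levyMoment ν 2 < ∞) (g : GridSeq)
    (hK : Tendsto (fun k => (g.K k + 1) * g.h k) atTop atTop) (r y z : ℝ) {n : ℕ} (hn : n ≠ 0)
    (t x : ℝ) :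
    MemLp (chaosKernel r y z n t x) 2 (Measure.pi fun _ : Fin n => intensity ν) ∧
    Tendsto (fun k => eLpNorm (fun ξ => (gridKernel hν r y z (g.pos k) (g.K k) (g.M k) n t x).toFun ξ
      - chaosKernel r y z n t x ξ) 2 (Measure.pi fun _ : Fin n => intensity ν)) atTop (𝓝 0) := by
  classical
  refine tendsto_eLpNorm_two_of_dominated (memLp_prod_coneMajorant hν z (t + 2) x n)
    (fun k => (measurable_simpleKernel_toFun _).aestronglyMeasurable)
    (fun k => ae_of_all _ fun ξ => ?_) ?_
  · rw [gridKernel_toFun]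
    have hpos : 0 ≤ |z| * ∏ j, coneMajorant 1 (t + 2) x (ξ j) :=
      mul_nonneg (abs_nonneg z) (Finset.prod_nonneg fun j _ => coneMajorant_nonneg zero_le_one _ _ _)
    split_ifs with hall
    · by_cases hne : chaosKernel r y z n t x (fun j => cellPt (g.h k) (cellIdx (g.h k) (ξ j))) = 0
      · rw [hne, norm_zero]; exact hpos
      · refine (abs_chaosKernel_le r y z n t x _).trans ?_
        gcongr with j
        have hc := (chaosKernel_support hne).2 j
        simp only [cellPt, cellIdx] at hc ⊢
        have hp := g.pos k
        have hle := g.le_one k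
        have a1 := timeIdx_mul_lt hp (ξ j).1
        have a2 := le_timeIdx_mul hp (ξ j).1
        have a3 := spaceIdx_mul_le hp (ξ j).2.1
        have a4 := lt_spaceIdx_mul hp (ξ j).2.1
        have a5 : (1 : ℝ) ≤ timeIdx (g.h k) (ξ j).1 := by
          exact_mod_cast (mem_gridIdx.1 (hall j)).1.1
        have a6 : 0 < timeIdx (g.h k) (ξ j).1 * g.h k := by positivity
        have a7 := (abs_nonneg _).trans_lt hc
        rw [abs_lt] at hc
        have m1 : (ξ j).1 ∈ Set.Icc 0 (t + 2) := ⟨by linarith, by linarith⟩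
        have m2 : (ξ j).2.1 ∈ Set.Icc (x - (t + 2)) (x + (t + 2)) := ⟨by linarith, by linarith⟩
        rw [coneMajorant, Set.indicator_of_mem m1, Set.indicator_of_mem m2, one_mul, one_mul,
          one_mul]
        exact abs_jumpIdx_mul_le hp _
    · rw [norm_zero]; exact hpos
  · filter_upwards [ae_regularChain (ν := ν) h0 r y n t x (fun h => absurd h hn)] with ξ hξ
    have h1 : ∀ᶠ k in atTop, ∀ j, cellIdx (g.h k) (ξ j) ∈ gridIdx (g.K k) (g.M k) :=
      eventually_all.2 fun j => g.eventually_mem_gridIdx (hξ.pos_and_ne j).1 (hξ.pos_and_ne j).2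
        (hK.eventually_ge_atTop _)
    have h2 : Tendsto (fun k j => cellPt (g.h k) (cellIdx (g.h k) (ξ j))) atTop (𝓝 ξ) :=
      tendsto_pi_nhds.2 fun j => g.tendsto_corner (ξ j)
    refine (hξ.tendsto (z := z) tendsto_const_nhds tendsto_const_nhds h2).congr' ?_
    filter_upwards [h1] with k hk
    rw [gridKernel_toFun, if_pos hk]

/-- The Picard differences are multiple integrals of the chaos kernels. -/
theorem isMultipleIntegral_picardTerm {Ω : Type*} [MeasurableSpace Ω] {P : Measure Ω}
    [IsProbabilityMeasure P] {N : Ω → Measure Pt} [SigmaFinite ν] (h0 : ν {0} = 0)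
    (hν : levyMoment ν 2 < ∞) (hN : IsPoissonRandomMeasure P N (intensity ν)) (r y z : ℝ) {n : ℕ}
    (hn : n ≠ 0) (t x : ℝ) :
    IsMultipleIntegral P N ν n (chaosKernel r y z n t x) (picardTerm P N ν r y z n t x) := by
  obtain ⟨h1, h2⟩ := gridKernel_tendsto (ν := ν) h0 hν fullGrid fullGrid_tendsto_K r y z hn t x
  refine ⟨h1, Lp.memLp _, fun k => gridKernel hν r y z (fullGrid.pos k) (fullGrid.K k)
    (fullGrid.M k) n t x, ?_, ?_⟩
  · refine h2.congr fun k => ?_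
    rw [← eLpNorm_neg]
    congr 1
    funext ξ
    simp
  · have h3 := tendsto_gridChaosH (P := P) h0 hν hN fullGrid fullGrid_tendsto_K r y z n t x
      (fun h => absurd h hn) _ _ (tendsto_const_nhds (x := t)) (tendsto_const_nhds (x := x))
    rw [Lp.tendsto_Lp_iff_tendsto_eLpNorm'] at h3
    refine h3.congr fun k => ?_
    rw [← eLpNorm_neg]
    refine eLpNorm_congr_ae ?_
    filter_upwards [(memLp_gridChaos (r := r) (y := y) (z := z) hν hN (fullGrid.pos k)
      (fullGrid.K k) (fullGrid.M k) n t x).coeFn_toLp] with ω hω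
    rw [gridKernel_integral]
    simp only [Pi.neg_apply, Pi.sub_apply, gridChaosH, hω, neg_sub]

end ChaosKernel

end LevyWave

namespace LevyWave

/-! ### Predictable versions of continuous adapted fields. -/

section Predictable

variable {Ω : Type*} [mΩ : MeasurableSpace Ω] {P : Measure Ω} {N : Ω → Measure Pt} {ν : Measure ℝ}

theorem predictableSigma_le (hN : IsPoissonRandomMeasure P N (intensity ν)) :
    predictableSigma P N ν ≤ (inferInstance : MeasurableSpace (Pt × Ω)) := by
  refine MeasurableSpace.generateFrom_le ?_
  rintro _ ⟨a, b, A, Γ, S, -, -, hA, hΓ, -, -, hS, rfl⟩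
  exact (measurableSet_Ioc.prod (hA.prod hΓ)).prod (noiseSigma_le hN a S hS)

variable [SigmaFinite ν]

/-- Exhaustion by bounded positions and by `spanningSets ν` removes the finiteness conditions on the
generators. -/
theorem measurableSet_predictable_Ioc {a b : ℝ} (ha : 0 < a) (hab : a < b) {A Γ : Set ℝ}
    (hA : MeasurableSet A) (hΓ : MeasurableSet Γ) {S : Set Ω}
    (hS : MeasurableSet[noiseSigma P N ν a] S) :
    MeasurableSet[predictableSigma P N ν] ((Set.Ioc a b ×ˢ A ×ˢ Γ) ×ˢ S) := by
  have h1 : (Set.Ioc a b ×ˢ A ×ˢ Γ) ×ˢ S = ⋃ n : ℕ, (Set.Ioc a b ×ˢ (A ∩ Set.Icc (-(n : ℝ)) n) ×ˢ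
      (Γ ∩ spanningSets ν n)) ×ˢ S := by
    ext ⟨⟨s, y, ζ⟩, ω⟩
    simp only [Set.mem_prod, Set.mem_iUnion, Set.mem_inter_iff]
    constructor
    · rintro ⟨⟨h1, h2, h3⟩, h4⟩
      obtain ⟨n, hn⟩ := exists_nat_ge |y|
      have h5 : ζ ∈ ⋃ i, spanningSets ν i := by rw [iUnion_spanningSets]; trivial
      obtain ⟨m, hm⟩ := Set.mem_iUnion.1 h5
      refine ⟨max n m, ⟨h1, ⟨h2, ?_⟩, h3, monotone_spanningSets ν (le_max_right n m) hm⟩, h4⟩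
      have : (n : ℝ) ≤ (max n m : ℕ) := by exact_mod_cast le_max_left n m
      exact abs_le.1 (hn.trans this)
    · rintro ⟨n, ⟨h1, ⟨h2, -⟩, h3, -⟩, h4⟩
      exact ⟨⟨h1, h2, h3⟩, h4⟩
  rw [h1]
  refine MeasurableSet.iUnion fun n => MeasurableSpace.measurableSet_generateFrom
    ⟨a, b, _, _, S, ha, hab, hA.inter measurableSet_Icc,
      hΓ.inter (measurableSet_spanningSets ν n), ?_, ?_, hS, rfl⟩
  · exact (measure_mono Set.inter_subset_right).trans_lt (by simp)
  · exact (measure_mono Set.inter_subset_right).trans_lt (measure_spanningSets_lt_top ν n)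

theorem measurableSet_predictable_Ioi {a : ℝ} (ha : 0 ≤ a) {A Γ : Set ℝ}
    (hA : MeasurableSet A) (hΓ : MeasurableSet Γ) :
    MeasurableSet[predictableSigma P N ν] ((Set.Ioi a ×ˢ A ×ˢ Γ) ×ˢ (Set.univ : Set Ω)) := by
  have h1 : (Set.Ioi a ×ˢ A ×ˢ Γ) ×ˢ (Set.univ : Set Ω) = ⋃ n : ℕ,
      (Set.Ioc (a + 1 / (n + 1)) (a + 1 / (n + 1) + (n + 1)) ×ˢ A ×ˢ Γ) ×ˢ Set.univ := by
    ext ⟨⟨s, y, ζ⟩, ω⟩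
    simp only [Set.mem_prod, Set.mem_iUnion, Set.mem_univ, and_true, Set.mem_Ioi, Set.mem_Ioc]
    constructor
    · rintro ⟨h1, h2⟩
      obtain ⟨n, hn⟩ := exists_nat_one_div_lt (sub_pos.2 h1)
      obtain ⟨m, hm⟩ := exists_nat_ge (s - a)
      refine ⟨max n m, ⟨?_, ?_⟩, h2⟩
      · have : (1 : ℝ) / ((max n m : ℕ) + 1) ≤ 1 / (n + 1) := by
          gcongr
          exact le_max_left n m
        linarith
      · have h3 : (m : ℝ) ≤ (max n m : ℕ) := by exact_mod_cast le_max_right n m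
        have h4 : (0 : ℝ) < 1 / ((max n m : ℕ) + 1) := by positivity
        linarith
    · rintro ⟨n, ⟨h1, -⟩, h2⟩
      have h4 : (0 : ℝ) < 1 / ((n : ℝ) + 1) := by positivity
      exact ⟨by linarith, h2⟩
  rw [h1]
  refine MeasurableSet.iUnion fun n => measurableSet_predictable_Ioc ?_ ?_ hA hΓ MeasurableSet.univ
  · positivity
  · have : (0 : ℝ) < n + 1 := by positivity
    linarith

/-- The point `ξ`, set to `0` for non-positive times. -/
noncomputable def positivePart (ξ : Pt) : Pt := if 0 < ξ.1 then ξ else 0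

/-- The predictable σ-algebra does not separate points of non-positive time, so a deterministic
function can be predictable only if it is constant there; collapsing those points to 0 takes care of
this. -/
theorem measurable_positivePart :
    Measurable[predictableSigma P N ν] fun q : Pt × Ω => positivePart q.1 := by
  have hset : ∀ {A B C : Set ℝ}, MeasurableSet A → MeasurableSet B → MeasurableSet C →
      MeasurableSet[predictableSigma P N ν]
        (((Set.Ioi 0 ∩ A) ×ˢ B ×ˢ C) ×ˢ (Set.univ : Set Ω)) := by
    intro A B C hA hB hC
    have hborel : ∀ A : Set ℝ, MeasurableSet A → MeasurableSet[predictableSigma P N ν]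
        (((Set.Ioi 0 ∩ A) ×ˢ B ×ˢ C) ×ˢ (Set.univ : Set Ω)) := by
      intro A hA
      -- Position and jump sets may already be arbitrary Borel sets; only the time coordinate has to
      -- be generated from half lines.
      rw [BorelSpace.measurable_eq (α := ℝ), borel_eq_generateFrom_Ioi ℝ] at hA
      induction A, hA using MeasurableSpace.generateFrom_induction with
      | hC t ht _ =>
        obtain ⟨a, rfl⟩ := ht
        rw [Set.Ioi_inter_Ioi]
        exact measurableSet_predictable_Ioi (le_max_left _ _) hB hC
      | empty => simp
      | compl t _ ih =>
        have : ((Set.Ioi 0 ∩ tᶜ) ×ˢ B ×ˢ C) ×ˢ (Set.univ : Set Ω) =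
            ((Set.Ioi 0 ×ˢ B ×ˢ C) ×ˢ Set.univ) \ (((Set.Ioi 0 ∩ t) ×ˢ B ×ˢ C) ×ˢ Set.univ) := by
          ext ⟨⟨s, y, ζ⟩, ω⟩
          simp only [Set.mem_prod, Set.mem_inter_iff, Set.mem_compl_iff, Set.mem_sdiff]
          tauto
        rw [this]
        exact (measurableSet_predictable_Ioi le_rfl hB hC).diff ih
      | iUnion f _ ih =>
        have : ((Set.Ioi 0 ∩ ⋃ i, f i) ×ˢ B ×ˢ C) ×ˢ (Set.univ : Set Ω) =
            ⋃ i, ((Set.Ioi 0 ∩ f i) ×ˢ B ×ˢ C) ×ˢ (Set.univ : Set Ω) := by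
          ext ⟨⟨s, y, ζ⟩, ω⟩
          simp only [Set.mem_prod, Set.mem_inter_iff, Set.mem_iUnion, Set.mem_univ, and_true]
          constructor
          · rintro ⟨⟨h1, i, h2⟩, h3⟩; exact ⟨i, ⟨h1, h2⟩, h3⟩
          · rintro ⟨i, ⟨h1, h2⟩, h3⟩; exact ⟨⟨h1, i, h2⟩, h3⟩
        rw [this]
        exact MeasurableSet.iUnion ih
    exact hborel A hA
  have hpos : MeasurableSet[predictableSigma P N ν] {q : Pt × Ω | 0 < q.1.1} := by
    convert hset MeasurableSet.univ MeasurableSet.univ MeasurableSet.univ using 1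
    ext ⟨⟨s, y, ζ⟩, ω⟩
    simp
  have hcoord : ∀ {φ : Pt → ℝ}, φ 0 = 0 → (∀ A : Set ℝ, MeasurableSet A →
      MeasurableSet[predictableSigma P N ν] {q : Pt × Ω | 0 < q.1.1 ∧ φ q.1 ∈ A}) →
      Measurable[predictableSigma P N ν] fun q : Pt × Ω => φ (positivePart q.1) := by
    intro φ h0 hφ A hA
    have : (fun q : Pt × Ω => φ (positivePart q.1)) ⁻¹' A =
        {q : Pt × Ω | 0 < q.1.1 ∧ φ q.1 ∈ A} ∪ ({q : Pt × Ω | 0 < q.1.1}ᶜ ∩ {_q | (0 : ℝ) ∈ A}) := by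
      ext q
      simp only [Set.mem_preimage, Set.mem_union, Set.mem_inter_iff, Set.mem_compl_iff,
        Set.mem_ofPred_eq, positivePart]
      split_ifs with h
      · simp [h]
      · simp [h, h0]
    rw [this]
    exact (hφ A hA).union (hpos.compl.inter (MeasurableSet.const _))
  refine Measurable.prodMk (hcoord (φ := fun ξ => ξ.1) rfl fun A hA => ?_) (Measurable.prodMk
    (hcoord (φ := fun ξ => ξ.2.1) rfl fun A hA => ?_)
    (hcoord (φ := fun ξ => ξ.2.2) rfl fun A hA => ?_))
  · convert hset hA MeasurableSet.univ MeasurableSet.univ using 1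
    ext ⟨⟨s, y, ζ⟩, ω⟩
    simp
  · convert hset MeasurableSet.univ hA MeasurableSet.univ using 1
    ext ⟨⟨s, y, ζ⟩, ω⟩
    simp
  · convert hset MeasurableSet.univ MeasurableSet.univ hA using 1
    ext ⟨⟨s, y, ζ⟩, ω⟩
    simp

/-- Deterministic functions that vanish at non-positive times are predictable. -/
theorem isPredictable_of_measurable {f : Pt → ℝ} (hf : Measurable f)
    (h0 : ∀ ξ : Pt, ξ.1 ≤ 0 → f ξ = 0) : IsPredictable P N ν fun ξ _ => f ξ := by
  have : (fun q : Pt × Ω => f q.1) = fun q => f (positivePart q.1) := by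
    funext q
    unfold positivePart
    split_ifs with h
    · rfl
    · rw [h0 _ (not_lt.1 h), h0 0 le_rfl]
  unfold IsPredictable
  rw [this]
  exact hf.comp measurable_positivePart

/-- Step fields with values in the past are predictable. -/
theorem isPredictable_step {h : ℝ} (hh : 0 < h) {Y : ℤ → ℤ → Ω → ℝ}
    (hY : ∀ i j : ℤ, Measurable[noiseSigma P N ν (i * h)] (Y i j)) :
    IsPredictable P N ν fun ξ ω => if 1 ≤ timeIdx h ξ.1 then
      Y (timeIdx h ξ.1) (spaceIdx h ξ.2.1) ω else 0 := by
  have hcell : ∀ (i j : ℤ), 1 ≤ i → ∀ S, MeasurableSet[noiseSigma P N ν (i * h)] S →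
      MeasurableSet[predictableSigma P N ν]
      ((Set.Ioc (i * h) ((i + 1) * h) ×ˢ spaceCell h j ×ˢ (Set.univ : Set ℝ)) ×ˢ S) := by
    intro i j hi S hS
    have : (1 : ℝ) ≤ i := by exact_mod_cast hi
    exact measurableSet_predictable_Ioc (by positivity) (by linarith)
      (measurable_spaceIdx h (measurableSet_singleton j)) MeasurableSet.univ hS
  intro U hU
  have hform : (fun q : Pt × Ω => if 1 ≤ timeIdx h q.1.1 then
      Y (timeIdx h q.1.1) (spaceIdx h q.1.2.1) q.2 else 0) ⁻¹' U =
      (⋃ (i : ℤ) (j : ℤ) (_ : 1 ≤ i), (Set.Ioc (i * h) ((i + 1) * h) ×ˢ spaceCell h j ×ˢ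
        (Set.univ : Set ℝ)) ×ˢ (Y i j ⁻¹' U)) ∪
      ((⋃ (i : ℤ) (j : ℤ) (_ : 1 ≤ i), (Set.Ioc (i * h) ((i + 1) * h) ×ˢ spaceCell h j ×ˢ
        (Set.univ : Set ℝ)) ×ˢ (Set.univ : Set Ω))ᶜ ∩ {_q | (0 : ℝ) ∈ U}) := by
    ext ⟨⟨s, y, ζ⟩, ω⟩
    simp only [Set.mem_preimage, Set.mem_union, Set.mem_iUnion, Set.mem_prod, ← timeIdx_eq_iff hh,
      spaceCell, Set.mem_ofPred_eq, Set.mem_univ, and_true, Set.mem_inter_iff, Set.mem_compl_iff,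
      exists_prop]
    split_ifs with h1
    · constructor
      · intro h2
        exact Or.inl ⟨_, _, h1, ⟨rfl, rfl⟩, h2⟩
      · rintro (⟨i, j, -, ⟨rfl, rfl⟩, h2⟩ | ⟨h2, -⟩)
        · exact h2
        · exact absurd ⟨_, _, h1, rfl, rfl⟩ h2
    · constructor
      · intro h2
        refine Or.inr ⟨?_, h2⟩
        rintro ⟨i, j, h3, h4, -⟩
        exact h1 (h4 ▸ h3)
      · rintro (⟨i, j, h3, ⟨h4, -⟩, -⟩ | ⟨-, h2⟩)
        · exact absurd (h4 ▸ h3) h1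
        · exact h2
  rw [hform]
  refine MeasurableSet.union ?_ (MeasurableSet.inter (MeasurableSet.compl ?_)
    (MeasurableSet.const _))
  · exact MeasurableSet.iUnion fun i => MeasurableSet.iUnion fun j => MeasurableSet.iUnion fun hi =>
      hcell i j hi _ (hY i j hU)
  · exact MeasurableSet.iUnion fun i => MeasurableSet.iUnion fun j => MeasurableSet.iUnion fun hi =>
      hcell i j hi _ MeasurableSet.univ

/-- The squared L² distances are eventually at most 4⁻ᵐ, so the sum of the squared differences has
finite expectation. It is then finite almost surely, and its terms tend to 0. -/
theorem ae_tendsto_of_norm_le {f : ℕ → HSp P} {f' : HSp P}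
    (hf : ∀ᶠ m in atTop, ‖f m - f'‖ ≤ (1 / 2) ^ m) :
    ∀ᵐ ω ∂P, Tendsto (fun m => f m ω) atTop (𝓝 (f' ω)) := by
  obtain ⟨m₀, hm₀⟩ := eventually_atTop.1 hf
  have hm : ∀ m, AEMeasurable (fun ω => ‖(f (m + m₀) - f' : HSp P) ω‖ₑ ^ (2 : ℝ)) P :=
    fun m => (Lp.aestronglyMeasurable (f (m + m₀) - f')).enorm.pow_const 2
  have h1 : ∫⁻ ω, ∑' m, ‖(f (m + m₀) - f' : HSp P) ω‖ₑ ^ (2 : ℝ) ∂P ≠ ∞ := by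
    rw [lintegral_tsum hm]
    have hs : Summable fun m : ℕ => ((1 / 4 : ℝ)) ^ m :=
      summable_geometric_of_lt_one (by norm_num) (by norm_num)
    refine ne_top_of_le_ne_top hs.tsum_ofReal_ne_top (ENNReal.tsum_le_tsum fun m => ?_)
    have e1 : ∫⁻ ω, ‖(f (m + m₀) - f' : HSp P) ω‖ₑ ^ (2 : ℝ) ∂P = ‖f (m + m₀) - f'‖ₑ ^ (2 : ℝ) := by
      rw [Lp.enorm_def, eLpNorm_eq_lintegral_rpow_enorm_toReal (by simp) (by simp),
        ← ENNReal.rpow_mul]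
      norm_num
    rw [e1, ← ofReal_norm, ENNReal.ofReal_rpow_of_nonneg (norm_nonneg _) (by norm_num)]
    refine ENNReal.ofReal_le_ofReal ?_
    rw [Real.rpow_two]
    calc _ ≤ ((1 / 2 : ℝ) ^ (m + m₀)) ^ 2 := by
          gcongr
          exact hm₀ _ (by omega)
      _ ≤ ((1 / 2 : ℝ) ^ m) ^ 2 := by
          gcongr ?_ ^ 2
          exact pow_le_pow_of_le_one (by norm_num) (by norm_num) (by omega)
      _ = (1 / 4 : ℝ) ^ m := by rw [← pow_mul, mul_comm, pow_mul]; norm_num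
  have h2 := ae_lt_top' (AEMeasurable.tsum hm) h1
  have h3 : ∀ᵐ ω ∂P, ∀ m, (f m - f' : HSp P) ω = f m ω - f' ω :=
    ae_all_iff.2 fun m => Lp.coeFn_sub _ _
  filter_upwards [h2, h3] with ω h4 h5
  have h6 := ENNReal.tendsto_atTop_zero_of_tsum_ne_top h4.ne
  have h7 := h6.ennrpow_const (1 / 2)
  rw [← tendsto_add_atTop_iff_nat m₀, tendsto_iff_norm_sub_tendsto_zero]
  have h8 : ∀ m, (‖(f (m + m₀) - f' : HSp P) ω‖ₑ ^ (2 : ℝ)) ^ (1 / 2 : ℝ) =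
      ‖f (m + m₀) ω - f' ω‖ₑ := by
    intro m
    rw [← ENNReal.rpow_mul, h5]
    norm_num
  simp only [h8] at h7
  have h9 := (ENNReal.tendsto_toReal (by simp)).comp h7
  simpa [Function.comp_def] using h9

/-- Uniform continuity on a compact square. The square exceeds |s|, |y| ≤ m by 1 because corners may
lie outside that range, and the rate 2⁻ᵐ is made for `ae_tendsto_of_norm_le`. -/
theorem exists_mesh {E : Type*} [NormedAddCommGroup E] {u : ℝ × ℝ → E} (hu : Continuous u)
    (m : ℕ) : ∃ h : ℝ, 0 < h ∧ h ≤ 1 / (m + 1) ∧ ∀ s y : ℝ, |s| ≤ m → |y| ≤ m →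
      ‖u (timeIdx h s * h, spaceIdx h y * h) - u (s, y)‖ ≤ (1 / 2) ^ m := by
  have hK : IsCompact (Set.Icc (-(m : ℝ) - 1) (m + 1) ×ˢ Set.Icc (-(m : ℝ) - 1) (m + 1)) :=
    isCompact_Icc.prod isCompact_Icc
  obtain ⟨δ, hδ, H⟩ := Metric.uniformContinuousOn_iff.1
    (hK.uniformContinuousOn_of_continuous hu.continuousOn) ((1 / 2) ^ m) (by positivity)
  have hm0 : (0 : ℝ) < 1 / (m + 1) := by positivity
  have hm1 : (1 : ℝ) / (m + 1) ≤ 1 := by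
    rw [div_le_one (by positivity)]
    linarith [(Nat.cast_nonneg m : (0 : ℝ) ≤ m)]
  refine ⟨min (δ / 2) (1 / (m + 1)), lt_min (by positivity) hm0, min_le_right _ _,
    fun s y hs hy => ?_⟩
  set h := min (δ / 2) (1 / (m + 1) : ℝ) with hh'
  have hh : 0 < h := lt_min (by positivity) hm0
  have h1 : h ≤ 1 := (min_le_right _ _).trans hm1
  have hhδ : h ≤ δ / 2 := min_le_left _ _
  have a1 := timeIdx_mul_lt hh s
  have a2 := le_timeIdx_mul hh s
  have a3 := spaceIdx_mul_le hh y
  have a4 := lt_spaceIdx_mul hh y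
  rw [abs_le] at hs hy
  rw [← dist_eq_norm]
  refine (H _ ?_ _ ?_ ?_).le
  · exact ⟨⟨by linarith, by linarith⟩, ⟨by linarith, by linarith⟩⟩
  · exact ⟨⟨by linarith, by linarith⟩, ⟨by linarith, by linarith⟩⟩
  · rw [Prod.dist_eq, max_lt_iff, Real.dist_eq, Real.dist_eq, abs_lt, abs_lt]
    refine ⟨⟨?_, ?_⟩, ⟨?_, ?_⟩⟩ <;> simp only <;> linarith

/-- Continuous adapted fields have predictable versions. -/
theorem exists_predictable_version {u : ℝ → ℝ → HSp P}
    (hc : Continuous fun q : ℝ × ℝ => u q.1 q.2) (ha : ∀ t x, AdaptedAt P N ν t (u t x)) :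
    ∃ v : ℝ → ℝ → Ω → ℝ, IsPredictable P N ν (fun ξ => v ξ.1 ξ.2.1) ∧
      ∀ t x, 0 < t → v t x =ᵐ[P] u t x := by
  choose h hpos hle hbound using exists_mesh hc
  set Y : ℕ → ℤ → ℤ → Ω → ℝ := fun m i j =>
    (ha (i * h m) (j * h m)).mk (u (i * h m) (j * h m)) with hY
  set V : ℕ → ℝ → ℝ → Ω → ℝ := fun m s y ω => if 1 ≤ timeIdx (h m) s then
    Y m (timeIdx (h m) s) (spaceIdx (h m) y) ω else 0 with hV
  -- A limsup is predictable and defined everywhere, with no need to know where the step fields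
  -- converge; at each fixed point of positive time it equals the almost sure limit.
  refine ⟨fun s y ω => limsup (fun m => V m s y ω) atTop, ?_, fun t x ht => ?_⟩
  · exact Measurable.limsup fun m => isPredictable_step (hpos m) fun i j =>
      (ha (i * h m) (j * h m)).stronglyMeasurable_mk.measurable
  · have h1 : ∀ᵐ ω ∂P, ∀ m, u (timeIdx (h m) t * h m) (spaceIdx (h m) x * h m) ω =
        Y m (timeIdx (h m) t) (spaceIdx (h m) x) ω :=
      ae_all_iff.2 fun m => (ha _ _).ae_eq_mk
    have h2 := ae_tendsto_of_norm_le (f := fun m => u (timeIdx (h m) t * h m)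
      (spaceIdx (h m) x * h m)) (f' := u t x) (by
        filter_upwards [eventually_ge_atTop ⌈|t|⌉₊, eventually_ge_atTop ⌈|x|⌉₊] with m h3 h4
        exact hbound m t x ((Nat.le_ceil _).trans (by exact_mod_cast h3))
          ((Nat.le_ceil _).trans (by exact_mod_cast h4)))
    have h5 : ∀ᶠ m in atTop, 1 ≤ timeIdx (h m) t := by
      have h6 : Tendsto (fun m : ℕ => 1 / ((m : ℝ) + 1)) atTop (𝓝 0) :=
        tendsto_one_div_add_atTop_nhds_zero_nat
      filter_upwards [h6.eventually_lt_const ht] with m hm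
      have h7 := le_timeIdx_mul (hpos m) t
      have h8 := hle m
      by_contra hlt
      have h9 : (timeIdx (h m) t : ℝ) ≤ 0 := by exact_mod_cast (by omega : timeIdx (h m) t ≤ 0)
      nlinarith [hpos m]
    filter_upwards [h1, h2] with ω h3 h4
    refine Tendsto.limsup_eq (h4.congr' ?_)
    filter_upwards [h5] with m hm
    rw [h3 m, hV]
    simp only
    rw [if_pos hm]

end Predictable

end LevyWave

namespace LevyWave

/-! ### Existence, uniqueness and expansion for predictable solutions. -/

section Solution

variable {Ω : Type*} [mΩ : MeasurableSpace Ω] {P : Measure Ω} {N : Ω → Measure Pt} {ν : Measure ℝ}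
  [IsProbabilityMeasure P] [SigmaFinite ν]

theorem IsPredictable.aestronglyMeasurable (hN : IsPoissonRandomMeasure P N (intensity ν))
    {V : Pt → Ω → ℝ} (hV : IsPredictable P N ν V) {μ : Measure (Pt × Ω)} :
    AEStronglyMeasurable (fun q : Pt × Ω => V q.1 q.2) μ :=
  (hV.mono (predictableSigma_le hN) le_rfl).aestronglyMeasurable

theorem ElementaryProcess.aestronglyMeasurable_toFun
    (hN : IsPoissonRandomMeasure P N (intensity ν)) (W : ElementaryProcess P N ν)
    {μ : Measure (Pt × Ω)} : AEStronglyMeasurable (fun q : Pt × Ω => W.toFun q.1 q.2) μ := by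
  refine Measurable.aestronglyMeasurable ?_
  unfold ElementaryProcess.toFun
  refine Finset.measurable_sum _ fun i _ => Measurable.mul ?_ ?_
  · exact ((W.measurable_Y i).mono (noiseSigma_le hN _) le_rfl).comp measurable_snd
  · exact (measurable_const.indicator
      ((W.finiteRect i).measurableSet measurableSet_Ioc)).comp measurable_fst

/-- Passage from the Hilbert space valued integral to the Itô integral of predictable fields. -/
theorem isItoIntegral_of_itoRel (hN : IsPoissonRandomMeasure P N (intensity ν)) {V : Pt → Ω → ℝ}
    (hV : IsPredictable P N ν V) {U : Pt → HSp P} (hVU : ∀ᵐ ξ ∂intensity ν, V ξ =ᵐ[P] U ξ)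
    {X : HSp P} (hX : ItoRel P N ν U X) {W : ℕ → ElementaryProcess P N ν}
    (hW : Tendsto (fun k => eLpNorm (fun ξ => (W k).toHilbert hN ξ - U ξ) 2 (intensity ν))
      atTop (𝓝 0)) : IsItoIntegral P N ν V X where
  predictable := hV
  memLp := by
    have hm := hV.aestronglyMeasurable hN (μ := (intensity ν).prod P)
    exact ⟨hm, (eLpNorm_prod_eq_eLpNorm_hilbert hm hVU).trans_lt hX.1.2⟩
  memLp_integral := Lp.memLp X
  approx := by
    refine ⟨W, hW.congr fun k => ?_, ?_⟩
    · symm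
      have hm := (hV.aestronglyMeasurable hN (μ := (intensity ν).prod P)).sub
        ((W k).aestronglyMeasurable_toFun hN)
      have h1 := eLpNorm_prod_eq_eLpNorm_hilbert (f := fun ξ ω => V ξ ω - (W k).toFun ξ ω)
        (g := fun ξ => U ξ - (W k).toHilbert hN ξ) hm (by
          filter_upwards [hVU] with ξ h2
          filter_upwards [h2, (W k).toHilbert_coe hN ξ, Lp.coeFn_sub (U ξ) ((W k).toHilbert hN ξ)]
            with ω h3 h4 h5
          rw [h5, Pi.sub_apply, h3, h4])
      exact h1.trans (eLpNorm_sub_comm _ _ _ _)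
    · obtain ⟨X', h1, h2⟩ := ItoRel.exists_of_tendsto hN (fun k => (W k).itoRel hN) hX.1 hW
      obtain rfl := hX.unique hN h1
      refine ((Lp.tendsto_Lp_iff_tendsto_eLpNorm' _ _).1 h2).congr fun k => ?_
      rw [eLpNorm_sub_comm]
      refine eLpNorm_congr_ae ?_
      filter_upwards [((W k).memLp_integral hN).coeFn_toLp] with ω h3
      rw [Pi.sub_apply, h3]

theorem ElementaryProcess.eLpNorm_integral_sub (hN : IsPoissonRandomMeasure P N (intensity ν))
    (W W' : ElementaryProcess P N ν) :
    eLpNorm (fun ω => W.integral ω - W'.integral ω) 2 P =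
      eLpNorm (fun q : Pt × Ω => W.toFun q.1 q.2 - W'.toFun q.1 q.2) 2 ((intensity ν).prod P) := by
  have h1 := ((W.itoRel hN).sub (W'.itoRel hN)).enorm_eq hN
  rw [← MemLp.toLp_sub, Lp.enorm_toLp] at h1
  refine h1.trans (eLpNorm_prod_eq_eLpNorm_hilbert
    (f := fun ξ ω => W.toFun ξ ω - W'.toFun ξ ω)
    ((W.aestronglyMeasurable_toFun hN).sub (W'.aestronglyMeasurable_toFun hN))
    (ae_of_all _ fun ξ => ?_)).symm
  filter_upwards [W.toHilbert_coe hN ξ, W'.toHilbert_coe hN ξ,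
    Lp.coeFn_sub (W.toHilbert hN ξ) (W'.toHilbert hN ξ)] with ω h3 h4 h5
  rw [h5, Pi.sub_apply, h3, h4]

theorem eLpNorm_sub_le_of_sub {α : Type*} [MeasurableSpace α] {μ : Measure α} {f g f' g' : α → ℝ}
    (hf : AEStronglyMeasurable f μ) (hg : AEStronglyMeasurable g μ)
    (hf' : AEStronglyMeasurable f' μ) (hg' : AEStronglyMeasurable g' μ) :
    eLpNorm (fun a => f a - g a) 2 μ ≤ eLpNorm (fun a => f a - f' a) 2 μ +
      eLpNorm (fun a => f' a - g' a) 2 μ + eLpNorm (fun a => g a - g' a) 2 μ := by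
  have e : (fun a => f a - g a) = ((fun a => f a - f' a) + fun a => f' a - g' a) -
      fun a => g a - g' a := by
    funext a
    simp only [Pi.sub_apply, Pi.add_apply]
    ring
  rw [e]
  refine (eLpNorm_sub_le ((hf.sub hf').add (hf'.sub hg')) (hg.sub hg') (by norm_num)).trans ?_
  exact add_le_add (eLpNorm_add_le (hf.sub hf') (hf'.sub hg') (by norm_num)) le_rfl

/-- The isometry transferred to the predictable notion of integral, which is defined by
approximating sequences: it is exact for the approximants, and the triangle inequality passes to the
limit. This is all that uniqueness needs. -/
theorem IsItoIntegral.eLpNorm_sub_le (hN : IsPoissonRandomMeasure P N (intensity ν))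
    {V V' : Pt → Ω → ℝ} {X X' : Ω → ℝ} (h : IsItoIntegral P N ν V X)
    (h' : IsItoIntegral P N ν V' X') : eLpNorm (fun ω => X ω - X' ω) 2 P ≤
      eLpNorm (fun q : Pt × Ω => V q.1 q.2 - V' q.1 q.2) 2 ((intensity ν).prod P) := by
  obtain ⟨W, hW1, hW2⟩ := h.approx
  obtain ⟨W', hW1', hW2'⟩ := h'.approx
  have hb : ∀ k, eLpNorm (fun ω => X ω - X' ω) 2 P ≤
      eLpNorm (fun ω => X ω - (W k).integral ω) 2 P +
      (eLpNorm (fun q : Pt × Ω => V q.1 q.2 - (W k).toFun q.1 q.2) 2 ((intensity ν).prod P) +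
        eLpNorm (fun q : Pt × Ω => V q.1 q.2 - V' q.1 q.2) 2 ((intensity ν).prod P) +
        eLpNorm (fun q : Pt × Ω => V' q.1 q.2 - (W' k).toFun q.1 q.2) 2 ((intensity ν).prod P)) +
      eLpNorm (fun ω => X' ω - (W' k).integral ω) 2 P := by
    intro k
    refine (eLpNorm_sub_le_of_sub h.memLp_integral.1 h'.memLp_integral.1
      ((W k).memLp_integral hN).1 ((W' k).memLp_integral hN).1).trans ?_
    gcongr
    rw [ElementaryProcess.eLpNorm_integral_sub hN]
    refine (eLpNorm_sub_le_of_sub ((W k).aestronglyMeasurable_toFun hN)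
      ((W' k).aestronglyMeasurable_toFun hN) h.memLp.1 h'.memLp.1).trans ?_
    gcongr
    · exact (eLpNorm_sub_comm _ _ _ _).le
    · exact (eLpNorm_sub_comm _ _ _ _).le
  have hlim := (hW2.add ((hW1.add_const (eLpNorm (fun q : Pt × Ω => V q.1 q.2 - V' q.1 q.2) 2
    ((intensity ν).prod P))).add hW1')).add hW2'
  simp only [zero_add, add_zero] at hlim
  exact ge_of_tendsto' hlim hb

theorem eLpNorm_two_sq {α : Type*} [MeasurableSpace α] {μ : Measure α} (f : α → ℝ) :
    eLpNorm f 2 μ ^ 2 = ∫⁻ a, ‖f a‖ₑ ^ 2 ∂μ := by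
  rw [eLpNorm_eq_lintegral_rpow_enorm_toReal (by simp) (by simp), ← ENNReal.rpow_natCast,
    ← ENNReal.rpow_mul]
  norm_num

variable {r y z : ℝ}

/-- Pathwise uniqueness of mild solutions. -/
theorem IsSolution.unique (hν : levyMoment ν 2 < ∞)
    (hN : IsPoissonRandomMeasure P N (intensity ν)) (hr : 0 ≤ r) {w v : ℝ → ℝ → Ω → ℝ}
    (hw : IsSolution P N ν r y z w) (hv : IsSolution P N ν r y z v) {t₀ : ℝ} (x₀ : ℝ)
    (ht₀ : r < t₀) : w t₀ x₀ =ᵐ[P] v t₀ x₀ := by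
  set E : ℝ → ℝ → ℝ≥0∞ := fun t x => ∫⁻ ω, ‖w t x ω - v t x ω‖ₑ ^ 2 ∂P with hE
  -- The squared L² norm of the difference of the two integrands. It dominates `E` by the isometry
  -- and is finite because both integrands are square integrable.
  set R : ℝ → ℝ → ℝ≥0∞ := fun t x => ∫⁻ ξ, (if r < ξ.1 ∧ |x - ξ.2.1| < t - ξ.1 then
    ENNReal.ofReal (1 / 4) * E ξ.1 ξ.2.1 else 0) * ENNReal.ofReal (|ξ.2.2| ^ (2 : ℝ))
      ∂intensity ν with hR
  have hER : ∀ t x, r < t → E t x ≤ R t x ∧ R t x ≠ ∞ := by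
    intro t x ht
    obtain ⟨X, hX1, hX2⟩ := hw.mild t x ht
    obtain ⟨X', hX1', hX2'⟩ := hv.mild t x ht
    have h1 := hX1.eLpNorm_sub_le hN hX1'
    have h2 := hX1.memLp.sub hX1'.memLp
    have h3 : eLpNorm (fun ω => X ω - X' ω) 2 P ^ 2 = E t x := by
      rw [eLpNorm_two_sq]
      refine lintegral_congr_ae ?_
      filter_upwards [hX2, hX2'] with ω h4 h5
      rw [h4, h5, add_sub_add_left_eq_sub]
    have h4 : eLpNorm _ 2 ((intensity ν).prod P) ^ 2 = R t x :=
      (eLpNorm_two_sq _).trans ((lintegral_prod _ (h2.1.enorm.pow_const 2)).trans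
        (lintegral_congr fun ξ => ?_))
    · rw [← h3, ← h4]
      exact ⟨by gcongr; exact h1, ENNReal.pow_ne_top h2.2.ne⟩
    · have e : ∀ ω, ‖(Set.Ioo r t).indicator (fun _ => (1 : ℝ)) ξ.1 *
          waveG (t - ξ.1) (x - ξ.2.1) * w ξ.1 ξ.2.1 ω * ξ.2.2 -
          (Set.Ioo r t).indicator (fun _ => (1 : ℝ)) ξ.1 *
          waveG (t - ξ.1) (x - ξ.2.1) * v ξ.1 ξ.2.1 ω * ξ.2.2‖ₑ ^ 2 =
          (if r < ξ.1 ∧ |x - ξ.2.1| < t - ξ.1 then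
            ENNReal.ofReal (1 / 4) * ENNReal.ofReal (|ξ.2.2| ^ (2 : ℝ)) else 0) *
            ‖w ξ.1 ξ.2.1 ω - v ξ.1 ξ.2.1 ω‖ₑ ^ 2 := by
        intro ω
        rw [ofReal_abs_rpow_two]
        split_ifs with hc
        · have hm : ξ.1 ∈ Set.Ioo r t :=
            ⟨hc.1, by have := (abs_nonneg _).trans_lt hc.2; linarith⟩
          rw [Set.indicator_of_mem hm, waveG, if_pos hc.2]
          have h6 : ENNReal.ofReal (1 / 4) = ‖(1 / 2 : ℝ)‖ₑ ^ 2 := by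
            rw [Real.enorm_eq_ofReal (by norm_num), ← ENNReal.ofReal_pow (by norm_num)]
            norm_num
          rw [h6, ← mul_pow, ← mul_pow, ← enorm_mul, ← enorm_mul]
          congr 2
          ring
        · have h6 : (Set.Ioo r t).indicator (fun _ => (1 : ℝ)) ξ.1 *
              waveG (t - ξ.1) (x - ξ.2.1) = 0 := by
            by_cases h7 : r < ξ.1
            · rw [waveG, if_neg fun h8 => hc ⟨h7, h8⟩, mul_zero]
            · rw [Set.indicator_of_notMem fun h8 => h7 h8.1, zero_mul]
          rw [h6]
          simp
      refine (lintegral_congr e).trans ?_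
      rw [lintegral_const_mul' _ _ (by split_ifs <;> finiteness)]
      split_ifs
      · ring
      · simp
  -- Solutions are not assumed locally bounded. But backward cones are nested, so finiteness of R at
  -- (t₀,x₀) alone bounds E on the whole cone below it and starts the iteration.
  have hRmono : ∀ t x, |x₀ - x| ≤ t₀ - t → R t x ≤ R t₀ x₀ := by
    intro t x h
    refine lintegral_mono fun ξ => ?_
    gcongr ?_ * _
    split_ifs with h1 h2
    · exact le_rfl
    · refine absurd ⟨h1.1, ?_⟩ h2
      have := abs_sub_le x₀ x ξ.2.1
      linarith [h1.2]
    · exact zero_le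
    · exact le_rfl
  set b := (R t₀ x₀).toReal
  set l := 2 * (levyMoment ν 2).toReal * t₀ + 1 with hl
  have ht₀' : 0 ≤ t₀ := hr.trans ht₀.le
  have hl0 : 0 < l := by positivity
  have hmain : ∀ (n : ℕ) (t x : ℝ), r < t → |x₀ - x| ≤ t₀ - t →
      E t x ≤ ENNReal.ofReal (b * (1 / 4) ^ n * Real.exp (l * t)) := by
    intro n
    induction n with
    | zero =>
      intro t x ht hx
      refine (hER t x ht).1.trans ((hRmono t x hx).trans ?_)
      rw [← ENNReal.ofReal_toReal (hER t₀ x₀ ht₀).2, pow_zero, mul_one]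
      refine ENNReal.ofReal_le_ofReal (le_mul_of_one_le_right ENNReal.toReal_nonneg ?_)
      have : 0 < t := hr.trans_lt ht
      exact Real.one_le_exp (by positivity)
    | succ n ih =>
      intro t x ht hx
      have htT : t ≤ t₀ := by have := abs_nonneg (x₀ - x); linarith
      have hb : 0 ≤ b * (1 / 4) ^ n := mul_nonneg ENNReal.toReal_nonneg (by positivity)
      refine (hER t x ht).1.trans ?_
      calc R t x ≤ ∫⁻ ξ, ENNReal.ofReal (1 / 4) * ((if |x - ξ.2.1| < t - ξ.1 then
            ENNReal.ofReal (b * (1 / 4) ^ n * Real.exp (l * ξ.1)) else 0) *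
              ENNReal.ofReal (|ξ.2.2| ^ (2 : ℝ))) ∂intensity ν := by
            refine lintegral_mono fun ξ => ?_
            rw [← mul_assoc]
            gcongr ?_ * _
            split_ifs with h1 h2 h2
            · gcongr
              refine ih _ _ h1.1 ?_
              have := abs_sub_le x₀ x ξ.2.1
              linarith [h1.2]
            · exact absurd h1.2 h2
            · exact zero_le
            · exact zero_le
        _ = ENNReal.ofReal (1 / 4) * (levyMoment ν 2 * ∫⁻ s in Set.Ici 0,
            ENNReal.ofReal (2 * (t - s)) *
              ENNReal.ofReal (b * (1 / 4) ^ n * Real.exp (l * s))) := by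
            rw [lintegral_const_mul' _ _ (by finiteness), lintegral_cone
              (φ := fun s => ENNReal.ofReal (b * (1 / 4) ^ n * Real.exp (l * s))) (by fun_prop)]
        _ ≤ ENNReal.ofReal (b * (1 / 4) ^ n / 4 * Real.exp (l * t)) :=
            cone_exp_le hν htT ht₀' hb (by linarith) hl0
        _ = _ := by rw [pow_succ]; congr 1; ring
  have hzero : E t₀ x₀ = 0 := by
    have h1 : Tendsto (fun n : ℕ => ENNReal.ofReal (b * (1 / 4) ^ n * Real.exp (l * t₀))) atTop
        (𝓝 0) := by
      have h2 : Tendsto (fun n : ℕ => b * (1 / 4 : ℝ) ^ n * Real.exp (l * t₀)) atTop (𝓝 0) := by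
        simpa using ((tendsto_pow_atTop_nhds_zero_of_lt_one (r := (1 / 4 : ℝ)) (by norm_num)
          (by norm_num)).const_mul b).mul_const (Real.exp (l * t₀))
      simpa using ENNReal.tendsto_ofReal h2
    exact le_antisymm (ge_of_tendsto' h1 fun n => hmain n t₀ x₀ ht₀ (by simp)) zero_le
  obtain ⟨X, hX1, hX2⟩ := hw.mild t₀ x₀ ht₀
  obtain ⟨X', hX1', hX2'⟩ := hv.mild t₀ x₀ ht₀
  have hmeas : AEMeasurable (fun ω => ‖w t₀ x₀ ω - v t₀ x₀ ω‖ₑ ^ 2) P := by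
    refine ((hX1.memLp_integral.1.sub hX1'.memLp_integral.1).enorm.pow_const 2).congr ?_
    filter_upwards [hX2, hX2'] with ω h4 h5
    rw [h4, h5, add_sub_add_left_eq_sub, Pi.sub_apply]
  filter_upwards [(lintegral_eq_zero_iff' hmeas).1 hzero] with ω hω
  simpa [sub_eq_zero] using hω

/-- Existence: the `L²(Ω)`-valued field `solH` has a version that is a mild solution. -/
theorem exists_isSolution (h0 : ν {0} = 0) (hν : levyMoment ν 2 < ∞)
    (hN : IsPoissonRandomMeasure P N (intensity ν)) (hr : 0 ≤ r) (y z : ℝ) :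
    ∃ v : ℝ → ℝ → Ω → ℝ, IsSolution P N ν r y z v ∧
      ∀ t x, v t x =ᵐ[P] solH P N ν r y z t x := by
  obtain ⟨u, hu, huv⟩ := exists_predictable_version (continuous_tail h0 hν hN hr y z)
    (adaptedAt_tail h0 hν hN hr y z)
  -- The indicator makes v vanish identically up to time r, which gives the initial condition for
  -- every ω and not just almost surely. The free term is kept explicit, as only the tail has a
  -- version by continuity.
  set v : ℝ → ℝ → Ω → ℝ := fun t x ω =>
    (Set.Ioi r).indicator (fun _ => (1 : ℝ)) t * (waveG (t - r) (x - y) * z + u t x ω) with hv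
  have hvt : ∀ t x ω, r < t → v t x ω = waveG (t - r) (x - y) * z + u t x ω := by
    intro t x ω ht
    rw [hv]
    simp only
    rw [Set.indicator_of_mem (Set.mem_Ioi.2 ht), one_mul]
  have hv0 : ∀ t x ω, t ≤ r → v t x ω = 0 := by
    intro t x ω ht
    rw [hv]
    simp only
    rw [Set.indicator_of_notMem (by simpa using ht), zero_mul]
  have hdet : ∀ {f : Pt → ℝ}, Measurable f → (∀ ξ : Pt, ξ.1 ≤ r → f ξ = 0) →
      IsPredictable P N ν fun ξ _ => f ξ := fun hf h =>
    isPredictable_of_measurable hf fun ξ hξ => h ξ (hξ.trans hr)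
  have hind : Measurable fun ξ : Pt => (Set.Ioi r).indicator (fun _ => (1 : ℝ)) ξ.1 :=
    (measurable_const.indicator measurableSet_Ioi).comp measurable_fst
  have hG : Measurable fun ξ : Pt => waveG (ξ.1 - r) (ξ.2.1 - y) :=
    measurable_waveG.comp (f := fun ξ : Pt => (ξ.1 - r, ξ.2.1 - y)) (by fun_prop)
  have hpred : IsPredictable P N ν (fun ξ => v ξ.1 ξ.2.1) := by
    have h1 : IsPredictable P N ν fun ξ _ => (Set.Ioi r).indicator (fun _ => (1 : ℝ)) ξ.1 :=
      hdet hind fun ξ hξ => Set.indicator_of_notMem (by simpa using hξ) _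
    have h2 : IsPredictable P N ν fun ξ _ => waveG (ξ.1 - r) (ξ.2.1 - y) * z :=
      hdet (hG.mul_const z) fun ξ hξ => by
        rw [waveG_eq_zero (by have := abs_nonneg (ξ.2.1 - y); linarith), zero_mul]
    exact Measurable.mul h1 (Measurable.add h2 hu)
  have hvsol : ∀ t x, v t x =ᵐ[P] solH P N ν r y z t x := by
    intro t x
    rcases le_or_gt t r with ht | ht
    · rw [solH_eq_zero h0 hν hN (by have := abs_nonneg (x - y); linarith)]
      filter_upwards [Lp.coeFn_zero ℝ 2 P] with ω hω
      rw [hv0 t x ω ht, hω, Pi.zero_apply]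
    · rw [solH_eq h0 hν hN hr]
      filter_upwards [huv t x (hr.trans_lt ht), Lp.coeFn_add
        (Lp.const 2 P (waveG (t - r) (x - y) * z) : HSp P)
        (∑' n, picardTerm P N ν r y z (n + 1) t x),
        Lp.coeFn_const (p := 2) (μ := P) (waveG (t - r) (x - y) * z)] with ω h1 h2 h3
      rw [hvt t x ω ht, h2, Pi.add_apply, h3, h1, Function.const_apply]
  refine ⟨v, ⟨hpred, fun x ω => hv0 r x ω le_rfl, fun t x ht =>
    ⟨(∑' n, picardTerm P N ν r y z (n + 1) t x : HSp P), ?_, ?_⟩⟩, hvsol⟩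
  · refine isItoIntegral_of_itoRel hN ?_ (ae_of_all _ fun ξ => ?_)
      (itoRel_solH h0 hν hN hr y z t x)
      (waveApprox_tendsto h0 hν hN fullGrid (isWaveField_solH h0 hν hN hr y z) t x
        fun s _ => fullGrid_tendsto_K.eventually_ge_atTop s).2
    · have h1 : IsPredictable P N ν fun ξ _ => (Set.Ioo r t).indicator (fun _ => (1 : ℝ)) ξ.1 *
          waveG (t - ξ.1) (x - ξ.2.1) * ξ.2.2 := by
        refine hdet ?_ fun ξ hξ => ?_
        · exact (((measurable_const.indicator measurableSet_Ioo).comp measurable_fst).mul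
            (measurable_waveG.comp (f := fun ξ : Pt => (t - ξ.1, x - ξ.2.1)) (by fun_prop))).mul
            (by fun_prop)
        · rw [Set.indicator_of_notMem (fun h => absurd h.1 (not_lt.2 hξ)), zero_mul, zero_mul]
      have h2 : IsPredictable P N ν fun ξ ω => (Set.Ioo r t).indicator (fun _ => (1 : ℝ)) ξ.1 *
          waveG (t - ξ.1) (x - ξ.2.1) * ξ.2.2 * v ξ.1 ξ.2.1 ω := Measurable.mul h1 hpred
      convert h2 using 3
      ring
    · filter_upwards [hvsol ξ.1 ξ.2.1, Lp.coeFn_smul (waveG (t - ξ.1) (x - ξ.2.1) * ξ.2.2)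
        (solH P N ν r y z ξ.1 ξ.2.1)] with ω h1 h2
      rw [waveIntegrand, h2, Pi.smul_apply, smul_eq_mul, ← h1]
      by_cases hs : ξ.1 ∈ Set.Ioo r t
      · rw [Set.indicator_of_mem hs]
        ring
      · rw [Set.indicator_of_notMem hs]
        by_cases hs' : r < ξ.1
        · have : t ≤ ξ.1 := by
            by_contra h
            exact hs ⟨hs', not_le.1 h⟩
          rw [waveG_eq_zero (by have := abs_nonneg (x - ξ.2.1); linarith)]
          simp
        · rw [hv0 _ _ _ (not_lt.1 hs')]
          simp
  · filter_upwards [huv t x (hr.trans_lt ht)] with ω hω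
    rw [hvt t x ω ht, hω]

theorem tendsto_chaos_expansion (h0 : ν {0} = 0) (hν : levyMoment ν 2 < ∞)
    (hN : IsPoissonRandomMeasure P N (intensity ν)) (hr : 0 ≤ r) (y z t x : ℝ) :
    Tendsto (fun M : ℕ => eLpNorm (fun ω => solH P N ν r y z t x ω -
      (waveG (t - r) (x - y) * z + ∑ n ∈ Finset.Icc 1 M, picardTerm P N ν r y z n t x ω)) 2 P)
      atTop (𝓝 0) := by
  have h1 := (tendsto_add_atTop_iff_nat 1).2
    (summable_picardTerm h0 hν hN hr y z t x).hasSum.tendsto_sum_nat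
  refine ((Lp.tendsto_Lp_iff_tendsto_eLpNorm' _ _).1 h1).congr fun M => ?_
  rw [eLpNorm_sub_comm]
  refine eLpNorm_congr_ae ?_
  filter_upwards [Lp.coeFn_finsetSum (Finset.range (M + 1))
      (fun n => picardTerm P N ν r y z n t x),
    Lp.coeFn_const (p := 2) (μ := P) (waveG (t - r) (x - y) * z)] with ω h2 h3
  rw [Pi.sub_apply, h2, Finset.sum_apply, Finset.sum_range_eq_add_Ico _ (by omega)]
  have h4 : picardTerm P N ν r y z 0 t x ω = waveG (t - r) (x - y) * z := h3
  rw [h4]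
  rfl

end Solution

end LevyWave

/-! ### The theorem. -/

theorem proposition3p1 :
    -- the constants `B p` depend on `p` only
    ∃ B : ℝ → ℝ, (∀ p, 2 ≤ p → 0 < B p) ∧
    ∀ (ν : Measure ℝ) [SigmaFinite ν] (Ω : Type*) [MeasurableSpace Ω] (P : Measure Ω)
      [IsProbabilityMeasure P] (N : Ω → Measure LevyWave.Pt),
      ν {0} = 0 → LevyWave.levyMoment ν 2 < ∞ →
      LevyWave.IsPoissonRandomMeasure P N (LevyWave.intensity ν) →
    ∀ r y z : ℝ, 0 ≤ r → z ≠ 0 →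
    ∃ v : ℝ → ℝ → Ω → ℝ,
      -- (i) existence, uniqueness, moment bound
      LevyWave.IsSolution P N ν r y z v ∧
      (∀ w : ℝ → ℝ → Ω → ℝ, LevyWave.IsSolution P N ν r y z w →
        ∀ t x, r ≤ t → ∀ᵐ ω ∂P, w t x ω = v t x ω) ∧
      (∀ p : ℝ, 2 ≤ p → LevyWave.levyMoment ν p < ∞ → ∀ T : ℝ, 0 < T →
        ∀ t x, r ≤ t → t ≤ T →
          eLpNorm (v t x) (ENNReal.ofReal p) P ≤
            ENNReal.ofReal (LevyWave.momentConst (B p) T p ν * |z|)) ∧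
      -- (ii) chaos expansion in `L²(P)`
      (∀ t x, r < t → ∃ J : ℕ → Ω → ℝ,
        (∀ n, 1 ≤ n → LevyWave.IsMultipleIntegral P N ν n
          (LevyWave.chaosKernel r y z n t x) (J n)) ∧
        Tendsto (fun M : ℕ => eLpNorm (fun ω => v t x ω -
          (LevyWave.waveG (t - r) (x - y) * z + ∑ n ∈ Finset.Icc 1 M, J n ω)) 2 P)
          atTop (𝓝 0)) ∧
      -- (iii) light cone
      (∀ t x, r < t → t - r ≤ |x - y| → ∀ᵐ ω ∂P, v t x ω = 0) ∧
      (∀ t x, r < t → ∀ᵐ ω ∂P,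
        LevyWave.waveG (t - r) (x - y) * v t x ω = 1 / 2 * v t x ω) := by
  refine ⟨LevyWave.momentB, fun p _ => LevyWave.momentB_pos p, ?_⟩
  intro ν _ Ω _ P _ N h0 hν hN r y z hr _
  obtain ⟨v, hv, hvsol⟩ := LevyWave.exists_isSolution h0 hν hN hr y z
  have hcone : ∀ t x, t - r ≤ |x - y| → ∀ᵐ ω ∂P, v t x ω = 0 := by
    intro t x h
    filter_upwards [hvsol t x, Lp.coeFn_zero ℝ 2 P] with ω h1 h2
    rw [h1, LevyWave.solH_eq_zero h0 hν hN h, h2, Pi.zero_apply]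
  refine ⟨v, hv, fun w hw t x ht => ?_, fun p hp hνp T hT t x _ htT => ?_, fun t x _ => ?_,
    fun t x _ h => hcone t x h, fun t x _ => ?_⟩
  · rcases ht.eq_or_lt with rfl | ht
    · exact ae_of_all _ fun ω => (hw.initial x ω).trans (hv.initial x ω).symm
    · exact hw.unique hν hN hr hv x ht
  · rw [eLpNorm_congr_ae (hvsol t x)]
    exact LevyWave.eLpNorm_solH_le h0 hν hN hr hp hνp hT htT x
  · refine ⟨fun n => LevyWave.picardTerm P N ν r y z n t x, fun n hn =>
      LevyWave.isMultipleIntegral_picardTerm h0 hν hN r y z (by omega) t x, ?_⟩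
    refine (LevyWave.tendsto_chaos_expansion h0 hν hN hr y z t x).congr fun M =>
      eLpNorm_congr_ae ?_
    filter_upwards [hvsol t x] with ω h
    rw [h]
  · by_cases h : |x - y| < t - r
    · exact ae_of_all _ fun ω => by rw [LevyWave.waveG, if_pos h]
    · filter_upwards [hcone t x (not_lt.1 h)] with ω h1
      rw [h1, mul_zero, mul_zero]
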